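/- **Setting.** Let $0<\ell<L$, $\kappa=\ell/L$, $\eta>0$, $\alpha>-\tfrac12$. Let $\mu(\lambda)=(1-m(\lambda)^2)^{\alpha-1/2}$ on $[\ell,L]$, where $m(\lambda)=\frac{2\lambda-L-\ell}{L-\ell}$, and for polynomials $P,Q$ put $\langle P,Q\rangle_\eta=\int_\ell^L PQ\,\mu\,d\lambda+\eta\int_\ell^L P'Q'\,\mu\,d\lambda$. Assume that the orthogonal polynomials for $\langle\cdot,\cdot\rangle_\eta$ can be normalized as residual polynomials, i.e. that there are $S_0,S_1,\dots$ with $\deg S_i=i$, $S_i(0)=1$, $\langle S_i,S_j\rangle_\eta=0$ for $i\neq j$ and $\langle S_i,S_i\rangle_\eta>0$ (this always holds when $\alpha\ge\frac12$). **Coefficients.** Let $\sigma_0=-\frac{L+\ell}{L-\ell}$, $\tilde\eta=\big(\frac{2}{L-\ell}\big)^2\eta$, $\gamma_t=\frac{t(t+2\alpha-1)}{4(t+\alpha)(t+\alpha-1)}$ for $t\ge2$ and $\gamma_1=\frac1{2(\alpha+1)}$, $\xi_t=\frac{(t+2)(t+1)}{4(t+\alpha+1)(t+\alpha)}$ (for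 $\alpha=0$ put $\xi_0=1$), $$d_0=\xi_0,\quad d_1=\tfrac{3}{2(\alpha+2)(\alpha+1)(1+2\tilde\eta(\alpha+1))},\quad d_t=\tfrac{\xi_t\gamma_t\gamma_{t-1}}{\gamma_{t-1}(\tilde\eta t^2+\gamma_t)+\xi_{t-2}(\xi_{t-2}-d_{t-2})}\ (t\ge2),$$ $$\delta_1=\tfrac1{\sigma_0},\quad \delta_t=\tfrac{1}{\sigma_0-\delta_{t-1}\gamma_{t-1}}\ (t\ge2),\qquad h_t=-\tfrac{2\delta_t}{L-\ell},\quad m_t=-\Big(1+\delta_t\tfrac{L+\ell}{L-\ell}\Big)\ (t\ge1),$$ and, with $\kappa_0=\kappa_1=1$, for $t\ge2$, $$\Delta^P_t=\tfrac{\sigma_0\delta_t-1}{\gamma_{t-1}},\quad \kappa_t=\tfrac{1}{1+(d_{t-2}/\kappa_{t-2}-\xi_{t-2})\Delta^P_t},\quad \tau_t=\tfrac{1}{d_{t-2}/\kappa_{t-2}+1/\Delta^P_t-\xi_{t-2}},\quad \Delta^S_t=\tfrac1{d_{t-2}+(1/\Delta^P_t-\xi_{t-2})\kappa_{t-2}},$$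 $$c^{(1)}_t=d_{t-2}\Delta^S_t,\quad c^{(2)}_t=\kappa_t,\quad c^{(3)}_t=\tau_t\xi_{t-2},$$ $$a_0=1,\quad a_1=\tfrac{d_1}{\xi_1\gamma_1}\sigma_0^2,\quad a_t=\tfrac{d_t\,\xi_{t-2}}{\xi_t\,d_{t-2}\,\gamma_t\gamma_{t-1}(\Delta^S_t)^2}\,a_{t-2}\ (t\ge2),\qquad A_t=\sum_{i=0}^t a_i .$$ **(1) Three-stage recursion.** For every $t$ the problem of minimizing $\langle P,P\rangle_\eta$ over polynomials with $\deg P\le t$, $P(0)=1$ has the unique solution $P^\star_t=\frac1{A_t}\sum_{i=0}^t a_iS_i$, and $a_t=\langle S_0,S_0\rangle_\eta/\langle S_t,S_t\rangle_\eta$. For every quadratic $f(x)=\frac12x^\top Hx+b^\top x$ on $\mathbb R^d$ with $H$ symmetric, $\ell I\preceq H\preceq LI$, with minimizer $x_\star$, and every $x_0$, let $y_0=z_0=x_0$, $y_1=y_0-h_1\nabla f(y_0)$, $z_1=y_1$, and $$y_t=y_{t-1}-h_t\nabla f(y_{t-1})+m_t(y_{t-1}-y_{t-2}),\qquad z_t=c^{(1)}_tz_{t-2}+c^{(2)}_ty_t-c^{(3)}_ty_{t-2}\qquad(t\ge2),$$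 $$x_t=\tfrac{A_{t-1}}{A_t}x_{t-1}+\tfrac{a_t}{A_t}z_t\qquad(t\ge1).$$ Then for all $t\ge 0$: $y_t-x_\star=G_t(H)(x_0-x_\star)$, $z_t-x_\star=S_t(H)(x_0-x_\star)$ and $x_t-x_\star=P^\star_t(H)(x_0-x_\star)$, where $G_t$ are the orthogonal polynomials of $L^2(\mu)$ (shifted Gegenbauer polynomials) with $\deg G_t=t$ and $G_t(0)=1$. **(2) Asymptotic recursion.** Let $m=\Big(\frac{1-\sqrt\kappa}{1+\sqrt\kappa}\Big)^2$ and $h=\Big(\frac{2}{\sqrt\ell+\sqrt L}\Big)^2$, the momentum and step size of Polyak's Heavy Ball. As $t\to\infty$, $h_t\to h$, $m_t\to m$, $c^{(1)}_t\to0$, $c^{(2)}_t\to\frac1{1-m}$, $c^{(3)}_t\to\frac m{1-m}$, $\frac{A_{t-1}}{A_t}\to m$, $\frac{a_t}{A_t}\to1-m$; with the coefficients replaced by their limits, the recursion becomes the weighted average of Heavy Ball iterates $$y_t=y_{t-1}-h\nabla f(y_{t-1})+m(y_{t-1}-y_{t-2}),\qquad x_t=y_t+m(x_{t-1}-y_{t-2}).$$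 **(3) Rate.** Let $f(x,\theta)=\frac12x^\top H(\theta)x+b(\theta)^\top x$, $x\in\mathbb R^d$, $\theta\in\mathbb R^k$, with $H(\cdot)$ symmetric, let $x_\star(\cdot)$ be the minimizer of $f(\cdot,\theta')$ for $\theta'$ near $\theta$, and assume that $H$, $b$ and $x_0$ are differentiable at $\theta$, $\ell I\preceq H(\theta)\preceq LI$, and $H(\theta)$ commutes with each $\partial_{\theta_i}H(\theta)$. Then $x_\star$ and the iterates $x_t$ are differentiable at $\theta$, and if $\partial x_0(\theta)\ne\partial x_\star(\theta)$, $$\limsup_{t\to\infty}\sqrt[t]{\frac{\|\partial x_t(\theta)-\partial x_\star(\theta)\|_F}{\|\partial x_0(\theta)-\partial x_\star(\theta)\|_F}}\le\sqrt m ,$$ both for the three-stage algorithm of (1) and for the asymptotic algorithm of (2) (started with $y_{-1}=y_0=x_0$). This is the asymptotic linear rate of the Chebyshev method, whose residual polynomials are $C_t(\lambda)=T_t(m(\lambda))/T_t(m(0))$ with $T_t$ the Chebyshev polynomials of the first kind: its iterates satisfy the same bound, and $\lim_{t\to\infty}\big(\max_{\lambda\in[\ell,L]}|C_t(\lambda)|\big)^{1/t}=\sqrt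 m$. -/

import Mathlib

open Polynomial Filter Topology

noncomputable section

namespace SobolevUnroll

/-! ## Shifted Gegenbauer density, Sobolev product, optimal residual polynomials -/

/-- The affine map sending `[ℓ, L]` onto `[-1, 1]`. -/
def shift (ℓ L lam : ℝ) : ℝ := (2 * lam - L - ℓ) / (L - ℓ)

/-- The shifted Gegenbauer density on `[ℓ, L]`. -/
def density (α ℓ L lam : ℝ) : ℝ := (1 - shift ℓ L lam ^ 2) ^ (α - 1 / 2)

/-- The Sobolev scalar product of two polynomials; for `η = 0` it is the `L²` product. -/
def sobInner (α ℓ L η : ℝ) (P Q : ℝ[X]) : ℝ :=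
  (∫ lam in ℓ..L, P.eval lam * Q.eval lam * density α ℓ L lam) +
    η * ∫ lam in ℓ..L, (derivative P).eval lam * (derivative Q).eval lam * density α ℓ L lam

/-- `S` is the orthogonal sequence (`S i` of degree `i`) for the Sobolev product,
normalized by `S i (0) = 1`. -/
def IsResidualOrthogonal (α ℓ L η : ℝ) (S : ℕ → ℝ[X]) : Prop :=
  (∀ i, (S i).natDegree = i ∧ (S i).eval 0 = 1 ∧ 0 < sobInner α ℓ L η (S i) (S i)) ∧
    ∀ i j, i ≠ j → sobInner α ℓ L η (S i) (S j) = 0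

/-- `P` minimizes the Sobolev norm among the polynomials of degree at most `t` with value `1`
at `0`. -/
def IsOptimalResidual (α ℓ L η : ℝ) (t : ℕ) (P : ℝ[X]) : Prop :=
  P.natDegree ≤ t ∧ P.eval 0 = 1 ∧
    ∀ Q : ℝ[X], Q.natDegree ≤ t → Q.eval 0 = 1 → sobInner α ℓ L η P P ≤ sobInner α ℓ L η Q Q

/-! ## The explicit coefficients -/

/-- The value of the affine map `shift` at `0`. -/
def sigma0 (ℓ L : ℝ) : ℝ := -((L + ℓ) / (L - ℓ))

/-- The parameter `η` rescaled to `[-1, 1]`. -/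
def etaT (ℓ L η : ℝ) : ℝ := (2 / (L - ℓ)) ^ 2 * η

/-- Recurrence coefficients of the monic Gegenbauer polynomials (`t ≥ 1`). The value at `t = 1` is
the simplified form of the general one, which is `0 / 0` at `α = 0`. -/
def gam (α : ℝ) (t : ℕ) : ℝ :=
  if t = 1 then 1 / (2 * (α + 1))
  else t * (t + 2 * α - 1) / (4 * (t + α) * (t + α - 1))

/-- For `α = 0` the value at `t = 0` is infinite, but there it only enters through `d₀ - ξ₀ = 0` and
`ξ₀ / d₀ = 1`, so that any nonzero number may be put in its place. -/
def xi (α : ℝ) (t : ℕ) : ℝ :=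
  if t = 0 ∧ α = 0 then 1
  else (t + 2) * (t + 1) / (4 * (t + α + 1) * (t + α))

/-- The coefficients `d_t` of the Gegenbauer-Sobolev recurrence. -/
def dCoef (α ℓ L η : ℝ) : ℕ → ℝ
  | 0 => xi α 0
  | 1 => 3 / (2 * (α + 2) * (α + 1) * (1 + 2 * etaT ℓ L η * (α + 1)))
  | t + 2 =>
      xi α (t + 2) * gam α (t + 2) * gam α (t + 1) /
        (gam α (t + 1) * (etaT ℓ L η * ((t : ℝ) + 2) ^ 2 + gam α (t + 2)) +
          xi α t * (xi α t - dCoef α ℓ L η t))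

/-- `δ_t`, for `t ≥ 1`; in particular `δ₁ = -(L - ℓ) / (L + ℓ)`. -/
def delta (α ℓ L : ℝ) : ℕ → ℝ
  | 0 => 0
  | t + 1 => 1 / (sigma0 ℓ L - delta α ℓ L t * gam α t)

/-- Step size `h_t` (`t ≥ 1`). -/
def stepSize (α ℓ L : ℝ) (t : ℕ) : ℝ := -(2 * delta α ℓ L t / (L - ℓ))

/-- Momentum `m_t` (`t ≥ 1`, with `m₁ = 0`). -/
def momentum (α ℓ L : ℝ) (t : ℕ) : ℝ := -(1 + delta α ℓ L t * ((L + ℓ) / (L - ℓ)))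

/-- `Δ^P_t`, for `t ≥ 2`. -/
def deltaP (α ℓ L : ℝ) (t : ℕ) : ℝ :=
  -(1 + delta α ℓ L t * ((L + ℓ) / (L - ℓ))) / gam α (t - 1)

/-- `κ_t`. -/
def kap (α ℓ L η : ℝ) : ℕ → ℝ
  | 0 => 1
  | 1 => 1
  | t + 2 =>
      1 / (1 + (dCoef α ℓ L η t / kap α ℓ L η t - xi α t) * deltaP α ℓ L (t + 2))

/-- `τ_t`, for `t ≥ 2`. -/
def tau (α ℓ L η : ℝ) (t : ℕ) : ℝ :=
  1 / (dCoef α ℓ L η (t - 2) / kap α ℓ L η (t - 2) + 1 / deltaP α ℓ L t - xi α (t - 2))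

/-- `Δ^S_t`, for `t ≥ 2`. -/
def deltaS (α ℓ L η : ℝ) (t : ℕ) : ℝ :=
  1 / (dCoef α ℓ L η (t - 2) + (1 / deltaP α ℓ L t - xi α (t - 2)) * kap α ℓ L η (t - 2))

/-- `c⁽¹⁾_t`, for `t ≥ 2`. -/
def c1 (α ℓ L η : ℝ) (t : ℕ) : ℝ := dCoef α ℓ L η (t - 2) * deltaS α ℓ L η t

/-- `c⁽²⁾_t`. -/
def c2 (α ℓ L η : ℝ) (t : ℕ) : ℝ := kap α ℓ L η t

/-- `c⁽³⁾_t`, for `t ≥ 2`. -/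
def c3 (α ℓ L η : ℝ) (t : ℕ) : ℝ := tau α ℓ L η t * xi α (t - 2)

/-- The weights `a_t`, scaled so that `a₀ = 1`. -/
def aCoef (α ℓ L η : ℝ) : ℕ → ℝ
  | 0 => 1
  | 1 => dCoef α ℓ L η 1 / (xi α 1 * gam α 1) * ((L + ℓ) / (L - ℓ)) ^ 2
  | t + 2 =>
      dCoef α ℓ L η (t + 2) * xi α t /
        (xi α (t + 2) * dCoef α ℓ L η t * gam α (t + 2) * gam α (t + 1) *
          deltaS α ℓ L η (t + 2) ^ 2) * aCoef α ℓ L η t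

/-- `A_t = a₀ + ⋯ + a_t`. -/
def ACoef (α ℓ L η : ℝ) (t : ℕ) : ℝ := ∑ i ∈ Finset.range (t + 1), aCoef α ℓ L η i

/-! ## The algorithms, driven by a gradient oracle `g` from a starting point `x₀` -/

section Algorithms

variable {E : Type*} [AddCommGroup E] [Module ℝ E]

/-- Gradient descent with momentum; the first step has no momentum. -/
def momentumIter (h m : ℕ → ℝ) (g : E → E) (x₀ : E) : ℕ → E
  | 0 => x₀
  | 1 => x₀ - h 1 • g x₀
  | t + 2 =>
      momentumIter h m g x₀ (t + 1) - h (t + 2) • g (momentumIter h m g x₀ (t + 1)) +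
        m (t + 2) • (momentumIter h m g x₀ (t + 1) - momentumIter h m g x₀ t)

/-- First stage: the Gegenbauer momentum method `y_t`. -/
def sobY (α ℓ L : ℝ) (g : E → E) (x₀ : E) : ℕ → E :=
  momentumIter (stepSize α ℓ L) (momentum α ℓ L) g x₀

/-- Second stage: the Sobolev combination `z_t`. -/
def sobZ (α ℓ L η : ℝ) (g : E → E) (x₀ : E) : ℕ → E
  | 0 => sobY α ℓ L g x₀ 0
  | 1 => sobY α ℓ L g x₀ 1
  | t + 2 =>
      c1 α ℓ L η (t + 2) • sobZ α ℓ L η g x₀ t + c2 α ℓ L η (t + 2) • sobY α ℓ L g x₀ (t + 2) -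
        c3 α ℓ L η (t + 2) • sobY α ℓ L g x₀ t

/-- Third stage: the weighted average `x_t`. -/
def sobX (α ℓ L η : ℝ) (g : E → E) (x₀ : E) : ℕ → E
  | 0 => x₀
  | t + 1 =>
      (ACoef α ℓ L η t / ACoef α ℓ L η (t + 1)) • sobX α ℓ L η g x₀ t +
        (aCoef α ℓ L η (t + 1) / ACoef α ℓ L η (t + 1)) • sobZ α ℓ L η g x₀ (t + 1)

/-- Momentum of Polyak's Heavy Ball. -/
def hbMomentum (ℓ L : ℝ) : ℝ := ((1 - √(ℓ / L)) / (1 + √(ℓ / L))) ^ 2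

/-- Step size of Polyak's Heavy Ball. -/
def hbStep (ℓ L : ℝ) : ℝ := (2 / (√ℓ + √L)) ^ 2

/-- Polyak's Heavy Ball. -/
def hbY (ℓ L : ℝ) (g : E → E) (x₀ : E) : ℕ → E :=
  momentumIter (fun _ => hbStep ℓ L) (fun _ => hbMomentum ℓ L) g x₀

/-- The weighted average of Heavy Ball iterates, started with `y₋₁ = y₀ = x₀`. -/
def hbX (ℓ L : ℝ) (g : E → E) (x₀ : E) : ℕ → E
  | 0 => x₀
  | 1 => hbY ℓ L g x₀ 1 + hbMomentum ℓ L • (x₀ - x₀)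
  | t + 2 =>
      hbY ℓ L g x₀ (t + 2) + hbMomentum ℓ L • (hbX ℓ L g x₀ (t + 1) - hbY ℓ L g x₀ t)

end Algorithms

/-- The residual polynomials of the Chebyshev method. -/
def chebResidual (ℓ L : ℝ) (t : ℕ) : ℝ[X] :=
  C ((Chebyshev.T ℝ (t : ℤ)).eval (shift ℓ L 0))⁻¹ *
    (Chebyshev.T ℝ (t : ℤ)).comp (C (2 / (L - ℓ)) * X - C ((L + ℓ) / (L - ℓ)))

/-! ## Quadratic problems and Jacobians -/

/-- The quadratic objective `x ↦ ½ xᵀ H x + bᵀ x`. -/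
def quadObj {d : ℕ} (H : EuclideanSpace ℝ (Fin d) →L[ℝ] EuclideanSpace ℝ (Fin d))
    (b x : EuclideanSpace ℝ (Fin d)) : ℝ :=
  1 / 2 * inner ℝ x (H x) + inner ℝ b x

/-- `ℓ I ⪯ H ⪯ L I`. -/
def SpectrumIn {d : ℕ} (ℓ L : ℝ)
    (H : EuclideanSpace ℝ (Fin d) →L[ℝ] EuclideanSpace ℝ (Fin d)) : Prop :=
  ∀ v, ℓ * ‖v‖ ^ 2 ≤ inner ℝ v (H v) ∧ inner ℝ v (H v) ≤ L * ‖v‖ ^ 2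

/-- The Frobenius norm of a linear map. -/
def frob {k d : ℕ} (J : EuclideanSpace ℝ (Fin k) →L[ℝ] EuclideanSpace ℝ (Fin d)) : ℝ :=
  √(∑ i, ‖J (EuclideanSpace.single i 1)‖ ^ 2)

/-- The Jacobian at `θ` of the `t`-th iterate of `x` converges to the Jacobian of `xs` with
asymptotic linear rate at most `ρ`: the upper limit of the `t`-th root of
`‖∂x_t - ∂x⋆‖_F / ‖∂x₀ - ∂x⋆‖_F` is at most `ρ`. -/
def JacobianRateLE {k d : ℕ} (x : ℕ → EuclideanSpace ℝ (Fin k) → EuclideanSpace ℝ (Fin d))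
    (xs : EuclideanSpace ℝ (Fin k) → EuclideanSpace ℝ (Fin d)) (θ : EuclideanSpace ℝ (Fin k))
    (ρ : ℝ) : Prop :=
  limsup (fun t : ℕ => ENNReal.ofReal
      ((frob (fderiv ℝ (x t) θ - fderiv ℝ xs θ) / frob (fderiv ℝ (x 0) θ - fderiv ℝ xs θ)) ^
        (1 / (t : ℝ)))) atTop ≤ ENNReal.ofReal ρ

end SobolevUnroll

end

open SobolevUnroll

/-! On a quadratic each method has error p_t(H)(x₀ - x⋆) for a residual polynomial p_t with p_t(0) =
1. If ∂H commutes with H, differentiation in θ gives p_t'(H) ∂H (x₀ - x⋆) + p_t(H) ∂(x₀ - x⋆). Both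
p_t and p_t' must therefore be small on [ℓ, L], which is why a Sobolev norm is minimized.

Algebra. The affine map onto [-1, 1] sends 0 to σ₀ < -1 and rescales η to η̃. The monic Gegenbauer
polynomials G_t (`gegen`) are coherent with their own weight: G_{t+2}' - ξ_t G_t' = (t+2) G_{t+1}
(`derivative_gegen_sub`). Hence G_{t+2} - ξ_t G_t is Sobolev-orthogonal to every polynomial of
degree < t, and one correction suffices: the monic Sobolev polynomials satisfy Q_{t+2} = d_t Q_t +
G_{t+2} - ξ_t G_t with d_t = ξ_t ‖G_t‖² / ‖Q_t‖², in the L² norm above and the Sobolev norm below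
(`sobMonic_aux`). Normalizing at σ₀ turns the recurrences of G and Q into the first two stages; the
coefficients are built from quotients of values at σ₀ (`delta_succ`, `kap_eq`, `deltaS_add_two`).
The optimal polynomial is the normalized kernel reproducing evaluation at 0, a weighted average of
the S_i (`isOptimalResidual_iff`), and averaging is the third stage. Running the algorithms on ℝ[X]
with "gradient" p ↦ X p yields the residual polynomials themselves (`momentumIter_eq`, `sobX_eq`).

Asymptotics. With z = √m one has -σ₀ = (z + 1/z)/2. The ratios G_{t+1}/G_t at -σ₀ tend to 1/(2z)
(`tendsto_eval_gegen_ratio`), and d_t → 0, so Q_t/G_t → 1 - m at σ₀; all limits follow. On [-1, 1]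
both G_t and G_t' have exponential rate 1/2 (`hasRate_gegen`, `hasRate_derivative_gegen`). Division
by the values at σ₀ contributes a factor 2z, giving rate z = √m for S_t. The recursions of Q and of
the averages preserve the respective rates; Heavy Ball is the case α = 1 and Chebyshev the case α =
0. -/

namespace SobolevUnroll

/-! ## Geometric growth of families of real sequences -/

/-- The family `f t x` grows, uniformly in `x`, at most like `r ^ t` for every `r > ρ`. -/
def HasRate {X : Type*} (ρ : ℝ) (f : ℕ → X → ℝ) : Prop :=
  ∀ r, ρ < r → ∃ C, ∀ t x, |f t x| ≤ C * r ^ t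

/-- A family that is a perturbed `k`-step contraction is bounded by a geometric sequence. -/
theorem exists_bound_of_recurrence {X : Type*} {f : ℕ → X → ℝ} {k N : ℕ} {q r K : ℝ}
    (hr : 0 < r) (hq0 : 0 ≤ q) (hq : q < r ^ k) (hb : ∀ t, ∃ B, ∀ x, |f t x| ≤ B)
    (h : ∀ t, N ≤ t → ∀ x, |f (t + k) x| ≤ q * |f t x| + K * r ^ t) :
    ∃ C, 0 ≤ C ∧ ∀ t x, |f t x| ≤ C * r ^ t := by
  choose B hB using hb
  have hs : 0 < r ^ k - q := sub_pos.2 hq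
  set D : ℝ := ∑ t ∈ Finset.range (N + k), |B t| / r ^ t with hD
  have hD0 : 0 ≤ D := Finset.sum_nonneg fun i _ => by positivity
  -- `D` absorbs the finitely many initial terms. The second constant c solves q c + |K| = c r ^ k,
  -- so it reproduces itself under the recurrence.
  refine ⟨D + |K| / (r ^ k - q), by positivity, fun t => ?_⟩
  induction t using Nat.strong_induction_on with
  | _ t ih =>
    intro x
    by_cases ht : t < N + k
    · have h1 : |B t| / r ^ t ≤ D :=
        Finset.single_le_sum (f := fun t => |B t| / r ^ t) (fun i _ => by positivity)
          (Finset.mem_range.2 ht)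
      have h2 : |B t| ≤ D * r ^ t := (div_le_iff₀ (by positivity)).1 h1
      have h3 : 0 ≤ |K| / (r ^ k - q) * r ^ t := by positivity
      nlinarith [hB t x, le_abs_self (B t)]
    · obtain ⟨u, rfl⟩ : ∃ u, t = u + k := ⟨t - k, by omega⟩
      -- For k = 0 the inequality bounds `|f u x|` by itself, with q < 1, and is solved directly;
      -- induction is useless there.
      rcases Nat.eq_zero_or_pos k with hk | hk
      · subst hk
        have h1 := h u (by omega) x
        simp only [add_zero, pow_zero] at h1 hs ⊢
        have h2 : |f u x| * (1 - q) ≤ |K| * r ^ u := by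
          nlinarith [le_abs_self K, pow_pos hr u]
        have h3 : |f u x| ≤ |K| / (1 - q) * r ^ u := by
          rw [div_mul_eq_mul_div, le_div_iff₀ hs]; exact h2
        nlinarith [pow_pos hr u]
      · have h1 := h u (by omega) x
        have h2 := ih u (by omega) x
        have h3 : q * |f u x| ≤ q * ((D + |K| / (r ^ k - q)) * r ^ u) :=
          mul_le_mul_of_nonneg_left h2 hq0
        have h4 : K * r ^ u ≤ |K| * r ^ u :=
          mul_le_mul_of_nonneg_right (le_abs_self K) (by positivity)
        have h5 : |K| = |K| / (r ^ k - q) * (r ^ k - q) := by field_simp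
        have h6 : 0 ≤ D * (r ^ k - q) * r ^ u := by positivity
        have h7 : |K| * r ^ u = |K| / (r ^ k - q) * (r ^ k - q) * r ^ u := by rw [← h5]
        rw [pow_add]
        linarith

/-- A sequence that contracts up to a null sequence tends to zero. -/
theorem tendsto_zero_of_contraction {u e : ℕ → ℝ} {q : ℝ} (hq0 : 0 ≤ q) (hq : q < 1)
    (he : Tendsto e atTop (𝓝 0)) (h : ∀ᶠ t in atTop, |u (t + 1)| ≤ q * |u t| + e t) :
    Tendsto u atTop (𝓝 0) := by
  rw [Metric.tendsto_atTop]
  intro ε hε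
  have h1 : ∀ᶠ t in atTop, e t < (1 - q) * (ε / 2) :=
    he.eventually_lt_const (by have : 0 < 1 - q := by linarith
                               positivity)
  obtain ⟨N, hN⟩ := eventually_atTop.1 (h.and h1)
  -- Once e t < (1 - q) ε/2, the excess of |u| over ε/2 contracts by q without any forcing term.
  obtain ⟨C, hC0, hC⟩ := exists_bound_of_recurrence (X := Unit)
    (f := fun t _ => max (|u t| - ε / 2) 0) (k := 1) (N := N) (q := q) (r := (q + 1) / 2) (K := 0)
    (by linarith) hq0 (by linarith) (fun t => ⟨|max (|u t| - ε / 2) 0|, fun _ => le_rfl⟩)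
    (fun t ht _ => by
      obtain ⟨h2, h3⟩ := hN t ht
      have h0 : ∀ a : ℝ, |max a 0| = max a 0 := fun a => abs_of_nonneg (le_max_right _ _)
      rw [h0, h0, zero_mul, add_zero]
      refine max_le ?_ (mul_nonneg hq0 (le_max_right _ _))
      have := mul_le_mul_of_nonneg_left (le_max_left (|u t| - ε / 2) 0) hq0
      linarith)
  have h4 : Tendsto (fun t : ℕ => C * ((q + 1) / 2) ^ t) atTop (𝓝 0) := by
    simpa using (tendsto_pow_atTop_nhds_zero_of_lt_one (by linarith : 0 ≤ (q + 1) / 2)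
      (by linarith)).const_mul C
  obtain ⟨M, hM⟩ := eventually_atTop.1 (h4.eventually_lt_const (half_pos hε))
  refine ⟨M, fun t ht => ?_⟩
  have h5 := (le_abs_self _).trans (hC t ())
  have h6 := hM t ht
  have h7 := le_max_left (|u t| - ε / 2) 0
  rw [Real.dist_eq, sub_zero]
  linarith

/-- A solution of an asymptotically affine contraction converges to the fixed point. -/
theorem tendsto_of_affine_recurrence {u p q : ℕ → ℝ} {a b v : ℝ} (hq : Tendsto q atTop (𝓝 b))
    (hp : Tendsto p atTop (𝓝 a)) (hb : |b| < 1) (hv : v = a + b * v)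
    (h : ∀ᶠ t in atTop, u (t + 1) = p t + q t * u t) : Tendsto u atTop (𝓝 v) := by
  obtain ⟨c, hbc, hc⟩ := exists_between hb
  have he : Tendsto (fun t => |p t - a| + |q t - b| * |v|) atTop (𝓝 0) := by
    have h1 := (hp.sub_const a).abs
    have h2 := ((hq.sub_const b).abs).mul_const |v|
    simpa using h1.add h2
  have h0 := tendsto_zero_of_contraction (u := fun t => u t - v) ((abs_nonneg b).trans hbc.le) hc
    he (by
      filter_upwards [h, hq.abs.eventually_lt_const hbc] with t h1 h2
      have h3 : u (t + 1) - v = q t * (u t - v) + ((p t - a) + (q t - b) * v) := by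
        rw [h1]; linear_combination -hv
      rw [h3]
      refine (abs_add_le _ _).trans (add_le_add ?_ ((abs_add_le _ _).trans_eq ?_))
      · rw [abs_mul]; exact mul_le_mul_of_nonneg_right h2.le (abs_nonneg _)
      · rw [abs_mul])
  simpa using h0.add_const v

/-! ### Calculus of exponential growth rates. -/

namespace HasRate

variable {X : Type*} {ρ σ : ℝ} {f g : ℕ → X → ℝ}

theorem exists_nonneg (hf : HasRate ρ f) {r : ℝ} (hr : ρ < r) (hr0 : 0 ≤ r) :
    ∃ C, 0 ≤ C ∧ ∀ t x, |f t x| ≤ C * r ^ t := by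
  obtain ⟨C, hC⟩ := hf r hr
  exact ⟨|C|, abs_nonneg _, fun t x => (hC t x).trans
    (mul_le_mul_of_nonneg_right (le_abs_self C) (by positivity))⟩

theorem add (hf : HasRate ρ f) (hg : HasRate ρ g) : HasRate ρ fun t x => f t x + g t x := by
  intro r hr
  obtain ⟨C, hC⟩ := hf r hr
  obtain ⟨D, hD⟩ := hg r hr
  refine ⟨C + D, fun t x => (abs_add_le _ _).trans ?_⟩
  linarith [hC t x, hD t x]

theorem reindex {Y : Type*} (hf : HasRate ρ f) (φ : Y → X) : HasRate ρ fun t y => f t (φ y) := by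
  intro r hr
  obtain ⟨C, hC⟩ := hf r hr
  exact ⟨C, fun t y => hC t (φ y)⟩

/-- Any r > σρ factors as a b with a > σ and b > ρ: take a so close to σ that a ρ < r. -/
theorem mul {c : ℕ → X → ℝ} (hρ : 0 ≤ ρ) (hσ : 0 ≤ σ) (hc : HasRate σ c) (hf : HasRate ρ f) :
    HasRate (σ * ρ) fun t x => c t x * f t x := by
  intro r hr
  obtain ⟨a, haσ, b, hbρ, hab⟩ : ∃ a, σ < a ∧ ∃ b, ρ < b ∧ a * b = r := by
    have h1 : Tendsto (fun a => a * ρ) (𝓝[>] σ) (𝓝 (σ * ρ)) :=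
      ((continuous_mul_const ρ).tendsto σ).mono_left nhdsWithin_le_nhds
    obtain ⟨a, ha, haσ⟩ := ((h1.eventually_lt_const hr).and self_mem_nhdsWithin).exists
    have ha0 : 0 < a := hσ.trans_lt haσ
    refine ⟨a, haσ, r / a, ?_, by field_simp⟩
    rw [lt_div_iff₀ ha0]; linarith
  obtain ⟨C, hC0, hC⟩ := hc.exists_nonneg haσ (hσ.trans haσ.le)
  obtain ⟨D, hD0, hD⟩ := hf.exists_nonneg hbρ (hρ.trans hbρ.le)
  refine ⟨C * D, fun t x => ?_⟩
  rw [abs_mul, ← hab, mul_pow]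
  calc |c t x| * |f t x| ≤ (C * a ^ t) * (D * b ^ t) :=
        mul_le_mul (hC t x) (hD t x) (abs_nonneg _) ((abs_nonneg _).trans (hC t x))
    _ = _ := by ring

/-- The ratio test. It serves for reciprocals of values at σ₀, where only the limit of consecutive
quotients is known. -/
theorem of_ratio {c d : ℕ → ℝ} {a : ℝ} (hσ : 0 ≤ σ) (ha : |a| ≤ σ)
    (h : ∀ t, c (t + 1) = d t * c t) (hd : Tendsto d atTop (𝓝 a)) :
    HasRate σ fun t (_ : X) => c t := by
  intro r hr
  obtain ⟨q, hq1, hq2⟩ := exists_between hr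
  obtain ⟨N, hN⟩ := eventually_atTop.1 (hd.abs.eventually_lt_const (ha.trans_lt hq1))
  obtain ⟨C, -, hC⟩ := exists_bound_of_recurrence (f := fun t (_ : X) => c t) (k := 1) (N := N)
    (q := q) (r := r) (K := 0) (hσ.trans_lt hr) (hσ.trans hq1.le) (by simpa using hq2)
    (fun t => ⟨_, fun _ => le_rfl⟩) (fun t ht _ => by
      rw [h, abs_mul, zero_mul, add_zero]
      exact mul_le_mul_of_nonneg_right (hN t ht).le (abs_nonneg _))
  exact ⟨C, hC⟩

theorem of_tendsto {c : ℕ → ℝ} {a : ℝ} (hc : Tendsto c atTop (𝓝 a)) :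
    HasRate 1 fun t (_ : X) => c t := by
  intro r hr
  obtain ⟨B, hB⟩ := hc.abs.bddAbove_range
  refine ⟨B, fun t _ => ?_⟩
  have h1 : |c t| ≤ B := hB ⟨t, rfl⟩
  nlinarith [one_le_pow₀ hr.le (n := t), abs_nonneg (c t)]

theorem const_mul (hf : HasRate ρ f) (a : ℝ) : HasRate ρ fun t x => a * f t x := by
  intro r hr
  obtain ⟨C, hC⟩ := hf r hr
  refine ⟨|a| * C, fun t x => ?_⟩
  rw [abs_mul, mul_assoc]
  exact mul_le_mul_of_nonneg_left (hC t x) (abs_nonneg a)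

/-- A polynomial factor does not change an exponential rate; this absorbs the factor t + 2 produced
by differentiation. -/
theorem natCast : HasRate 1 fun t (_ : X) => (t : ℝ) + 1 := by
  refine of_ratio zero_le_one (a := 1) (by simp) (d := fun t : ℕ => ((t : ℝ) + 2) / (t + 1))
    (fun t => ?_) ?_
  · field_simp; push_cast; ring
  · have h : Tendsto (fun t : ℕ => 1 + 1 / ((t : ℝ) + 1)) atTop (𝓝 (1 + 0)) :=
      tendsto_one_div_add_atTop_nhds_zero_nat.const_add 1
    rw [add_zero] at h
    exact h.congr fun t => by field_simp; ring

theorem smul {c : ℕ → ℝ} {a : ℝ} (hρ : 0 ≤ ρ) (hc : Tendsto c atTop (𝓝 a)) (hf : HasRate ρ f) :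
    HasRate ρ fun t x => c t * f t x := by
  simpa using mul hρ zero_le_one (of_tendsto hc) hf

theorem shift (hρ : 0 ≤ ρ) (hf : HasRate ρ f) : HasRate ρ fun t x => f (t + 1) x := by
  intro r hr
  obtain ⟨C, -, hC⟩ := hf.exists_nonneg hr (hρ.trans hr.le)
  exact ⟨C * r, fun t x => (hC (t + 1) x).trans_eq (by ring)⟩

theorem of_shift (hρ : 0 ≤ ρ) (h0 : ∃ B, ∀ x, |f 0 x| ≤ B) (hf : HasRate ρ fun t x => f (t + 1) x) :
    HasRate ρ f := by
  intro r hr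
  have hr0 : 0 < r := hρ.trans_lt hr
  obtain ⟨C, hC0, hC⟩ := hf.exists_nonneg hr hr0.le
  obtain ⟨B, hB⟩ := h0
  refine ⟨max B (C / r), fun t x => ?_⟩
  rcases t with _ | t
  · simpa using Or.inl (hB x)
  · refine (hC t x).trans ?_
    have : C * r ^ t = C / r * r ^ (t + 1) := by field_simp; ring
    rw [this]
    exact mul_le_mul_of_nonneg_right (le_max_right _ _) (by positivity)

/-- Growth of the solutions of a `k`-step recurrence with forcing. -/
theorem of_recurrence {c : ℕ → ℝ} {a : ℝ} {h : ℕ → X → ℝ} {k : ℕ} (hk : k ≠ 0) (hρ : 0 ≤ ρ)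
    (hb : ∀ t, ∃ B, ∀ x, |f t x| ≤ B) (hc : Tendsto c atTop (𝓝 a)) (ha : |a| ≤ ρ ^ k)
    (hh : HasRate ρ h) (hf : ∀ t x, f (t + k) x = c t * f t x + h t x) : HasRate ρ f := by
  intro r hr
  have hr0 : 0 < r := hρ.trans_lt hr
  obtain ⟨C, hC⟩ := hh r hr
  -- Equality |a| = ρ ^ k is allowed, because only rates r > ρ have to be reached and |a| < r ^ k
  -- for those.
  obtain ⟨q, hq1, hq2⟩ := exists_between (ha.trans_lt (pow_lt_pow_left₀ hr hρ hk))
  obtain ⟨N, hN⟩ := eventually_atTop.1 (hc.abs.eventually_lt_const hq1)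
  obtain ⟨D, -, hD⟩ := exists_bound_of_recurrence (f := f) (N := N) (K := C) hr0
    ((abs_nonneg a).trans hq1.le) hq2 hb (fun t ht x => by
      rw [hf]
      refine (abs_add_le _ _).trans (add_le_add ?_ (hC t x))
      rw [abs_mul]
      exact mul_le_mul_of_nonneg_right (hN t ht).le (abs_nonneg _))
  exact ⟨D, hD⟩

end HasRate

/-! ## Monic Gegenbauer polynomials -/

theorem gam_one (α : ℝ) : gam α 1 = 1 / (2 * (α + 1)) := by simp [gam]

theorem gam_add_two (α : ℝ) (t : ℕ) :
    gam α (t + 2) = (t + 2) * (t + 1 + 2 * α) / (4 * (t + 2 + α) * (t + 1 + α)) := by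
  have h : t + 2 ≠ 1 := by omega
  simp only [gam, h, if_false]
  push_cast
  congr 1 <;> ring

theorem gam_spec {α : ℝ} (hα : -1 / 2 < α) (t : ℕ) :
    4 * (t + 1 + α) * (t + α) * gam α (t + 1) = (t + 1) * (t + 2 * α) := by
  rcases t with _ | t
  · have : α + 1 ≠ 0 := by linarith
    rw [gam_one]; field_simp; push_cast; ring
  · have ht : (0 : ℝ) ≤ t := t.cast_nonneg
    have h1 : (t : ℝ) + 2 + α ≠ 0 := by linarith
    have h2 : (t : ℝ) + 1 + α ≠ 0 := by linarith
    rw [gam_add_two]; push_cast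
    field_simp
    ring

theorem gam_pos {α : ℝ} (hα : -1 / 2 < α) (t : ℕ) : 0 < gam α (t + 1) := by
  rcases t with _ | t
  · rw [gam_one]; have : 0 < α + 1 := by linarith
    positivity
  · have ht : (0 : ℝ) ≤ t := t.cast_nonneg
    have h1 : 0 < (t : ℝ) + 2 + α := by linarith
    have h2 : 0 < (t : ℝ) + 1 + α := by linarith
    have h3 : 0 < (t : ℝ) + 1 + 2 * α := by linarith
    rw [gam_add_two]; positivity

theorem xi_add_one (α : ℝ) (t : ℕ) :
    xi α (t + 1) = (t + 3) * (t + 2) / (4 * (t + 2 + α) * (t + 1 + α)) := by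
  simp only [xi, Nat.add_eq_zero_iff, one_ne_zero, and_false, false_and, if_false]
  push_cast
  congr 1 <;> ring

theorem xi_pos {α : ℝ} (hα : -1 / 2 < α) (t : ℕ) : 0 < xi α (t + 1) := by
  have ht : (0 : ℝ) ≤ t := t.cast_nonneg
  have h1 : 0 < (t : ℝ) + 2 + α := by linarith
  have h2 : 0 < (t : ℝ) + 1 + α := by linarith
  rw [xi_add_one]; positivity

theorem xi_ne_zero {α : ℝ} (hα : -1 / 2 < α) (t : ℕ) : xi α t ≠ 0 := by
  rcases t with _ | t
  · by_cases h : α = 0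
    · simp [xi, h]
    · simp only [xi, h, and_false, if_false]
      have h2 : α + 1 ≠ 0 := by linarith
      simp [h, h2]
  · exact (xi_pos hα t).ne'

theorem tendsto_natCast_ratio (a b c d : ℝ) :
    Tendsto (fun t : ℕ => ((t : ℝ) + a) * (t + b) / (4 * (t + c) * (t + d))) atTop
      (𝓝 (1 / 4)) := by
  have h : ∀ e : ℝ, Tendsto (fun t : ℕ => ((t : ℝ) + e) / t) atTop (𝓝 1) := fun e => by
    have h1 : Tendsto (fun t : ℕ => 1 + e / (t : ℝ)) atTop (𝓝 (1 + 0)) :=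
      (tendsto_const_div_atTop_nhds_zero_nat e).const_add 1
    rw [add_zero] at h1
    refine h1.congr' ?_
    filter_upwards [eventually_gt_atTop 0] with t ht
    have : (t : ℝ) ≠ 0 := by positivity
    field_simp
  have h2 := ((h a).mul (h b)).div (((h c).const_mul 4).mul (h d)) (by norm_num)
  norm_num at h2
  refine (h2.congr' ?_)
  filter_upwards [eventually_gt_atTop 0] with t ht
  have : (t : ℝ) ≠ 0 := by positivity
  have h3 : 4 * (((t : ℝ) + c) / t) * ((t + d) / t) = 4 * (t + c) * (t + d) / (t * t) := by
    field_simp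
  simp only [Pi.div_apply]
  rw [div_mul_div_comm, h3, div_div_div_cancel_right₀]
  positivity

theorem tendsto_gam (α : ℝ) : Tendsto (gam α) atTop (𝓝 (1 / 4)) := by
  rw [← tendsto_add_atTop_iff_nat 2]
  refine (tendsto_natCast_ratio 2 (1 + 2 * α) (2 + α) (1 + α)).congr fun t => ?_
  rw [gam_add_two]; congr 1 <;> ring

theorem tendsto_xi (α : ℝ) : Tendsto (xi α) atTop (𝓝 (1 / 4)) := by
  rw [← tendsto_add_atTop_iff_nat 1]
  refine (tendsto_natCast_ratio 3 2 (2 + α) (1 + α)).congr fun t => ?_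
  rw [xi_add_one]; congr 1 ; ring

/-- The monic Gegenbauer polynomials, orthogonal for the weight `(1 - x²) ^ (α - 1/2)`. -/
noncomputable def gegen (α : ℝ) : ℕ → ℝ[X]
  | 0 => 1
  | 1 => X
  | t + 2 => X * gegen α (t + 1) - C (gam α (t + 1)) * gegen α t

theorem degree_C_mul_le_degree (a : ℝ) (p : ℝ[X]) : (C a * p).degree ≤ p.degree := by
  rw [C_mul']; exact degree_smul_le a p

theorem gegen_monic_natDegree (α : ℝ) (t : ℕ) :
    (gegen α t).Monic ∧ (gegen α t).natDegree = t := by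
  suffices h : (gegen α t).Monic ∧ (gegen α t).degree = t from
    ⟨h.1, natDegree_eq_of_degree_eq_some h.2⟩
  induction t using Nat.strong_induction_on with
  | _ t ih =>
    rcases t with _ | _ | t
    · simp [gegen, monic_one]
    · simp [gegen, monic_X]
    · obtain ⟨h1, h2⟩ := ih (t + 1) (by omega)
      obtain ⟨-, h3⟩ := ih t (by omega)
      have h4 : (X * gegen α (t + 1)).degree = ((t + 2 : ℕ) : WithBot ℕ) := by
        rw [degree_mul, h2, degree_X, add_comm]; norm_cast
      have h5 : (C (gam α (t + 1)) * gegen α t).degree < (X * gegen α (t + 1)).degree := by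
        rw [h4]
        refine (degree_C_mul_le_degree _ _).trans_lt ?_
        rw [h3]; exact_mod_cast (by omega : t < t + 2)
      rw [gegen]
      exact ⟨(monic_X.mul h1).sub_of_left h5, by rw [degree_sub_eq_left_of_degree_lt h5, h4]⟩

theorem gegen_monic (α : ℝ) (t : ℕ) : (gegen α t).Monic := (gegen_monic_natDegree α t).1

theorem natDegree_gegen (α : ℝ) (t : ℕ) : (gegen α t).natDegree = t :=
  (gegen_monic_natDegree α t).2

theorem eval_gegen_add_two (α x : ℝ) (t : ℕ) : (gegen α (t + 2)).eval x =
    x * (gegen α (t + 1)).eval x - gam α (t + 1) * (gegen α t).eval x := by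
  simp [gegen]

/-- The structure relation of the family. It passes through the three-term recurrence by induction
and later yields both the coherence relation and the moments. -/
theorem gegen_derivative_aux {α : ℝ} (hα : -1 / 2 < α) (x : ℝ) (t : ℕ) :
    (1 - x ^ 2) * (derivative (gegen α (t + 1))).eval x =
      -((t : ℝ) + 1) * x * (gegen α (t + 1)).eval x +
        2 * (t + 1 + α) * gam α (t + 1) * (gegen α t).eval x := by
  induction t using Nat.twoStepInduction with
  | zero =>
    have : α + 1 ≠ 0 := by linarith
    simp only [gegen, zero_add, gam_one, derivative_X, eval_one, eval_X]
    push_cast; field_simp; ring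
  | one =>
    have h1 : α + 1 ≠ 0 := by linarith
    have h2 : 2 + α ≠ 0 := by linarith
    have h3 : 1 + α ≠ 0 := by linarith
    have := gam_add_two α 0
    norm_num at this
    simp only [gegen, zero_add, this, gam_one, derivative_X, eval_one, eval_X, derivative_sub,
      derivative_mul, eval_sub, eval_mul, eval_add, derivative_C, eval_C, derivative_one, eval_zero,
      one_add_one_eq_two]
    push_cast; field_simp; ring
  | more t ih1 ih2 =>
    have hd : (derivative (gegen α (t + 3))).eval x = (gegen α (t + 2)).eval x +
        x * (derivative (gegen α (t + 2))).eval x -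
          gam α (t + 2) * (derivative (gegen α (t + 1))).eval x := by
      rw [gegen]; simp
    have hg3 := eval_gegen_add_two α x (t + 1)
    have hg2 := eval_gegen_add_two α x t
    have h2 := gam_add_two α t
    have h3 := gam_add_two α (t + 1)
    have ht : (0 : ℝ) ≤ t := t.cast_nonneg
    have n1 : (t : ℝ) + 1 + α ≠ 0 := by linarith
    have n2 : (t : ℝ) + 2 + α ≠ 0 := by linarith
    have n3 : (t : ℝ) + 3 + α ≠ 0 := by linarith
    -- What remains of the inductive step: the coefficients of G_{t+2} have to agree.
    have key : 1 + 2 * (t + 1 + α) * gam α (t + 2) = 2 * (t + 3 + α) * gam α (t + 3) := by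
      have h3' : gam α (t + 3) =
          (t + 3) * (t + 2 + 2 * α) / (4 * (t + 3 + α) * (t + 2 + α)) := by
        rw [h3]; push_cast; congr 1 <;> ring
      rw [h3', h2]; field_simp; ring
    push_cast at ih1 ih2 ⊢
    simp only [show t + 1 + 1 = t + 2 from rfl, show t + 2 + 1 = t + 3 from rfl] at *
    rw [hd]
    linear_combination x * ih2 - gam α (t + 2) * ih1 + ((t : ℝ) + 3) * x * hg3
      - 2 * (t + 1 + α) * gam α (t + 2) * hg2 + (gegen α (t + 2)).eval x * key

theorem derivative_gegen {α : ℝ} (hα : -1 / 2 < α) (t : ℕ) :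
    (1 - X ^ 2) * derivative (gegen α (t + 1)) =
      -(C ((t : ℝ) + 1) * (X * gegen α (t + 1))) +
        C (2 * (t + 1 + α) * gam α (t + 1)) * gegen α t := by
  refine Polynomial.funext fun x => ?_
  have := gegen_derivative_aux hα x t
  simp only [eval_mul, eval_add, eval_neg, eval_sub, eval_one, eval_pow, eval_X, eval_C]
  linear_combination this

/-- Coherence, the identity on which the Sobolev recurrence rests: this combination has a derivative
that is a single Gegenbauer polynomial for the same weight. After multiplication by the nonzero 1 -
X² it reduces to the structure relation. -/
theorem derivative_gegen_sub {α : ℝ} (hα : -1 / 2 < α) (t : ℕ) :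
    derivative (gegen α (t + 2)) - C (xi α t) * derivative (gegen α t) =
      C ((t : ℝ) + 2) * gegen α (t + 1) := by
  -- For t = 0 the derivative of G₀ vanishes, so the conventional value of ξ₀ plays no role.
  rcases t with _ | t
  · simp [gegen, C_ofNat]; ring
  have hX : (1 - X ^ 2 : ℝ[X]) ≠ 0 := fun h => by
    have := congrArg (eval 0) h
    simp at this
  refine mul_left_cancel₀ hX (Polynomial.funext fun x => ?_)
  have e1 := gegen_derivative_aux hα x (t + 2)
  have e2 := gegen_derivative_aux hα x t
  have hg3 := eval_gegen_add_two α x (t + 1)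
  have hg2 := eval_gegen_add_two α x t
  have ht : (0 : ℝ) ≤ t := t.cast_nonneg
  have n1 : (t : ℝ) + 1 + α ≠ 0 := by linarith
  have n2 : (t : ℝ) + 2 + α ≠ 0 := by linarith
  have n3 : (t : ℝ) + 3 + α ≠ 0 := by linarith
  have h2 := gam_add_two α t
  have h3 : gam α (t + 3) = (t + 3) * (t + 2 + 2 * α) / (4 * (t + 3 + α) * (t + 2 + α)) := by
    rw [gam_add_two]; push_cast; congr 1 <;> ring
  have key1 : 2 * (t + 3 + α) * gam α (t + 3) + 2 * (t + 1 + α) * xi α (t + 1) = t + 3 := by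
    rw [h3, xi_add_one]; field_simp; ring
  have key2 : ((t : ℝ) + 3) * gam α (t + 2) = xi α (t + 1) * (t + 1 + 2 * α) := by
    rw [h2, xi_add_one]; field_simp
  push_cast at e1 e2 ⊢
  simp only [eval_mul, eval_sub, eval_one, eval_pow, eval_X, eval_C,
    show t + 1 + 1 = t + 2 from rfl, show t + 2 + 1 = t + 3 from rfl] at *
  linear_combination e1 - xi α (t + 1) * e2 - ((t : ℝ) + 3) * x * hg3 +
    (gegen α (t + 2)).eval x * key1 + x * (gegen α (t + 1)).eval x * key2
    - 2 * (t + 1 + α) * xi α (t + 1) * hg2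

theorem eval_neg_gegen (α x : ℝ) (t : ℕ) :
    (gegen α t).eval (-x) = (-1) ^ t * (gegen α t).eval x := by
  induction t using Nat.twoStepInduction with
  | zero => simp [gegen]
  | one => simp [gegen]
  | more t ih1 ih2 => rw [eval_gegen_add_two, eval_gegen_add_two, ih1, ih2]; ring

/-- Ratio of two consecutive Gegenbauer polynomials at `1`. -/
noncomputable def gegenRatio (α : ℝ) (t : ℕ) : ℝ :=
  -- The general formula would read 0 / 0 at t = 0, α = 0.
  if t = 0 then 1 else (t + 2 * α) / (2 * (t + α))

theorem gegenRatio_pos {α : ℝ} (hα : -1 / 2 < α) (t : ℕ) : 0 < gegenRatio α t := by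
  rcases t with _ | t
  · simp [gegenRatio]
  · have ht : (0 : ℝ) ≤ t := t.cast_nonneg
    have h1 : 0 < (t : ℝ) + 1 + 2 * α := by linarith
    have h2 : 0 < (t : ℝ) + 1 + α := by linarith
    simp only [gegenRatio, Nat.add_eq_zero_iff, one_ne_zero, and_false, if_false]
    push_cast
    positivity

theorem one_sub_gam_div_gegenRatio {α : ℝ} (hα : -1 / 2 < α) (t : ℕ) :
    gegenRatio α (t + 1) = 1 - gam α (t + 1) / gegenRatio α t := by
  rcases t with _ | t
  · have h1 : α + 1 ≠ 0 := by linarith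
    have h2 : 1 + α ≠ 0 := by linarith
    simp [gegenRatio, gam_one]
    field_simp; ring
  · have ht : (0 : ℝ) ≤ t := t.cast_nonneg
    have h1 : (t : ℝ) + 1 + 2 * α ≠ 0 := by linarith
    have h2 : (t : ℝ) + 1 + α ≠ 0 := by linarith
    have h3 : (t : ℝ) + 2 + α ≠ 0 := by linarith
    have h4 : (t : ℝ) + 1 + 1 + α ≠ 0 := by linarith
    simp only [gegenRatio, Nat.add_eq_zero_iff, one_ne_zero, and_false, if_false, gam_add_two]
    push_cast
    field_simp
    ring

/-- To the right of 1 the quotients G_{t+1}/G_t are at least those at 1: by the recurrence each is x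
- γ divided by the previous quotient, increasing in both x and that quotient. Positivity on [1, ∞)
comes with it. -/
theorem gegenRatio_mul_eval_le {α x : ℝ} (hα : -1 / 2 < α) (hx : 1 ≤ x) (t : ℕ) :
    0 < (gegen α t).eval x ∧ gegenRatio α t * (gegen α t).eval x ≤ (gegen α (t + 1)).eval x := by
  induction t with
  | zero => simp [gegen, gegenRatio, hx]
  | succ t ih =>
    have hr := gegenRatio_pos hα t
    have h1 : 0 < (gegen α (t + 1)).eval x := (mul_pos hr ih.1).trans_le ih.2
    refine ⟨h1, ?_⟩
    have h2 : (gegen α t).eval x ≤ (gegen α (t + 1)).eval x / gegenRatio α t := by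
      rw [le_div_iff₀ hr]; linarith [ih.2]
    have h3 := mul_le_mul_of_nonneg_left h2 (gam_pos hα t).le
    have h4 : gam α (t + 1) * ((gegen α (t + 1)).eval x / gegenRatio α t) =
      gam α (t + 1) / gegenRatio α t * (gegen α (t + 1)).eval x := by ring
    rw [eval_gegen_add_two, one_sub_gam_div_gegenRatio hα]
    nlinarith

theorem eval_gegen_pos {α x : ℝ} (hα : -1 / 2 < α) (hx : 1 ≤ x) (t : ℕ) :
    0 < (gegen α t).eval x := (gegenRatio_mul_eval_le hα hx t).1

/-- Two steps of the ratio bound give a factor (t + 2α)(t + 1 + 2α) over 4(t + α)(t + 1 + α), while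
ξ_t has the numerator (t + 1)(t + 2) over the same denominator. This is where 2α ≥ 1 enters. -/
theorem xi_mul_eval_gegen_le {α x : ℝ} (hα : 1 / 2 ≤ α) (hx : 1 ≤ x) (t : ℕ) :
    xi α t * (gegen α t).eval x ≤ (gegen α (t + 2)).eval x := by
  have hα' : -1 / 2 < α := by linarith
  obtain ⟨h0, h1⟩ := gegenRatio_mul_eval_le hα' hx t
  obtain ⟨-, h2⟩ := gegenRatio_mul_eval_le hα' hx (t + 1)
  have hx : xi α t ≤ gegenRatio α (t + 1) * gegenRatio α t := by
    have ht : (0 : ℝ) ≤ t := t.cast_nonneg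
    have e1 : 0 < (t : ℝ) + α := by linarith
    have e2 : 0 < (t : ℝ) + 1 + α := by linarith
    have e3 : gegenRatio α t = (t + 2 * α) / (2 * (t + α)) := by
      rcases t with _ | t
      · have : α ≠ 0 := by linarith
        simp [gegenRatio]; field_simp
      · simp [gegenRatio]
    have e4 : gegenRatio α (t + 1) = (t + 1 + 2 * α) / (2 * (t + 1 + α)) := by
      simp [gegenRatio]
    have e5 : xi α t = (t + 2) * (t + 1) / (4 * (t + 1 + α) * (t + α)) := by
      have : ¬ (t = 0 ∧ α = 0) := fun h => by linarith [h.2]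
      simp only [xi, this, if_false]; congr 1; ring
    rw [e3, e4, e5, div_mul_div_comm, show 2 * ((t : ℝ) + 1 + α) * (2 * (t + α)) =
      4 * (t + 1 + α) * (t + α) by ring]
    refine div_le_div_of_nonneg_right ?_ (by positivity)
    nlinarith
  have h3 := mul_le_mul_of_nonneg_left h1 (gegenRatio_pos hα' (t + 1)).le
  have h4 := mul_le_mul_of_nonneg_right hx h0.le
  linarith

/-! ## The Sobolev coefficients and polynomials -/

/-- The parameter `η` rescaled to `[-1, 1]` is positive. -/
theorem etaT_pos {ℓ L η : ℝ} (hL : ℓ < L) (hη : 0 < η) : 0 < etaT ℓ L η := by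
  have : 0 < L - ℓ := sub_pos.2 hL
  unfold etaT; positivity

/-- The denominator in the recursion of `dCoef`: ratio of the squared Sobolev norm of degree `t + 2`
to the squared `L²` norm of degree `t`. -/
noncomputable def dDenom (α ℓ L η : ℝ) (t : ℕ) : ℝ :=
  gam α (t + 1) * (etaT ℓ L η * ((t : ℝ) + 2) ^ 2 + gam α (t + 2)) +
    xi α t * (xi α t - dCoef α ℓ L η t)

theorem dCoef_add_two (α ℓ L η : ℝ) (t : ℕ) : dCoef α ℓ L η (t + 2) =
    xi α (t + 2) * gam α (t + 2) * gam α (t + 1) / dDenom α ℓ L η t := rfl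

/-- The bounds concern d_t / ξ_t because ξ₀ < 0 for -1/2 < α < 0. The next quotient is γ_{t+2}
γ_{t+1} / `dDenom`, and `dDenom` exceeds that numerator by a positive η̃ term and ξ_t² (1 - d_t /
ξ_t) ≥ 0. -/
theorem dCoef_bounds {α ℓ L η : ℝ} (hα : -1 / 2 < α) (hL : ℓ < L) (hη : 0 < η) (t : ℕ) :
    0 < dCoef α ℓ L η t / xi α t ∧ dCoef α ℓ L η t / xi α t ≤ 1 := by
  have he := etaT_pos hL hη
  induction t using Nat.twoStepInduction with
  | zero => simp [dCoef, xi_ne_zero hα 0]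
  | one =>
    have h1 : 0 < α + 1 := by linarith
    have h2 : 0 < α + 2 := by linarith
    have h3 : xi α 1 = 3 / (2 * (α + 2) * (α + 1)) := by
      have h4 : 0 < 2 + α := by linarith
      have h5 : 0 < 1 + α := by linarith
      have := xi_add_one α 0
      norm_num at this
      rw [this]; field_simp; ring
    have h6 : dCoef α ℓ L η 1 / xi α 1 = 1 / (1 + 2 * etaT ℓ L η * (α + 1)) := by
      rw [h3, dCoef]; field_simp
    have h7 : 0 < 2 * etaT ℓ L η * (α + 1) := by positivity
    rw [h6]
    exact ⟨by positivity, by rw [div_le_one (by positivity)]; linarith⟩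
  | more t ih _ =>
    have hg1 := gam_pos hα t
    have hg2 := gam_pos hα (t + 1)
    have hx := xi_ne_zero hα t
    have hx2 := xi_ne_zero hα (t + 2)
    have h1 : xi α t * (xi α t - dCoef α ℓ L η t) =
        xi α t ^ 2 * (1 - dCoef α ℓ L η t / xi α t) := by field_simp
    have h2 : 0 ≤ xi α t * (xi α t - dCoef α ℓ L η t) := by
      rw [h1]; exact mul_nonneg (sq_nonneg _) (by linarith [ih.2])
    have h3 : 0 < gam α (t + 1) * (etaT ℓ L η * ((t : ℝ) + 2) ^ 2) := by positivity
    have h4 : gam α (t + 2) * gam α (t + 1) ≤ dDenom α ℓ L η t := by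
      unfold dDenom; nlinarith
    have h5 : 0 < gam α (t + 2) * gam α (t + 1) := mul_pos hg2 hg1
    have h6 : dCoef α ℓ L η (t + 2) / xi α (t + 2) =
        gam α (t + 2) * gam α (t + 1) / dDenom α ℓ L η t := by
      rw [dCoef_add_two]; field_simp
    rw [h6]
    exact ⟨div_pos h5 (h5.trans_le h4), (div_le_one (h5.trans_le h4)).2 h4⟩

theorem xi_mul_sub_dCoef_nonneg {α ℓ L η : ℝ} (hα : -1 / 2 < α) (hL : ℓ < L) (hη : 0 < η) (t : ℕ) :
    0 ≤ xi α t * (xi α t - dCoef α ℓ L η t) := by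
  have hx := xi_ne_zero hα t
  have h1 : xi α t * (xi α t - dCoef α ℓ L η t) =
      xi α t ^ 2 * (1 - dCoef α ℓ L η t / xi α t) := by field_simp
  rw [h1]
  exact mul_nonneg (sq_nonneg _) (by linarith [(dCoef_bounds (ℓ := ℓ) (η := η) hα hL hη t).2])

theorem dDenom_pos {α ℓ L η : ℝ} (hα : -1 / 2 < α) (hL : ℓ < L) (hη : 0 < η) (t : ℕ) :
    0 < dDenom α ℓ L η t := by
  have h1 := xi_mul_sub_dCoef_nonneg (ℓ := ℓ) hα hL hη t
  have h2 := gam_pos hα t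
  have h3 := gam_pos hα (t + 1)
  have h4 := etaT_pos hL hη
  have h5 : 0 < gam α (t + 1) * (etaT ℓ L η * ((t : ℝ) + 2) ^ 2 + gam α (t + 2)) := by positivity
  unfold dDenom; linarith

theorem dCoef_ne_zero {α ℓ L η : ℝ} (hα : -1 / 2 < α) (hL : ℓ < L) (hη : 0 < η) (t : ℕ) :
    dCoef α ℓ L η t ≠ 0 := fun h => by
  have := (dCoef_bounds (ℓ := ℓ) (η := η) hα hL hη t).1
  simp [h] at this

/-- Base case of d_t ‖Q_t‖² = ξ_t ‖G_t‖², since the Sobolev norm of X is (γ₁ + η̃) ‖1‖². -/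
theorem dCoef_one {α ℓ L η : ℝ} (hα : -1 / 2 < α) (hL : ℓ < L) (hη : 0 < η) :
    dCoef α ℓ L η 1 * (gam α 1 + etaT ℓ L η) = xi α 1 * gam α 1 := by
  have h1 : 0 < α + 1 := by linarith
  have h2 : 0 < α + 2 := by linarith
  have h4 : 0 < 2 + α := by linarith
  have h5 : 0 < 1 + α := by linarith
  have he := etaT_pos hL hη
  have := xi_add_one α 0
  norm_num at this
  have h7 : 0 < 2 * etaT ℓ L η * (α + 1) := by positivity
  rw [this, dCoef, gam_one]; field_simp; ring

/-- The derivative term η̃ (t + 2)² γ_{t+1} dominates `dDenom`, all else being bounded; so `dDenom`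
grows quadratically and d_t vanishes in the limit. -/
theorem tendsto_dCoef {α ℓ L η : ℝ} (hα : -1 / 2 < α) (hL : ℓ < L) (hη : 0 < η) :
    Tendsto (dCoef α ℓ L η) atTop (𝓝 0) ∧
      Tendsto (fun t : ℕ => dDenom α ℓ L η t / ((t : ℝ) + 2) ^ 2) atTop
        (𝓝 (etaT ℓ L η / 4)) := by
  have he := etaT_pos hL hη
  have hsq : Tendsto (fun t : ℕ => 1 / ((t : ℝ) + 2) ^ 2) atTop (𝓝 0) := by
    have h1 := ((tendsto_add_atTop_iff_nat 1).2
      (tendsto_one_div_add_atTop_nhds_zero_nat (𝕜 := ℝ))).pow 2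
    norm_num at h1
    refine h1.congr fun t => ?_
    rw [one_div]; congr 2; ring
  have hg1 := (tendsto_add_atTop_iff_nat 1).2 (tendsto_gam α)
  have hg2 := (tendsto_add_atTop_iff_nat 2).2 (tendsto_gam α)
  have hx := tendsto_xi α
  have hxd : Tendsto (fun t => xi α t * (xi α t - dCoef α ℓ L η t) * (1 / ((t : ℝ) + 2) ^ 2)) atTop
      (𝓝 0) := by
    have h1 : Tendsto (fun t => xi α t ^ 2 * (1 / ((t : ℝ) + 2) ^ 2)) atTop (𝓝 0) := by
      simpa using (hx.pow 2).mul hsq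
    refine squeeze_zero (fun t => mul_nonneg (xi_mul_sub_dCoef_nonneg hα hL hη t) (by positivity))
      (fun t => mul_le_mul_of_nonneg_right ?_ (by positivity)) h1
    have h2 := (dCoef_bounds (ℓ := ℓ) (η := η) hα hL hη t).1
    have hx := xi_ne_zero hα t
    have h3 : xi α t * dCoef α ℓ L η t = xi α t ^ 2 * (dCoef α ℓ L η t / xi α t) := by field_simp
    have h4 : 0 ≤ xi α t * dCoef α ℓ L η t := by rw [h3]; positivity
    nlinarith
  have hD : Tendsto (fun t : ℕ => dDenom α ℓ L η t / ((t : ℝ) + 2) ^ 2) atTop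
      (𝓝 (etaT ℓ L η / 4)) := by
    have h1 := (hg1.mul ((hg2.mul hsq).const_add (etaT ℓ L η))).add hxd
    have h2 : 1 / 4 * (etaT ℓ L η + 1 / 4 * 0) + 0 = etaT ℓ L η / 4 := by ring
    rw [h2] at h1
    refine h1.congr fun t => ?_
    have : (t : ℝ) + 2 ≠ 0 := by positivity
    unfold dDenom; field_simp
  refine ⟨?_, hD⟩
  rw [← tendsto_add_atTop_iff_nat 2]
  have h1 := (((((tendsto_add_atTop_iff_nat 2).2 hx).mul hg2).mul hg1).mul hsq).div hD (by positivity)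
  rw [mul_zero, zero_div] at h1
  refine h1.congr fun t => ?_
  have h3 := (dDenom_pos (ℓ := ℓ) hα hL hη t).ne'
  have : (t : ℝ) + 2 ≠ 0 := by positivity
  simp only [Pi.div_apply]
  rw [dCoef_add_two]; field_simp

/-- The monic orthogonal polynomials of the Gegenbauer-Sobolev product on `[-1, 1]`. -/
noncomputable def sobMonic (α ℓ L η : ℝ) : ℕ → ℝ[X]
  | 0 => 1
  | 1 => X
  | t + 2 => C (dCoef α ℓ L η t) * sobMonic α ℓ L η t + (gegen α (t + 2) - C (xi α t) * gegen α t)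

theorem sobMonic_monic_natDegree (α ℓ L η : ℝ) (t : ℕ) :
    (sobMonic α ℓ L η t).Monic ∧ (sobMonic α ℓ L η t).natDegree = t := by
  suffices h : (sobMonic α ℓ L η t).Monic ∧ (sobMonic α ℓ L η t).degree = t from
    ⟨h.1, natDegree_eq_of_degree_eq_some h.2⟩
  have hdeg : ∀ t, (gegen α t).degree = t := fun t => by
    rw [degree_eq_natDegree (gegen_monic α t).ne_zero, natDegree_gegen]
  induction t using Nat.twoStepInduction with
  | zero => simp [sobMonic, monic_one]
  | one => simp [sobMonic, monic_X]
  | more t ih _ =>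
    have hlt : ((t : ℕ) : WithBot ℕ) < ((t + 2 : ℕ) : WithBot ℕ) := by
      exact_mod_cast (by omega : t < t + 2)
    have h1 : (C (xi α t) * gegen α t).degree < (gegen α (t + 2)).degree := by
      rw [hdeg]; exact (degree_C_mul_le_degree _ _).trans_lt (by rw [hdeg]; exact hlt)
    have h2 : (gegen α (t + 2) - C (xi α t) * gegen α t).degree = ((t + 2 : ℕ) : WithBot ℕ) := by
      rw [degree_sub_eq_left_of_degree_lt h1, hdeg]
    have h3 : (C (dCoef α ℓ L η t) * sobMonic α ℓ L η t).degree <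
        (gegen α (t + 2) - C (xi α t) * gegen α t).degree := by
      rw [h2]; exact (degree_C_mul_le_degree _ _).trans_lt (by rw [ih.2]; exact hlt)
    rw [sobMonic]
    exact ⟨((gegen_monic α (t + 2)).sub_of_left h1).add_of_right h3,
      by rw [degree_add_eq_right_of_degree_lt h3, h2]⟩

theorem eval_sobMonic_add_two (α ℓ L η x : ℝ) (t : ℕ) : (sobMonic α ℓ L η (t + 2)).eval x =
    dCoef α ℓ L η t * (sobMonic α ℓ L η t).eval x +
      ((gegen α (t + 2)).eval x - xi α t * (gegen α t).eval x) := by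
  simp [sobMonic]

theorem eval_neg_sobMonic (α ℓ L η x : ℝ) (t : ℕ) :
    (sobMonic α ℓ L η t).eval (-x) = (-1) ^ t * (sobMonic α ℓ L η t).eval x := by
  induction t using Nat.twoStepInduction with
  | zero => simp [sobMonic]
  | one => simp [sobMonic]
  | more t ih1 _ =>
    rw [eval_sobMonic_add_two, eval_sobMonic_add_two, ih1, eval_neg_gegen, eval_neg_gegen]; ring

/-- The bracket in the Sobolev recurrence is nonnegative by `xi_mul_eval_gegen_le`, and the
remaining term is positive by induction. -/
theorem eval_sobMonic_pos {α ℓ L η x : ℝ} (hα : 1 / 2 ≤ α) (hL : ℓ < L) (hη : 0 < η) (hx : 1 ≤ x)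
    (t : ℕ) : 0 < (sobMonic α ℓ L η t).eval x := by
  have hα' : -1 / 2 < α := by linarith
  induction t using Nat.twoStepInduction with
  | zero => simp [sobMonic]
  | one => simp [sobMonic]; linarith
  | more t ih _ =>
    have hxi : 0 < xi α t := by
      rcases t with _ | t
      · have h1 : 0 < α := by linarith
        simp [xi, h1.ne']; positivity
      · exact xi_pos hα' t
    have hd : 0 < dCoef α ℓ L η t := by
      have := (dCoef_bounds (ℓ := ℓ) (η := η) hα' hL hη t).1
      rwa [div_pos_iff_of_pos_right hxi] at this
    rw [eval_sobMonic_add_two]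
    have := xi_mul_eval_gegen_le hα hx t
    have := mul_pos hd ih
    linarith

/-! ## The Gegenbauer functional -/

/-- The affine polynomial mapping `[ℓ, L]` onto `[-1, 1]`. -/
noncomputable def toUnit (ℓ L : ℝ) : ℝ[X] := C (2 / (L - ℓ)) * X - C ((L + ℓ) / (L - ℓ))

theorem eval_toUnit (ℓ L x : ℝ) : (toUnit ℓ L).eval x = shift ℓ L x := by
  simp [toUnit, shift]; ring

theorem shift_zero (ℓ L : ℝ) : shift ℓ L 0 = sigma0 ℓ L := by
  simp [shift, sigma0]; ring

theorem one_sub_shift_sq {ℓ L : ℝ} (hL : ℓ < L) (x : ℝ) :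
    1 - shift ℓ L x ^ 2 = (2 / (L - ℓ)) ^ 2 * ((x - ℓ) * (L - x)) := by
  have : L - ℓ ≠ 0 := (sub_pos.2 hL).ne'
  unfold shift; field_simp; ring

theorem hasDerivAt_shift (ℓ L x : ℝ) : HasDerivAt (shift ℓ L) (2 / (L - ℓ)) x := by
  have h := (toUnit ℓ L).hasDerivAt x
  have h1 : (fun y => (toUnit ℓ L).eval y) = shift ℓ L := funext (eval_toUnit ℓ L)
  rw [h1] at h
  simpa [toUnit] using h

theorem continuous_shift (ℓ L : ℝ) : Continuous (shift ℓ L) :=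
  continuous_iff_continuousAt.2 fun x => (hasDerivAt_shift ℓ L x).continuousAt

/-- Cut at the midpoint: on each half only one of the two factors is singular and the other is
continuous. -/
theorem intervalIntegrable_mul_rpow {β a b : ℝ} (hβ : -1 < β) (hab : a < b) :
    IntervalIntegrable (fun x => ((x - a) * (b - x)) ^ β) MeasureTheory.volume a b := by
  set c := (a + b) / 2 with hc
  have h1 : IntervalIntegrable (fun x => (x - a) ^ β) MeasureTheory.volume a c := by
    have := (intervalIntegral.intervalIntegrable_rpow' (a := 0) (b := c - a) hβ).comp_sub_right a
    simpa using this
  have h2 : IntervalIntegrable (fun x => (b - x) ^ β) MeasureTheory.volume c b := by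
    have := (intervalIntegral.intervalIntegrable_rpow' (a := b - c) (b := 0) hβ).comp_sub_left b
    simpa using this
  have hac : a < c := by rw [hc]; linarith
  have hcb : c < b := by rw [hc]; linarith
  have e1 : IntervalIntegrable (fun x => ((x - a) * (b - x)) ^ β) MeasureTheory.volume a c := by
    have h3 : ContinuousOn (fun x : ℝ => (b - x) ^ β) (Set.uIcc a c) := by
      rw [Set.uIcc_of_le hac.le]
      exact ContinuousOn.rpow_const (by fun_prop) fun x hx => Or.inl (by linarith [hx.2])
    refine (h1.mul_continuousOn h3).congr fun x hx => ?_
    rw [Set.uIoc_of_le hac.le] at hx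
    exact (Real.mul_rpow (by linarith [hx.1]) (by linarith [hx.2])).symm
  have e2 : IntervalIntegrable (fun x => ((x - a) * (b - x)) ^ β) MeasureTheory.volume c b := by
    have h3 : ContinuousOn (fun x : ℝ => (x - a) ^ β) (Set.uIcc c b) := by
      rw [Set.uIcc_of_le hcb.le]
      exact ContinuousOn.rpow_const (by fun_prop) fun x hx => Or.inl (by linarith [hx.1])
    refine (h2.continuousOn_mul h3).congr fun x hx => ?_
    rw [Set.uIoc_of_le hcb.le] at hx
    exact (Real.mul_rpow (by linarith [hx.1]) (by linarith [hx.2])).symm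
  exact e1.trans e2

theorem density_eq {α ℓ L : ℝ} (hL : ℓ < L) {x : ℝ} (hx : x ∈ Set.Icc ℓ L) : density α ℓ L x =
    ((2 / (L - ℓ)) ^ 2) ^ (α - 1 / 2) * ((x - ℓ) * (L - x)) ^ (α - 1 / 2) := by
  rw [density, one_sub_shift_sq hL, Real.mul_rpow (by positivity)]
  exact mul_nonneg (by linarith [hx.1]) (by linarith [hx.2])

theorem intervalIntegrable_density {α ℓ L : ℝ} (hα : -1 / 2 < α) (hL : ℓ < L) :
    IntervalIntegrable (density α ℓ L) MeasureTheory.volume ℓ L := by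
  refine ((intervalIntegrable_mul_rpow (β := α - 1 / 2) (by linarith) hL).const_mul
    (((2 / (L - ℓ)) ^ 2) ^ (α - 1 / 2))).congr fun x hx => ?_
  rw [Set.uIoc_of_le hL.le] at hx
  exact (density_eq hL ⟨hx.1.le, hx.2⟩).symm

theorem intervalIntegrable_mul_density {α ℓ L : ℝ} (hα : -1 / 2 < α) (hL : ℓ < L) {f : ℝ → ℝ}
    (hf : Continuous f) :
    IntervalIntegrable (fun x => f x * density α ℓ L x) MeasureTheory.volume ℓ L :=
  (intervalIntegrable_density hα hL).continuousOn_mul hf.continuousOn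

theorem shift_sq_lt_one {ℓ L x : ℝ} (hL : ℓ < L) (hx : x ∈ Set.Ioo ℓ L) :
    0 < 1 - shift ℓ L x ^ 2 := by
  rw [one_sub_shift_sq hL]
  have h1 : 0 < L - ℓ := sub_pos.2 hL
  have h2 : 0 < x - ℓ := sub_pos.2 hx.1
  have h3 : 0 < L - x := sub_pos.2 hx.2
  positivity

theorem density_pos {α ℓ L x : ℝ} (hL : ℓ < L) (hx : x ∈ Set.Ioo ℓ L) : 0 < density α ℓ L x :=
  Real.rpow_pos_of_pos (shift_sq_lt_one hL hx) _

theorem density_nonneg {α ℓ L x : ℝ} (hL : ℓ < L) (hx : x ∈ Set.Icc ℓ L) : 0 ≤ density α ℓ L x := by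
  refine Real.rpow_nonneg ?_ _
  rw [one_sub_shift_sq hL]
  exact mul_nonneg (sq_nonneg _) (mul_nonneg (by linarith [hx.1]) (by linarith [hx.2]))

/-- A functional on polynomials that is positive and satisfies the Pearson equation of the weight
`(1 - x²) ^ (α - 1/2)`. -/
structure IsGegenbauerFunctional (α : ℝ) (Λ : ℝ[X] →ₗ[ℝ] ℝ) : Prop where
  pos : ∀ P, P ≠ 0 → 0 < Λ (P * P)
  pearson : ∀ P, Λ ((1 - X ^ 2) * derivative P) = (2 * α + 1) * Λ (X * P)

/-- Integration against the density, transported to `[-1, 1]`. -/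
noncomputable def gegenFunctional {α ℓ L : ℝ} (hα : -1 / 2 < α) (hL : ℓ < L) : ℝ[X] →ₗ[ℝ] ℝ where
  toFun R := ∫ x in ℓ..L, (R.comp (toUnit ℓ L)).eval x * density α ℓ L x
  map_add' P Q := by
    simp only [add_comp, eval_add, add_mul]
    exact intervalIntegral.integral_add
      (intervalIntegrable_mul_density hα hL (Polynomial.continuous _))
      (intervalIntegrable_mul_density hα hL (Polynomial.continuous _))
  map_smul' c P := by
    simp only [smul_comp, eval_smul, smul_eq_mul, mul_assoc, RingHom.id_apply]
    exact intervalIntegral.integral_const_mul _ _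

/-- Integrate the derivative of (1 - σ²) ^ (α + 1/2) P(σ) with σ = `shift`: it vanishes at both
endpoints because α + 1/2 > 0. The factor 2/(L - ℓ) in `Q` comes from the chain rule. -/
theorem gegenFunctional_pearson {α ℓ L : ℝ} (hα : -1 / 2 < α) (hL : ℓ < L) (P : ℝ[X]) :
    gegenFunctional hα hL ((1 - X ^ 2) * derivative P) =
      (2 * α + 1) * gegenFunctional hα hL (X * P) := by
  set c := 2 / (L - ℓ) with hc
  have hc0 : c ≠ 0 := by
    have : L - ℓ ≠ 0 := (sub_pos.2 hL).ne'
    positivity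
  set Q := c • ((1 - X ^ 2) * derivative P - (2 * α + 1) • (X * P)) with hQ
  suffices h : gegenFunctional hα hL Q = 0 by
    rw [hQ, map_smul, map_sub, map_smul, smul_eq_mul, smul_eq_mul, mul_eq_zero] at h
    linarith [h.resolve_left hc0]
  have hcont : ContinuousOn (fun x => (1 - shift ℓ L x ^ 2) ^ (α + 1 / 2) * P.eval (shift ℓ L x))
      (Set.Icc ℓ L) := by
    have hs := continuous_shift ℓ L
    refine (Continuous.mul ?_ (P.continuous.comp hs)).continuousOn
    exact Continuous.rpow_const (by fun_prop) fun x => Or.inr (by linarith)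
  have hderiv : ∀ x ∈ Set.Ioo ℓ L, HasDerivAt
      (fun x => (1 - shift ℓ L x ^ 2) ^ (α + 1 / 2) * P.eval (shift ℓ L x))
      ((Q.comp (toUnit ℓ L)).eval x * density α ℓ L x) x := by
    intro x hx
    have h0 := shift_sq_lt_one hL hx
    have h1 := hasDerivAt_shift ℓ L x
    have h2 := ((h1.pow 2).const_sub 1).rpow_const (p := α + 1 / 2) (Or.inl h0.ne')
    have h3 := (P.hasDerivAt (shift ℓ L x)).comp x h1
    refine (h2.mul h3).congr_deriv ?_
    have h4 : (1 - shift ℓ L x ^ 2) ^ (α + 1 / 2) =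
        (1 - shift ℓ L x ^ 2) * density α ℓ L x := by
      rw [density, show α + 1 / 2 = 1 + (α - 1 / 2) by ring, Real.rpow_add h0, Real.rpow_one]
    have h5 : (1 - shift ℓ L x ^ 2) ^ (α + 1 / 2 - 1) = density α ℓ L x := by
      rw [density]; congr 1; ring
    simp only [Pi.pow_apply, Function.comp_apply, h4, h5]
    rw [eval_comp, eval_toUnit, hQ]
    simp only [eval_smul, eval_sub, eval_mul, eval_one, eval_pow, eval_X, smul_eq_mul]
    rw [← hc]
    push_cast
    ring
  have hint := intervalIntegrable_mul_density hα hL (Polynomial.continuous (Q.comp (toUnit ℓ L)))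
  have hftc := intervalIntegral.integral_eq_sub_of_hasDerivAt_of_le hL.le hcont hderiv hint
  have h1 : 1 - shift ℓ L L ^ 2 = 0 := by rw [one_sub_shift_sq hL]; ring
  have h2 : 1 - shift ℓ L ℓ ^ 2 = 0 := by rw [one_sub_shift_sq hL]; ring
  rw [h1, h2, Real.zero_rpow (by linarith)] at hftc
  simpa [gegenFunctional] using hftc

theorem toUnit_natDegree {ℓ L : ℝ} (hL : ℓ < L) : (toUnit ℓ L).natDegree = 1 := by
  have : 2 / (L - ℓ) ≠ 0 := by
    have : L - ℓ ≠ 0 := (sub_pos.2 hL).ne'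
    positivity
  unfold toUnit
  rw [natDegree_sub_C, natDegree_C_mul_X _ this]

theorem comp_toUnit_ne_zero {ℓ L : ℝ} (hL : ℓ < L) {P : ℝ[X]} (hP : P ≠ 0) :
    P.comp (toUnit ℓ L) ≠ 0 := by
  intro h
  rcases comp_eq_zero_iff.1 h with h | ⟨-, h⟩
  · exact hP h
  · have := toUnit_natDegree hL
    rw [h, natDegree_C] at this
    omega

/-- A nonzero polynomial has finitely many roots and the density is positive inside, so the
integrand is positive almost everywhere. -/
theorem gegenFunctional_pos {α ℓ L : ℝ} (hα : -1 / 2 < α) (hL : ℓ < L) {P : ℝ[X]} (hP : P ≠ 0) :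
    0 < gegenFunctional hα hL (P * P) := by
  have hP' := comp_toUnit_ne_zero hL hP
  set R := P.comp (toUnit ℓ L) with hR
  have h1 : gegenFunctional hα hL (P * P) = ∫ x in ℓ..L, (R * R).eval x * density α ℓ L x := by
    simp [gegenFunctional, hR]
  have hint := intervalIntegrable_mul_density hα hL (Polynomial.continuous (R * R))
  rw [h1, intervalIntegral.integral_pos_iff_support_of_nonneg_ae' ?_ hint]
  · refine ⟨hL, ?_⟩
    have h2 : Set.Ioo ℓ L \ (R.rootSet ℝ) ⊆
        Function.support (fun x => (R * R).eval x * density α ℓ L x) ∩ Set.Ioc ℓ L := by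
      rintro x ⟨hx, hx2⟩
      refine ⟨?_, hx.1, hx.2.le⟩
      have h3 : R.eval x ≠ 0 := fun h => hx2 (by rw [mem_rootSet]; exact ⟨hP', by simpa using h⟩)
      rw [Function.mem_support, eval_mul]
      exact mul_ne_zero (mul_ne_zero h3 h3) (density_pos hL hx).ne'
    refine lt_of_lt_of_le ?_ (MeasureTheory.measure_mono h2)
    rw [MeasureTheory.measure_sdiff_null ((R.rootSet_finite ℝ).measure_zero _), Real.volume_Ioo]
    simpa using hL
  · rw [Set.uIoc_of_le hL.le]
    refine (MeasureTheory.ae_restrict_iff' measurableSet_Ioc).2 (Eventually.of_forall fun x hx => ?_)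
    simp only [Pi.zero_apply, eval_mul]
    exact mul_nonneg (mul_self_nonneg _) (density_nonneg hL ⟨hx.1.le, hx.2⟩)

theorem isGegenbauerFunctional_gegenFunctional {α ℓ L : ℝ} (hα : -1 / 2 < α) (hL : ℓ < L) :
    IsGegenbauerFunctional α (gegenFunctional hα hL) :=
  ⟨fun _ hP => gegenFunctional_pos hα hL hP, gegenFunctional_pearson hα hL⟩

/-- The Sobolev bilinear form of a functional. -/
noncomputable def sobForm (Λ : ℝ[X] →ₗ[ℝ] ℝ) (e : ℝ) : ℝ[X] →ₗ[ℝ] ℝ[X] →ₗ[ℝ] ℝ :=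
  LinearMap.mk₂ ℝ (fun P Q => Λ (P * Q) + e * Λ (derivative P * derivative Q))
    (fun P P' Q => by simp only [add_mul, map_add]; ring)
    (fun c P Q => by simp only [smul_mul_assoc, map_smul, smul_eq_mul]; ring)
    (fun P Q Q' => by simp only [mul_add, map_add]; ring)
    (fun c P Q => by simp only [mul_smul_comm, map_smul, smul_eq_mul]; ring)

theorem sobForm_apply (Λ : ℝ[X] →ₗ[ℝ] ℝ) (e : ℝ) (P Q : ℝ[X]) :
    sobForm Λ e P Q = Λ (P * Q) + e * Λ (derivative P * derivative Q) := rfl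

theorem sobForm_comm (Λ : ℝ[X] →ₗ[ℝ] ℝ) (e : ℝ) (P Q : ℝ[X]) :
    sobForm Λ e P Q = sobForm Λ e Q P := by
  rw [sobForm_apply, sobForm_apply, mul_comm P, mul_comm (derivative P)]

theorem sobForm_pos {α : ℝ} {Λ : ℝ[X] →ₗ[ℝ] ℝ} (h : IsGegenbauerFunctional α Λ) {e : ℝ}
    (he : 0 ≤ e) {P : ℝ[X]} (hP : P ≠ 0) : 0 < sobForm Λ e P P := by
  have h1 : 0 ≤ Λ (derivative P * derivative P) := by
    by_cases h2 : derivative P = 0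
    · simp [h2]
    · exact (h.pos _ h2).le
  have := h.pos P hP
  rw [sobForm_apply]; positivity

/-- Each derivative contributes a factor 2/(L - ℓ); their product is what turns η into η̃. -/
theorem sobInner_comp {α ℓ L : ℝ} (hα : -1 / 2 < α) (hL : ℓ < L) (η : ℝ) (P Q : ℝ[X]) :
    sobInner α ℓ L η (P.comp (toUnit ℓ L)) (Q.comp (toUnit ℓ L)) =
      sobForm (gegenFunctional hα hL) (etaT ℓ L η) P Q := by
  have hd : ∀ R : ℝ[X], derivative (R.comp (toUnit ℓ L)) =
      C (2 / (L - ℓ)) * (derivative R).comp (toUnit ℓ L) := fun R => by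
    rw [derivative_comp]; simp [toUnit]
  have h1 : ∀ x, (derivative (P.comp (toUnit ℓ L))).eval x *
      (derivative (Q.comp (toUnit ℓ L))).eval x * density α ℓ L x = (2 / (L - ℓ)) ^ 2 *
        (((derivative P * derivative Q).comp (toUnit ℓ L)).eval x * density α ℓ L x) := fun x => by
    rw [hd, hd, mul_comp]; simp only [eval_mul, eval_C]; ring
  rw [sobInner, sobForm_apply]
  simp only [h1, intervalIntegral.integral_const_mul]
  simp only [gegenFunctional, LinearMap.coe_mk, AddHom.coe_mk, etaT, mul_comp, eval_mul]
  ring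

/-- The inverse of `toUnit`. -/
noncomputable def ofUnit (ℓ L : ℝ) : ℝ[X] := C ((L - ℓ) / 2) * X + C ((L + ℓ) / 2)

theorem ofUnit_comp_toUnit {ℓ L : ℝ} (hL : ℓ < L) (P : ℝ[X]) :
    (P.comp (ofUnit ℓ L)).comp (toUnit ℓ L) = P := by
  have : L - ℓ ≠ 0 := (sub_pos.2 hL).ne'
  rw [comp_assoc]
  have h : (ofUnit ℓ L).comp (toUnit ℓ L) = X := Polynomial.funext fun x => by
    simp [ofUnit, toUnit]; field_simp; ring
  rw [h, comp_X]

theorem natDegree_comp_toUnit {ℓ L : ℝ} (hL : ℓ < L) (P : ℝ[X]) :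
    (P.comp (toUnit ℓ L)).natDegree = P.natDegree := by
  rw [natDegree_comp, toUnit_natDegree hL, mul_one]

theorem eval_zero_comp_toUnit (ℓ L : ℝ) (P : ℝ[X]) :
    (P.comp (toUnit ℓ L)).eval 0 = P.eval (sigma0 ℓ L) := by
  rw [eval_comp, eval_toUnit, shift_zero]

/-! ## Orthogonality -/

/-- A linear functional vanishing on polynomials of each degree `< n` vanishes on all polynomials
of degree `< n`. -/
theorem map_eq_zero_of_degree_lt {p : ℕ → ℝ[X]} (hp : ∀ i, (p i).natDegree = i) (hp0 : ∀ i, p i ≠ 0)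
    {φ : ℝ[X] →ₗ[ℝ] ℝ} {n : ℕ} (hφ : ∀ i < n, φ (p i) = 0) {R : ℝ[X]} (hR : R.degree < n) :
    φ R = 0 := by
  induction n generalizing R with
  | zero =>
    have : R = 0 := by simpa [Nat.WithBot.lt_zero_iff, degree_eq_bot] using hR
    simp [this]
  | succ n ih =>
    have h1 : (R - C (R.coeff n / (p n).leadingCoeff) * p n).degree < n := by
      rw [degree_lt_iff_coeff_zero]
      intro m hm
      rw [coeff_sub, coeff_C_mul]
      rcases hm.eq_or_lt with h | h
      · subst h
        have h2 : (p n).coeff n = (p n).leadingCoeff := by rw [leadingCoeff, hp]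
        have h3 : (p n).leadingCoeff ≠ 0 := leadingCoeff_ne_zero.2 (hp0 n)
        rw [h2]; field_simp; ring
      · rw [coeff_eq_zero_of_degree_lt (hR.trans_le (by exact_mod_cast h)),
          coeff_eq_zero_of_natDegree_lt (p := p n) (by rw [hp]; exact h)]
        ring
    have h2 := ih (fun i hi => hφ i (by omega)) h1
    rw [map_sub, C_mul', map_smul, hφ n (by omega), smul_zero, sub_zero] at h2
    exact h2

/-- Orthogonal sequences are unique up to scalars. -/
theorem orthogonal_unique {B : ℝ[X] →ₗ[ℝ] ℝ[X] →ₗ[ℝ] ℝ} (hB : ∀ P, P ≠ 0 → 0 < B P P)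
    {p q : ℕ → ℝ[X]} (hp : ∀ i, (p i).natDegree = i) (hp0 : ∀ i, p i ≠ 0)
    (hq : ∀ i, (q i).natDegree = i) (hq0 : ∀ i, q i ≠ 0)
    (hpo : ∀ i j, i ≠ j → B (p i) (p j) = 0) (hqo : ∀ i j, i ≠ j → B (q i) (q j) = 0) (i : ℕ) :
    p i = C ((p i).leadingCoeff / (q i).leadingCoeff) * q i := by
  set c := (p i).leadingCoeff / (q i).leadingCoeff with hc
  have hlq : (q i).leadingCoeff ≠ 0 := leadingCoeff_ne_zero.2 (hq0 i)
  have hlp : (p i).leadingCoeff ≠ 0 := leadingCoeff_ne_zero.2 (hp0 i)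
  have hc0 : c ≠ 0 := div_ne_zero hlp hlq
  -- `R` has degree below i, hence is orthogonal to both p i and q i, and so to itself.
  set R := p i - C c * q i with hR
  have hd : R.degree < i := by
    have h1 : (p i).degree = i := by rw [degree_eq_natDegree (hp0 i), hp]
    rw [← h1]
    refine degree_sub_lt_left ?_ (hp0 i) ?_
    · rw [degree_C_mul hc0, degree_eq_natDegree (hp0 i), degree_eq_natDegree (hq0 i), hp, hq]
    · rw [leadingCoeff_mul, leadingCoeff_C, hc]; field_simp
  have e1 : B (p i) R = 0 :=
    map_eq_zero_of_degree_lt hp hp0 (fun j hj => hpo i j (by omega)) hd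
  have e2 : B (q i) R = 0 :=
    map_eq_zero_of_degree_lt hq hq0 (fun j hj => hqo i j (by omega)) hd
  have e3 : B R R = 0 := by
    have e4 : B R R = B (p i) R - c * B (q i) R := by
      conv_lhs => rw [show B R = B (p i) - c • B (q i) by rw [hR, map_sub, C_mul', map_smul]]
      rfl
    rw [e4, e1, e2]; simp
  have : R = 0 := by
    by_contra h
    exact (hB R h).ne' e3
  exact sub_eq_zero.1 this

/-! ### Orthogonality of the Gegenbauer polynomials from the Pearson equation. -/

section Functional

variable {α : ℝ} {Λ : ℝ[X] →ₗ[ℝ] ℝ}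

theorem X_mul_gegen (α : ℝ) (t : ℕ) :
    X * gegen α (t + 1) = gegen α (t + 2) + C (gam α (t + 1)) * gegen α t := by
  rw [gegen]; ring

/-- The Pearson equation for G_{t+1}, combined with the structure relation, links Λ(G_{t+2}) to
Λ(G_t) alone. The factor t in this link removes Λ(G₀), so even moments vanish too. -/
theorem IsGegenbauerFunctional.map_gegen (h : IsGegenbauerFunctional α Λ) (hα : -1 / 2 < α) (t : ℕ) :
    Λ (gegen α (t + 1)) = 0 := by
  have step : ∀ t, Λ (gegen α (t + 2)) * (t + 2 + 2 * α) =
      gam α (t + 1) * t * Λ (gegen α t) := fun t => by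
    have h1 := h.pearson (gegen α (t + 1))
    rw [derivative_gegen hα, X_mul_gegen, C_mul', C_mul', C_mul'] at h1
    simp only [map_add, map_neg, map_smul, smul_eq_mul] at h1
    linear_combination -h1
  induction t using Nat.twoStepInduction with
  | zero =>
    have h1 := h.pearson 1
    rw [derivative_one, mul_zero, map_zero, mul_one, zero_eq_mul] at h1
    simp only [gegen]
    exact h1.resolve_left (by linarith)
  | one =>
    have h1 := step 0
    rw [Nat.cast_zero, mul_zero, zero_mul, mul_eq_zero] at h1
    exact h1.resolve_right (by linarith)
  | more t ih _ =>
    have h1 := step (t + 1)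
    rw [ih, mul_zero, mul_eq_zero] at h1
    have ht : (0 : ℝ) ≤ t := t.cast_nonneg
    exact h1.resolve_right (by push_cast; linarith)

/-- Induction on the smaller index: one factor X is moved from G_{m+2} to G_{n+1} by the three-term
recurrence. -/
theorem IsGegenbauerFunctional.gegen_orthogonal_of_lt (h : IsGegenbauerFunctional α Λ)
    (hα : -1 / 2 < α) {m n : ℕ} (hmn : m < n) : Λ (gegen α n * gegen α m) = 0 := by
  induction m using Nat.twoStepInduction generalizing n with
  | zero =>
    obtain ⟨n, rfl⟩ : ∃ k, n = k + 1 := ⟨n - 1, by omega⟩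
    rw [gegen, mul_one]; exact h.map_gegen hα n
  | one =>
    obtain ⟨n, rfl⟩ : ∃ k, n = k + 2 := ⟨n - 2, by omega⟩
    have h1 : gegen α (n + 2) * gegen α 1 =
        gegen α (n + 3) + C (gam α (n + 2)) * gegen α (n + 1) := by
      rw [← X_mul_gegen, gegen.eq_2, mul_comm]
    rw [h1, map_add, C_mul', map_smul, h.map_gegen hα (n + 2), h.map_gegen hα n]; simp
  | more m ih1 ih2 =>
    obtain ⟨n, rfl⟩ : ∃ k, n = k + 1 := ⟨n - 1, by omega⟩
    have h1 : gegen α (n + 1) * gegen α (m + 2) = gegen α (n + 2) * gegen α (m + 1) +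
        C (gam α (n + 1)) * (gegen α n * gegen α (m + 1)) -
          C (gam α (m + 1)) * (gegen α (n + 1) * gegen α m) := by
      rw [gegen.eq_3 α m, gegen.eq_3 α n]; ring
    rw [h1, map_sub, map_add, C_mul', C_mul', map_smul, map_smul, ih2 (by omega), ih2 (by omega),
      ih1 (by omega)]
    simp

theorem IsGegenbauerFunctional.gegen_orthogonal (h : IsGegenbauerFunctional α Λ)
    (hα : -1 / 2 < α) {m n : ℕ} (hmn : m ≠ n) : Λ (gegen α m * gegen α n) = 0 := by
  rcases hmn.lt_or_gt with h1 | h1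
  · rw [mul_comm]; exact h.gegen_orthogonal_of_lt hα h1
  · exact h.gegen_orthogonal_of_lt hα h1

theorem IsGegenbauerFunctional.gegen_mul_eq_zero (h : IsGegenbauerFunctional α Λ)
    (hα : -1 / 2 < α) {n : ℕ} {R : ℝ[X]} (hR : R.degree < n) : Λ (gegen α n * R) = 0 :=
  map_eq_zero_of_degree_lt (φ := Λ ∘ₗ LinearMap.mulLeft ℝ (gegen α n)) (natDegree_gegen α)
    (fun i => (gegen_monic α i).ne_zero)
    (fun _ hi => h.gegen_orthogonal_of_lt hα hi) hR

theorem IsGegenbauerFunctional.gegen_mul_monic (h : IsGegenbauerFunctional α Λ)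
    (hα : -1 / 2 < α) {n : ℕ} {R : ℝ[X]} (hR : R.Monic) (hn : R.natDegree = n) :
    Λ (gegen α n * R) = Λ (gegen α n * gegen α n) := by
  have h1 : (R - gegen α n).degree < n := by
    have h2 : R.degree = n := by rw [degree_eq_natDegree hR.ne_zero, hn]
    rw [← h2]
    refine degree_sub_lt_left ?_ hR.ne_zero (by rw [hR.leadingCoeff, (gegen_monic α n).leadingCoeff])
    rw [h2, degree_eq_natDegree (gegen_monic α n).ne_zero, natDegree_gegen]
  have h2 := h.gegen_mul_eq_zero hα h1
  rw [mul_sub, map_sub] at h2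
  linarith

/-- G_{n+1} may be replaced by X G_n in one factor; moving X to the other factor leaves only γ_{n+1}
G_n. -/
theorem IsGegenbauerFunctional.norm_gegen_succ (h : IsGegenbauerFunctional α Λ)
    (hα : -1 / 2 < α) (n : ℕ) :
    Λ (gegen α (n + 1) * gegen α (n + 1)) = gam α (n + 1) * Λ (gegen α n * gegen α n) := by
  have h1 : Λ (gegen α (n + 1) * (X * gegen α n)) = Λ (gegen α (n + 1) * gegen α (n + 1)) :=
    h.gegen_mul_monic hα (monic_X.mul (gegen_monic α n))
      (by rw [monic_X.natDegree_mul (gegen_monic α n), natDegree_X, natDegree_gegen, add_comm])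
  have h2 : gegen α (n + 1) * (X * gegen α n) =
      gegen α (n + 2) * gegen α n + C (gam α (n + 1)) * (gegen α n * gegen α n) := by
    rw [gegen]; ring
  rw [← h1, h2, map_add, h.gegen_orthogonal_of_lt hα (by omega), C_mul', map_smul, smul_eq_mul,
    zero_add]

end Functional

/-! ### Orthogonality of the Sobolev polynomials. -/

section Orthogonality

variable {α : ℝ} {Λ : ℝ[X] →ₗ[ℝ] ℝ}

theorem natDegree_sobMonic (α ℓ L η : ℝ) (t : ℕ) : (sobMonic α ℓ L η t).natDegree = t :=
  (sobMonic_monic_natDegree α ℓ L η t).2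

theorem sobMonic_monic (α ℓ L η : ℝ) (t : ℕ) : (sobMonic α ℓ L η t).Monic :=
  (sobMonic_monic_natDegree α ℓ L η t).1

theorem degree_sobMonic_lt (α ℓ L η : ℝ) {m n : ℕ} (h : m < n) :
    (sobMonic α ℓ L η m).degree < n := by
  rw [degree_eq_natDegree (sobMonic_monic α ℓ L η m).ne_zero, natDegree_sobMonic]
  exact_mod_cast h

theorem degree_derivative_sobMonic_lt (α ℓ L η : ℝ) {m n : ℕ} (h : m ≤ n) :
    (derivative (sobMonic α ℓ L η m)).degree < n := by
  rcases Nat.eq_zero_or_pos m with rfl | hm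
  · simp [sobMonic]
  · have h1 := degree_derivative_lt (sobMonic_monic α ℓ L η m).ne_zero
    rw [degree_eq_natDegree (sobMonic_monic α ℓ L η m).ne_zero, natDegree_sobMonic] at h1
    exact h1.trans_le (by exact_mod_cast h)

/-- Coherence at work: the derivative part of the form tests R' against the single polynomial
G_{n+1}, so all terms vanish when deg R < n. -/
theorem sobForm_gegen_sub (hα : -1 / 2 < α) (Λ : ℝ[X] →ₗ[ℝ] ℝ) (e : ℝ) (n : ℕ) (R : ℝ[X]) :
    sobForm Λ e (gegen α (n + 2) - C (xi α n) * gegen α n) R =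
      Λ (gegen α (n + 2) * R) - xi α n * Λ (gegen α n * R) +
        e * ((n + 2) * Λ (gegen α (n + 1) * derivative R)) := by
  have h1 := derivative_gegen_sub hα n
  rw [sobForm_apply, derivative_sub, derivative_C_mul, h1, sub_mul, map_sub, C_mul', C_mul',
    smul_mul_assoc, smul_mul_assoc, map_smul, map_smul, smul_eq_mul, smul_eq_mul]

theorem sobForm_sobMonic_add_two (hα : -1 / 2 < α) (Λ : ℝ[X] →ₗ[ℝ] ℝ) (e ℓ L η : ℝ) (n : ℕ)
    (R : ℝ[X]) : sobForm Λ e (sobMonic α ℓ L η (n + 2)) R =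
      dCoef α ℓ L η n * sobForm Λ e (sobMonic α ℓ L η n) R +
        (Λ (gegen α (n + 2) * R) - xi α n * Λ (gegen α n * R) +
          e * ((n + 2) * Λ (gegen α (n + 1) * derivative R))) := by
  rw [← sobForm_gegen_sub hα, sobMonic, map_add, LinearMap.add_apply, C_mul', map_smul,
    LinearMap.smul_apply, smul_eq_mul]

theorem IsGegenbauerFunctional.gegen_mul_sobMonic_succ (h : IsGegenbauerFunctional α Λ)
    (hα : -1 / 2 < α) (ℓ L η : ℝ) (n : ℕ) :
    Λ (gegen α n * sobMonic α ℓ L η (n + 1)) = 0 := by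
  rcases n with _ | n
  · simpa [gegen, sobMonic] using h.map_gegen hα 0
  · have h1 : gegen α (n + 1) * sobMonic α ℓ L η (n + 2) =
        dCoef α ℓ L η n • (gegen α (n + 1) * sobMonic α ℓ L η n) +
          (gegen α (n + 1) * gegen α (n + 2) - xi α n • (gegen α (n + 1) * gegen α n)) := by
      rw [sobMonic, ← C_mul', ← C_mul']; ring
    rw [h1, map_add, map_sub, map_smul, map_smul,
      h.gegen_mul_eq_zero hα (degree_sobMonic_lt α ℓ L η n.lt_succ_self),
      h.gegen_orthogonal hα (by omega), h.gegen_orthogonal hα (by omega)]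
    simp

/-- By `h0` only the bracket of the recurrence contributes. `e1` and `e2` give the components
needed: d_n - ξ_n of Q_{n+2} along G_n, and n + 2 of its derivative along G_{n+1}. The hypothesis
`h0` is supplied by the induction that follows. -/
theorem IsGegenbauerFunctional.sobMonic_add_two_aux (h : IsGegenbauerFunctional α Λ)
    (hα : -1 / 2 < α) (ℓ L η : ℝ) (n : ℕ)
    (h0 : sobForm Λ (etaT ℓ L η) (sobMonic α ℓ L η n) (sobMonic α ℓ L η (n + 2)) = 0) :
    sobForm Λ (etaT ℓ L η) (sobMonic α ℓ L η (n + 2)) (sobMonic α ℓ L η (n + 2)) =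
      dDenom α ℓ L η n * Λ (gegen α n * gegen α n) := by
  rw [sobForm_sobMonic_add_two hα, h0,
    h.gegen_mul_monic hα (sobMonic_monic α ℓ L η (n + 2)) (natDegree_sobMonic α ℓ L η (n + 2))]
  have e1 : gegen α n * sobMonic α ℓ L η (n + 2) =
        dCoef α ℓ L η n • (gegen α n * sobMonic α ℓ L η n) +
          (gegen α n * gegen α (n + 2) - xi α n • (gegen α n * gegen α n)) := by
    rw [sobMonic, ← C_mul', ← C_mul']; ring
  have e2 : gegen α (n + 1) * derivative (sobMonic α ℓ L η (n + 2)) =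
      dCoef α ℓ L η n • (gegen α (n + 1) * derivative (sobMonic α ℓ L η n)) +
        ((n : ℝ) + 2) • (gegen α (n + 1) * gegen α (n + 1)) := by
    have h1 := derivative_gegen_sub hα n
    rw [sobMonic, derivative_add, derivative_sub, derivative_C_mul, derivative_C_mul, h1, ← C_mul',
      ← C_mul']; ring
  rw [e1, e2]
  simp only [map_add, map_sub, map_smul, smul_eq_mul]
  rw [h.gegen_mul_monic hα (sobMonic_monic α ℓ L η n) (natDegree_sobMonic α ℓ L η n),
    h.gegen_orthogonal hα (by omega : n ≠ n + 2),
    h.gegen_mul_eq_zero hα (degree_derivative_sobMonic_lt α ℓ L η n.le_succ),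
    h.norm_gegen_succ hα (n + 1), h.norm_gegen_succ hα n, dDenom]
  ring

/-- The second conjunct says that d_n is exactly the coefficient making Q_{n+2} orthogonal to Q_n.
Smaller indices are handled by degree, and index n + 1 because Q_{n+1} has no component along G_n.
The norm of Q_{n+2} then renews the second conjunct. -/
theorem IsGegenbauerFunctional.sobMonic_aux (h : IsGegenbauerFunctional α Λ) (hα : -1 / 2 < α)
    {ℓ L η : ℝ} (hL : ℓ < L) (hη : 0 < η) (n : ℕ) :
    (∀ j < n, sobForm Λ (etaT ℓ L η) (sobMonic α ℓ L η n) (sobMonic α ℓ L η j) = 0) ∧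
      dCoef α ℓ L η n * sobForm Λ (etaT ℓ L η) (sobMonic α ℓ L η n) (sobMonic α ℓ L η n) =
        xi α n * Λ (gegen α n * gegen α n) := by
  induction n using Nat.twoStepInduction with
  | zero => simp [sobForm_apply, sobMonic, gegen, dCoef]
  | one =>
    refine ⟨fun j hj => ?_, ?_⟩
    · obtain rfl : j = 0 := by omega
      simpa [sobForm_apply, sobMonic, gegen] using h.map_gegen hα 0
    · have h1 := h.norm_gegen_succ hα 0
      have h2 := dCoef_one (ℓ := ℓ) hα hL hη
      simp only [sobForm_apply, sobMonic, gegen, zero_add, derivative_X, mul_one] at h1 ⊢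
      rw [h1]
      linear_combination Λ 1 * h2
  | more n ih1 ih2 =>
    have h1 : ∀ j < n + 2,
        sobForm Λ (etaT ℓ L η) (sobMonic α ℓ L η (n + 2)) (sobMonic α ℓ L η j) = 0 := by
      intro j hj
      have a1 := h.gegen_mul_eq_zero hα (degree_sobMonic_lt α ℓ L η hj)
      have a2 : Λ (gegen α (n + 1) * derivative (sobMonic α ℓ L η j)) = 0 :=
        h.gegen_mul_eq_zero hα
          (degree_derivative_sobMonic_lt α ℓ L η (by omega : j ≤ n + 1))
      rw [sobForm_sobMonic_add_two hα, a1, a2]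
      rcases lt_trichotomy j n with hj | rfl | hj'
      · rw [ih1.1 j hj, h.gegen_mul_eq_zero hα (degree_sobMonic_lt α ℓ L η hj)]; ring
      · rw [h.gegen_mul_monic hα (sobMonic_monic α ℓ L η j) (natDegree_sobMonic α ℓ L η j)]
        linear_combination ih1.2
      · obtain rfl : j = n + 1 := by omega
        rw [sobForm_comm, ih2.1 n (by omega), h.gegen_mul_sobMonic_succ hα]; ring
    refine ⟨h1, ?_⟩
    rw [h.sobMonic_add_two_aux hα ℓ L η n (by rw [sobForm_comm]; exact h1 n (by omega)),
      h.norm_gegen_succ hα (n + 1), h.norm_gegen_succ hα n, dCoef_add_two]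
    have := (dDenom_pos (ℓ := ℓ) hα hL hη n).ne'
    field_simp

theorem IsGegenbauerFunctional.sobMonic_orthogonal (h : IsGegenbauerFunctional α Λ)
    (hα : -1 / 2 < α) {ℓ L η : ℝ} (hL : ℓ < L) (hη : 0 < η) {i j : ℕ} (hij : i ≠ j) :
    sobForm Λ (etaT ℓ L η) (sobMonic α ℓ L η i) (sobMonic α ℓ L η j) = 0 := by
  rcases hij.lt_or_gt with h1 | h1
  · rw [sobForm_comm]; exact (h.sobMonic_aux hα hL hη j).1 i h1
  · exact (h.sobMonic_aux hα hL hη i).1 j h1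

end Orthogonality

/-! ## Residual polynomials -/

/-- A polynomial on `[-1, 1]` transported to `[ℓ, L]` and normalized at `0`. -/
noncomputable def residualPoly (ℓ L : ℝ) (q : ℝ[X]) : ℝ[X] :=
  C (q.eval (sigma0 ℓ L))⁻¹ * q.comp (toUnit ℓ L)

theorem residual_eq_comp (ℓ L : ℝ) (q : ℝ[X]) :
    residualPoly ℓ L q = (C (q.eval (sigma0 ℓ L))⁻¹ * q).comp (toUnit ℓ L) := by
  rw [mul_comp, C_comp, residualPoly]

theorem sobInner_residual {α ℓ L : ℝ} (hα : -1 / 2 < α) (hL : ℓ < L) (η : ℝ) (p q : ℝ[X]) :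
    sobInner α ℓ L η (residualPoly ℓ L p) (residualPoly ℓ L q) =
      sobForm (gegenFunctional hα hL) (etaT ℓ L η) p q /
        (p.eval (sigma0 ℓ L) * q.eval (sigma0 ℓ L)) := by
  rw [residual_eq_comp, residual_eq_comp, sobInner_comp hα hL, C_mul', C_mul', map_smul, map_smul,
    LinearMap.smul_apply, smul_eq_mul, smul_eq_mul]
  field_simp

theorem etaT_nonneg {ℓ L η : ℝ} (hη : 0 ≤ η) : 0 ≤ etaT ℓ L η := by
  unfold etaT; positivity

theorem isResidualOrthogonal_residual {α ℓ L η : ℝ} (hα : -1 / 2 < α) (hL : ℓ < L) (hη : 0 ≤ η)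
    {q : ℕ → ℝ[X]} (hq : ∀ i, (q i).natDegree = i) (hq0 : ∀ i, (q i).eval (sigma0 ℓ L) ≠ 0)
    (ho : ∀ i j, i ≠ j → sobForm (gegenFunctional hα hL) (etaT ℓ L η) (q i) (q j) = 0) :
    IsResidualOrthogonal α ℓ L η fun i => residualPoly ℓ L (q i) := by
  refine ⟨fun i => ⟨?_, ?_, ?_⟩, fun i j hij => ?_⟩
  · change (residualPoly ℓ L (q i)).natDegree = i
    rw [residualPoly, natDegree_C_mul (inv_ne_zero (hq0 i)), natDegree_comp_toUnit hL, hq]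
  · change (residualPoly ℓ L (q i)).eval 0 = 1
    rw [residualPoly, eval_mul, eval_C, eval_zero_comp_toUnit, inv_mul_cancel₀ (hq0 i)]
  · rw [sobInner_residual hα hL]
    have h1 : q i ≠ 0 := fun h => hq0 i (by simp [h])
    exact div_pos (sobForm_pos (isGegenbauerFunctional_gegenFunctional hα hL) (etaT_nonneg hη) h1)
      (mul_self_pos.2 (hq0 i))
  · rw [sobInner_residual hα hL, ho i j hij, zero_div]

/-- The Sobolev product as a bilinear form. -/
noncomputable def sobInnerForm {α ℓ L : ℝ} (hα : -1 / 2 < α) (hL : ℓ < L) (η : ℝ) :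
    ℝ[X] →ₗ[ℝ] ℝ[X] →ₗ[ℝ] ℝ :=
  (sobForm (gegenFunctional hα hL) (etaT ℓ L η)).compl₁₂ (aeval (ofUnit ℓ L)).toLinearMap
    (aeval (ofUnit ℓ L)).toLinearMap

theorem sobInnerForm_eq {α ℓ L : ℝ} (hα : -1 / 2 < α) (hL : ℓ < L) (η : ℝ) (P Q : ℝ[X]) :
    sobInnerForm hα hL η P Q = sobForm (gegenFunctional hα hL) (etaT ℓ L η)
      (P.comp (ofUnit ℓ L)) (Q.comp (ofUnit ℓ L)) := by
  rw [comp_eq_aeval, comp_eq_aeval, sobInnerForm, LinearMap.compl₁₂_apply]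
  simp only [AlgHom.toLinearMap_apply]

theorem sobInnerForm_apply {α ℓ L : ℝ} (hα : -1 / 2 < α) (hL : ℓ < L) (η : ℝ) (P Q : ℝ[X]) :
    sobInnerForm hα hL η P Q = sobInner α ℓ L η P Q := by
  have h := sobInner_comp hα hL η (P.comp (ofUnit ℓ L)) (Q.comp (ofUnit ℓ L))
  rw [ofUnit_comp_toUnit hL, ofUnit_comp_toUnit hL] at h
  rw [h, sobInnerForm_eq]

theorem sobInnerForm_pos {α ℓ L η : ℝ} (hα : -1 / 2 < α) (hL : ℓ < L) (hη : 0 ≤ η) {P : ℝ[X]}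
    (hP : P ≠ 0) : 0 < sobInnerForm hα hL η P P := by
  rw [sobInnerForm_eq]
  refine sobForm_pos (isGegenbauerFunctional_gegenFunctional hα hL) (etaT_nonneg hη) ?_
  intro h
  have h1 := ofUnit_comp_toUnit hL P
  rw [h, zero_comp] at h1
  exact hP h1.symm

theorem sobInnerForm_comm {α ℓ L : ℝ} (hα : -1 / 2 < α) (hL : ℓ < L) (η : ℝ) (P Q : ℝ[X]) :
    sobInnerForm hα hL η P Q = sobInnerForm hα hL η Q P := by
  rw [sobInnerForm_eq, sobInnerForm_eq, sobForm_comm]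

theorem IsResidualOrthogonal.ne_zero {α ℓ L η : ℝ} {S : ℕ → ℝ[X]}
    (hS : IsResidualOrthogonal α ℓ L η S) (i : ℕ) : S i ≠ 0 := fun h => by
  have := (hS.1 i).2.1
  simp [h] at this

/-- Uniqueness identifies any given sequence with the concrete one. The normalization S_i(0) = 1
forces the concrete polynomials not to vanish at σ₀, which is all that the later formulas need. -/
theorem IsResidualOrthogonal.eq_residual {α ℓ L η : ℝ} (hα : -1 / 2 < α) (hL : ℓ < L) (hη : 0 ≤ η)
    {S : ℕ → ℝ[X]} (hS : IsResidualOrthogonal α ℓ L η S) {q : ℕ → ℝ[X]}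
    (hq : ∀ i, (q i).natDegree = i) (hq0 : ∀ i, q i ≠ 0)
    (ho : ∀ i j, i ≠ j → sobForm (gegenFunctional hα hL) (etaT ℓ L η) (q i) (q j) = 0) (i : ℕ) :
    (q i).eval (sigma0 ℓ L) ≠ 0 ∧ S i = residualPoly ℓ L (q i) := by
  have h1 := orthogonal_unique (fun P hP => sobInnerForm_pos hα hL hη hP) (fun i => (hS.1 i).1)
    hS.ne_zero (q := fun i => (q i).comp (toUnit ℓ L))
    (fun i => by rw [natDegree_comp_toUnit hL, hq])
    (fun i => comp_toUnit_ne_zero hL (hq0 i))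
    (fun i j hij => by rw [sobInnerForm_apply]; exact hS.2 i j hij)
    (fun i j hij => by rw [sobInnerForm_apply, sobInner_comp hα hL]; exact ho i j hij) i
  set c := (S i).leadingCoeff / ((q i).comp (toUnit ℓ L)).leadingCoeff
  have h2 := (hS.1 i).2.1
  rw [h1, eval_mul, eval_C, eval_zero_comp_toUnit] at h2
  have h3 : (q i).eval (sigma0 ℓ L) ≠ 0 := fun h => by simp [h] at h2
  refine ⟨h3, ?_⟩
  rw [h1, residualPoly, eq_inv_of_mul_eq_one_left h2]

/-- Minimization of the Sobolev norm in terms of an orthogonal sequence. -/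
theorem isOptimalResidual_iff {α ℓ L η : ℝ} (hα : -1 / 2 < α) (hL : ℓ < L) (hη : 0 ≤ η)
    {S : ℕ → ℝ[X]} (hS : IsResidualOrthogonal α ℓ L η S) {a : ℕ → ℝ}
    (ha : ∀ i, a i = sobInner α ℓ L η (S 0) (S 0) / sobInner α ℓ L η (S i) (S i)) (t : ℕ)
    (Q : ℝ[X]) : IsOptimalResidual α ℓ L η t Q ↔
      Q = C (1 / ∑ i ∈ Finset.range (t + 1), a i) *
        ∑ i ∈ Finset.range (t + 1), C (a i) * S i := by
  set A := ∑ i ∈ Finset.range (t + 1), a i with hA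
  set P := C (1 / A) * ∑ i ∈ Finset.range (t + 1), C (a i) * S i with hP
  have hpos : ∀ i, 0 < a i := fun i => by
    rw [ha]; exact div_pos (hS.1 0).2.2 (hS.1 i).2.2
  have hA0 : 0 < A := Finset.sum_pos (fun i _ => hpos i) ⟨0, by simp⟩
  have hPdeg : P.natDegree ≤ t := by
    refine (natDegree_C_mul_le _ _).trans (natDegree_sum_le_of_forall_le _ _ fun i hi => ?_)
    refine (natDegree_C_mul_le _ _).trans ?_
    rw [(hS.1 i).1]; exact Nat.lt_succ_iff.1 (Finset.mem_range.1 hi)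
  have hP0 : P.eval 0 = 1 := by
    rw [hP, eval_mul, eval_C, eval_finsetSum]
    simp only [eval_mul, eval_C, fun i => (hS.1 i).2.1, mul_one]
    rw [← hA]; field_simp
  set w := sobInner α ℓ L η (S 0) (S 0) with hw
  -- Since a_j ‖S_j‖² = w for every j, this product does not depend on j.
  have hPS : ∀ j < t + 1, sobInnerForm hα hL η P (S j) = w / A := by
    intro j hj
    have h1 : sobInnerForm hα hL η P (S j) = 1 / A * ∑ i ∈ Finset.range (t + 1),
        a i * sobInner α ℓ L η (S i) (S j) := by
      rw [hP, C_mul', map_smul, map_sum, LinearMap.smul_apply, LinearMap.sum_apply, smul_eq_mul]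
      congr 1
      refine Finset.sum_congr rfl fun i _ => ?_
      rw [C_mul', map_smul, LinearMap.smul_apply, sobInnerForm_apply, smul_eq_mul]
    rw [h1, Finset.sum_eq_single j (fun i _ hij => by rw [hS.2 i j hij, mul_zero])
      (fun h => (h (Finset.mem_range.2 hj)).elim), ha j, div_mul_cancel₀ _ (hS.1 j).2.2.ne']
    ring
  -- Up to the factor w / A, P is the reproducing kernel at 0. Thus R - P is orthogonal to P
  -- whenever R(0) = 1, and Pythagoras applies.
  have hPR : ∀ R : ℝ[X], R.natDegree ≤ t → sobInnerForm hα hL η P R = w / A * R.eval 0 := by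
    intro R hR
    have h1 := map_eq_zero_of_degree_lt (n := t + 1)
      (φ := sobInnerForm hα hL η P - (w / A) • (leval (0 : ℝ))) (fun i => (hS.1 i).1) hS.ne_zero
      (fun i hi => by
        rw [LinearMap.sub_apply, hPS i hi, LinearMap.smul_apply, leval_apply, (hS.1 i).2.1]
        simp) (R := R) (degree_le_natDegree.trans_lt (by exact_mod_cast Nat.lt_succ_iff.2 hR))
    rw [LinearMap.sub_apply, LinearMap.smul_apply, leval_apply, smul_eq_mul] at h1
    linarith
  have hdecomp : ∀ R : ℝ[X], R.natDegree ≤ t → R.eval 0 = 1 → sobInner α ℓ L η R R =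
      sobInner α ℓ L η P P + sobInnerForm hα hL η (R - P) (R - P) := by
    intro R hR hR0
    have h1 := hPR R hR
    have h2 := hPR P hPdeg
    rw [hR0] at h1
    rw [hP0] at h2
    have h3 : sobInnerForm hα hL η (R - P) (R - P) = sobInnerForm hα hL η R R -
        sobInnerForm hα hL η P R - sobInnerForm hα hL η R P + sobInnerForm hα hL η P P := by
      simp only [map_sub, LinearMap.sub_apply]; ring
    rw [h3, sobInnerForm_comm hα hL η R P, ← sobInnerForm_apply hα hL, ← sobInnerForm_apply hα hL]
    linarith
  have hnn : ∀ R : ℝ[X], 0 ≤ sobInnerForm hα hL η R R := fun R => by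
    by_cases h : R = 0
    · simp [h]
    · exact (sobInnerForm_pos hα hL hη h).le
  constructor
  · rintro ⟨h1, h2, h3⟩
    have h4 := h3 P hPdeg hP0
    rw [hdecomp Q h1 h2] at h4
    by_contra h
    have := sobInnerForm_pos hα hL hη (sub_ne_zero.2 h)
    linarith
  · rintro rfl
    exact ⟨hPdeg, hP0, fun R hR hR0 => by rw [hdecomp R hR hR0]; linarith [hnn (R - P)]⟩

/-! ## Parameters of Heavy Ball -/

/-- With z = √m = (√L - √ℓ)/(√L + √ℓ), the point -σ₀ is (z + 1/z)/2. All asymptotics are expressed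
through this Joukowski parameter. -/
theorem hb_parameters {ℓ L : ℝ} (hℓ : 0 < ℓ) (hL : ℓ < L) :
    0 < √(hbMomentum ℓ L) ∧ √(hbMomentum ℓ L) < 1 ∧
      hbMomentum ℓ L = √(hbMomentum ℓ L) ^ 2 ∧
      (L + ℓ) / (L - ℓ) = (1 + √(hbMomentum ℓ L) ^ 2) / (2 * √(hbMomentum ℓ L)) ∧
      hbStep ℓ L = 4 * √(hbMomentum ℓ L) / (L - ℓ) := by
  have hL0 : 0 < L := hℓ.trans hL
  obtain ⟨a, ha, rfl⟩ : ∃ a, 0 < a ∧ ℓ = a ^ 2 :=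
    ⟨√ℓ, Real.sqrt_pos.2 hℓ, (Real.sq_sqrt hℓ.le).symm⟩
  obtain ⟨b, hb, rfl⟩ : ∃ b, 0 < b ∧ L = b ^ 2 :=
    ⟨√L, Real.sqrt_pos.2 hL0, (Real.sq_sqrt hL0.le).symm⟩
  have hab : a < b := lt_of_pow_lt_pow_left₀ 2 hb.le hL
  have hba : 0 < b - a := sub_pos.2 hab
  have h1 : hbMomentum (a ^ 2) (b ^ 2) = ((b - a) / (b + a)) ^ 2 := by
    rw [hbMomentum, ← div_pow, Real.sqrt_sq (by positivity)]
    congr 1; field_simp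
  have h2 : √(hbMomentum (a ^ 2) (b ^ 2)) = (b - a) / (b + a) := by
    rw [h1, Real.sqrt_sq (by positivity)]
  have h3 : b ^ 2 - a ^ 2 = (b - a) * (b + a) := by ring
  rw [h2, h1, h3]
  refine ⟨by positivity, by rw [div_lt_one (by positivity)]; linarith, rfl, ?_, ?_⟩
  · field_simp; ring
  · rw [hbStep, Real.sqrt_sq ha.le, Real.sqrt_sq hb.le]; field_simp; ring

theorem one_lt_ratio {ℓ L : ℝ} (hℓ : 0 < ℓ) (hL : ℓ < L) : 1 < (L + ℓ) / (L - ℓ) := by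
  rw [lt_div_iff₀ (sub_pos.2 hL)]; linarith

theorem sigma0_eq_neg (ℓ L : ℝ) : sigma0 ℓ L = -((L + ℓ) / (L - ℓ)) := rfl

/-! ## The coefficients as ratios of values at the origin -/

section Values

variable {α ℓ L η : ℝ}

theorem eval_gegen_sigma0_ne_zero (hα : -1 / 2 < α) (hℓ : 0 < ℓ) (hL : ℓ < L) (t : ℕ) :
    (gegen α t).eval (sigma0 ℓ L) ≠ 0 := by
  rw [sigma0_eq_neg, eval_neg_gegen]
  exact mul_ne_zero (by simp) (eval_gegen_pos hα (one_lt_ratio hℓ hL).le t).ne'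

/-- The recursion of δ is the three-term recurrence at σ₀ divided by the current value. The default
`delta 0 = 0` makes the first step come out as 1/σ₀. -/
theorem delta_succ (hα : -1 / 2 < α) (hℓ : 0 < ℓ) (hL : ℓ < L) (t : ℕ) : delta α ℓ L (t + 1) =
    (gegen α t).eval (sigma0 ℓ L) / (gegen α (t + 1)).eval (sigma0 ℓ L) := by
  induction t with
  | zero => simp [delta, gegen]
  | succ t ih =>
    have h1 := eval_gegen_sigma0_ne_zero hα hℓ hL (t + 1)
    have h2 := eval_gegen_sigma0_ne_zero hα hℓ hL (t + 2)
    rw [eval_gegen_add_two] at h2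
    rw [delta, ih, eval_gegen_add_two]
    field_simp

theorem stepSize_succ (hα : -1 / 2 < α) (hℓ : 0 < ℓ) (hL : ℓ < L) (t : ℕ) :
    stepSize α ℓ L (t + 1) = -(2 / (L - ℓ) * ((gegen α t).eval (sigma0 ℓ L) /
      (gegen α (t + 1)).eval (sigma0 ℓ L))) := by
  rw [stepSize, delta_succ hα hℓ hL]; ring

theorem momentum_succ (α ℓ L : ℝ) (t : ℕ) :
    momentum α ℓ L (t + 1) = delta α ℓ L (t + 1) * sigma0 ℓ L - 1 := by
  rw [momentum, sigma0_eq_neg]; ring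

theorem momentum_add_two (hα : -1 / 2 < α) (hℓ : 0 < ℓ) (hL : ℓ < L) (t : ℕ) :
    momentum α ℓ L (t + 2) = gam α (t + 1) * ((gegen α t).eval (sigma0 ℓ L) /
      (gegen α (t + 2)).eval (sigma0 ℓ L)) := by
  have h2 := eval_gegen_sigma0_ne_zero hα hℓ hL (t + 2)
  rw [momentum_succ, delta_succ hα hℓ hL (t + 1)]
  have h3 := eval_gegen_add_two α (sigma0 ℓ L) t
  field_simp
  linear_combination -h3

theorem deltaP_add_two (hα : -1 / 2 < α) (hℓ : 0 < ℓ) (hL : ℓ < L) (t : ℕ) :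
    deltaP α ℓ L (t + 2) =
      (gegen α t).eval (sigma0 ℓ L) / (gegen α (t + 2)).eval (sigma0 ℓ L) := by
  have h1 : deltaP α ℓ L (t + 2) = momentum α ℓ L (t + 2) / gam α (t + 1) := rfl
  rw [h1, momentum_add_two hα hℓ hL, mul_div_cancel_left₀ _ (gam_pos hα t).ne']

/-- Divide the Sobolev recurrence at σ₀ by G_{t+2}(σ₀) and take reciprocals. The formulas for τ and
Δ^S below are the same recurrence divided by G_t(σ₀) and by G_t(σ₀)Q_{t+2}(σ₀)-type normalizations,
so that all three express change of normalization between G and Q. -/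
theorem kap_eq (hα : -1 / 2 < α) (hℓ : 0 < ℓ) (hL : ℓ < L)
    (hQ : ∀ t, (sobMonic α ℓ L η t).eval (sigma0 ℓ L) ≠ 0) (t : ℕ) : kap α ℓ L η t =
      (gegen α t).eval (sigma0 ℓ L) / (sobMonic α ℓ L η t).eval (sigma0 ℓ L) := by
  induction t using Nat.twoStepInduction with
  | zero => simp [kap, gegen, sobMonic]
  | one =>
    have h1 := hQ 1
    simp only [sobMonic] at h1
    simp only [kap, gegen, sobMonic]
    rw [div_self h1]
  | more t ih _ =>
    have h0 := hQ t
    have h2 := hQ (t + 2)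
    have g0 := eval_gegen_sigma0_ne_zero hα hℓ hL t
    have g2 := eval_gegen_sigma0_ne_zero hα hℓ hL (t + 2)
    have e := eval_sobMonic_add_two α ℓ L η (sigma0 ℓ L) t
    rw [kap, ih, deltaP_add_two hα hℓ hL]
    rw [one_div, inv_eq_iff_eq_inv, inv_div, e]
    field_simp
    ring

theorem tau_add_two (hα : -1 / 2 < α) (hℓ : 0 < ℓ) (hL : ℓ < L)
    (hQ : ∀ t, (sobMonic α ℓ L η t).eval (sigma0 ℓ L) ≠ 0) (t : ℕ) : tau α ℓ L η (t + 2) =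
      (gegen α t).eval (sigma0 ℓ L) / (sobMonic α ℓ L η (t + 2)).eval (sigma0 ℓ L) := by
  have h0 := hQ t
  have g0 := eval_gegen_sigma0_ne_zero hα hℓ hL t
  have g2 := eval_gegen_sigma0_ne_zero hα hℓ hL (t + 2)
  have e := eval_sobMonic_add_two α ℓ L η (sigma0 ℓ L) t
  rw [tau, Nat.add_sub_cancel, kap_eq hα hℓ hL hQ, deltaP_add_two hα hℓ hL]
  rw [one_div, inv_eq_iff_eq_inv, inv_div, e]
  field_simp
  ring

theorem deltaS_add_two (hα : -1 / 2 < α) (hℓ : 0 < ℓ) (hL : ℓ < L)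
    (hQ : ∀ t, (sobMonic α ℓ L η t).eval (sigma0 ℓ L) ≠ 0) (t : ℕ) : deltaS α ℓ L η (t + 2) =
      (sobMonic α ℓ L η t).eval (sigma0 ℓ L) /
        (sobMonic α ℓ L η (t + 2)).eval (sigma0 ℓ L) := by
  have h0 := hQ t
  have g0 := eval_gegen_sigma0_ne_zero hα hℓ hL t
  have g2 := eval_gegen_sigma0_ne_zero hα hℓ hL (t + 2)
  have e := eval_sobMonic_add_two α ℓ L η (sigma0 ℓ L) t
  rw [deltaS, Nat.add_sub_cancel, kap_eq hα hℓ hL hQ, deltaP_add_two hα hℓ hL]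
  rw [one_div, inv_eq_iff_eq_inv, inv_div, e]
  field_simp

/-- The squared `L²` norm of the monic Gegenbauer polynomials, relative to that of `1`. -/
noncomputable def gamProd (α : ℝ) (t : ℕ) : ℝ := ∏ i ∈ Finset.range t, gam α (i + 1)

theorem gamProd_succ (α : ℝ) (t : ℕ) : gamProd α (t + 1) = gamProd α t * gam α (t + 1) :=
  Finset.prod_range_succ _ _

theorem gamProd_pos (hα : -1 / 2 < α) (t : ℕ) : 0 < gamProd α t :=
  Finset.prod_pos fun i _ => gam_pos hα i

/-- With ‖Q_t‖² = ξ_t ‖G_t‖² / d_t and ‖G_t‖² proportional to `gamProd`, the right side is the ratio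
‖S_0‖² / ‖S_t‖². -/
theorem aCoef_eq (hα : -1 / 2 < α) (hℓ : 0 < ℓ) (hL : ℓ < L) (hη : 0 < η)
    (hQ : ∀ t, (sobMonic α ℓ L η t).eval (sigma0 ℓ L) ≠ 0) (t : ℕ) : aCoef α ℓ L η t =
      dCoef α ℓ L η t * (sobMonic α ℓ L η t).eval (sigma0 ℓ L) ^ 2 /
        (xi α t * gamProd α t) := by
  induction t using Nat.twoStepInduction with
  | zero =>
    have := xi_ne_zero hα 0
    simp [aCoef, dCoef, sobMonic, gamProd, this]
  | one =>
    simp only [aCoef, sobMonic, gamProd, eval_X, sigma0_eq_neg, Finset.prod_range_one]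
    ring
  | more t ih _ =>
    have h0 := hQ t
    have h2 := hQ (t + 2)
    have hd := dCoef_ne_zero (ℓ := ℓ) (η := η) hα hL hη t
    have hx := xi_ne_zero hα t
    have hx2 := xi_ne_zero hα (t + 2)
    have hk := (gamProd_pos hα t).ne'
    have hg1 := (gam_pos hα t).ne'
    have hg2 := (gam_pos hα (t + 1)).ne'
    rw [aCoef, ih, deltaS_add_two hα hℓ hL hQ, gamProd_succ, gamProd_succ]
    field_simp

/-- For the asymptotics d_t, which tends to 0, is traded for `dDenom`, whose growth is known. -/
theorem aCoef_add_two (hα : -1 / 2 < α) (hℓ : 0 < ℓ) (hL : ℓ < L) (hη : 0 < η)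
    (hQ : ∀ t, (sobMonic α ℓ L η t).eval (sigma0 ℓ L) ≠ 0) (t : ℕ) : aCoef α ℓ L η (t + 2) =
      (sobMonic α ℓ L η (t + 2)).eval (sigma0 ℓ L) ^ 2 /
        (dDenom α ℓ L η t * gamProd α t) := by
  have hx2 := xi_ne_zero hα (t + 2)
  have hk := (gamProd_pos hα t).ne'
  have hg1 := (gam_pos hα t).ne'
  have hg2 := (gam_pos hα (t + 1)).ne'
  have hD := (dDenom_pos (ℓ := ℓ) hα hL hη t).ne'
  rw [aCoef_eq hα hℓ hL hη hQ, dCoef_add_two, gamProd_succ, gamProd_succ]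
  field_simp

theorem aCoef_pos (hα : -1 / 2 < α) (hℓ : 0 < ℓ) (hL : ℓ < L) (hη : 0 < η)
    (hQ : ∀ t, (sobMonic α ℓ L η t).eval (sigma0 ℓ L) ≠ 0) (t : ℕ) : 0 < aCoef α ℓ L η t := by
  have h1 := (dCoef_bounds (ℓ := ℓ) (η := η) hα hL hη t).1
  have h2 := gamProd_pos hα t
  have h3 : 0 < (sobMonic α ℓ L η t).eval (sigma0 ℓ L) ^ 2 := by
    have := hQ t
    positivity
  have h4 : aCoef α ℓ L η t = dCoef α ℓ L η t / xi α t *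
      (sobMonic α ℓ L η t).eval (sigma0 ℓ L) ^ 2 / gamProd α t := by
    rw [aCoef_eq hα hℓ hL hη hQ]
    have := xi_ne_zero hα t
    field_simp
  rw [h4]; positivity

theorem ACoef_succ (α ℓ L η : ℝ) (t : ℕ) :
    ACoef α ℓ L η (t + 1) = ACoef α ℓ L η t + aCoef α ℓ L η (t + 1) :=
  Finset.sum_range_succ _ _

theorem ACoef_pos (hα : -1 / 2 < α) (hℓ : 0 < ℓ) (hL : ℓ < L) (hη : 0 < η)
    (hQ : ∀ t, (sobMonic α ℓ L η t).eval (sigma0 ℓ L) ≠ 0) (t : ℕ) : 0 < ACoef α ℓ L η t :=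
  Finset.sum_pos (fun i _ => aCoef_pos hα hℓ hL hη hQ i) ⟨0, by simp⟩

/-! ## Limits of the coefficients -/

theorem tendsto_gegenRatio (α : ℝ) : Tendsto (gegenRatio α) atTop (𝓝 (1 / 2)) := by
  have h := (tendsto_natCast_ratio (2 * α) 0 0 α).const_mul 2
  norm_num at h
  refine h.congr' ?_
  filter_upwards [eventually_gt_atTop 0] with t ht
  have h1 : (t : ℝ) ≠ 0 := by positivity
  have h2 : t ≠ 0 := ht.ne'
  simp only [gegenRatio, h2, if_false]
  rw [show (4 : ℝ) * t * (t + α) = t * (4 * (t + α)) by ring, mul_comm _ (t : ℝ),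
    mul_div_mul_left _ _ h1, mul_div_assoc']
  rw [show (4 : ℝ) * (t + α) = 2 * (2 * (t + α)) by ring, mul_div_mul_left _ _ two_ne_zero]

/-- The quotients satisfy R_{t+1} = s - γ_{t+1} / R_t with γ → 1/4. The limiting map has the fixed
points 1/(2z) and z/2. The lower bound by `gegenRatio` → 1/2 > z/2 keeps R_t away from the repelling
one. -/
theorem tendsto_eval_gegen_ratio {s z : ℝ} (hα : -1 / 2 < α) (hz0 : 0 < z) (hz1 : z < 1)
    (hs : s = (1 + z ^ 2) / (2 * z)) :
    Tendsto (fun t => (gegen α (t + 1)).eval s / (gegen α t).eval s) atTop (𝓝 (1 / (2 * z))) := by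
  have hs1 : 1 ≤ s := by
    rw [hs, le_div_iff₀ (by positivity)]; nlinarith [sq_nonneg (1 - z)]
  set R : ℕ → ℝ := fun t => (gegen α (t + 1)).eval s / (gegen α t).eval s with hR
  have hpos := eval_gegen_pos hα hs1
  have hRge : ∀ t, gegenRatio α t ≤ R t := fun t => by
    rw [hR, le_div_iff₀ (hpos t)]; exact (gegenRatio_mul_eval_le hα hs1 t).2
  have hRec : ∀ t, R (t + 1) = s - gam α (t + 1) / R t := fun t => by
    have h1 := (hpos t).ne'
    have h2 := (hpos (t + 1)).ne'
    simp only [hR]; rw [eval_gegen_add_two]; field_simp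
  -- The midpoint of z/2 and 1/2: eventually c < R_t, and the contraction factor z / (2c) is below
  -- 1.
  set c := (z + 1) / 4 with hc
  have hc0 : 0 < c := by positivity
  have hev : ∀ᶠ t in atTop, c < gegenRatio α t :=
    (tendsto_gegenRatio α).eventually_const_lt (by rw [hc]; linarith)
  have he : Tendsto (fun t => |1 / 4 - gam α (t + 1)| / c) atTop (𝓝 0) := by
    have h1 := (((tendsto_add_atTop_iff_nat 1).2 (tendsto_gam α)).const_sub (1 / 4)).abs
    simpa using h1.div_const c
  have h0 := tendsto_zero_of_contraction (u := fun t => R t - 1 / (2 * z)) (q := z / (2 * c))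
    (by positivity) (by rw [div_lt_one (by positivity), hc]; linarith) he (by
      filter_upwards [hev] with t ht
      have hRt : c < R t := ht.trans_le (hRge t)
      have hR0 : 0 < R t := hc0.trans hRt
      have h1 : R (t + 1) - 1 / (2 * z) =
          z / (2 * R t) * (R t - 1 / (2 * z)) + (1 / 4 - gam α (t + 1)) / R t := by
        rw [hRec, hs]; field_simp; ring
      rw [h1]
      refine (abs_add_le _ _).trans (add_le_add ?_ ?_)
      · rw [abs_mul, abs_of_nonneg (by positivity : 0 ≤ z / (2 * R t))]
        gcongr
      · rw [abs_div, abs_of_pos hR0]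
        gcongr)
  simpa using h0.add_const (1 / (2 * z))

/-- Limits of the ratios of the values at the origin. -/
theorem tendsto_ratios (hα : -1 / 2 < α) (hℓ : 0 < ℓ) (hL : ℓ < L) :
    Tendsto (fun t => (gegen α t).eval (sigma0 ℓ L) / (gegen α (t + 1)).eval (sigma0 ℓ L)) atTop
      (𝓝 (-(2 * √(hbMomentum ℓ L)))) ∧
    Tendsto (fun t => (gegen α t).eval (sigma0 ℓ L) / (gegen α (t + 2)).eval (sigma0 ℓ L)) atTop
      (𝓝 (4 * hbMomentum ℓ L)) := by
  obtain ⟨hz0, hz1, hm, hs, -⟩ := hb_parameters hℓ hL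
  set z := √(hbMomentum ℓ L)
  rw [hm]
  have h1 := (tendsto_eval_gegen_ratio hα hz0 hz1 hs).inv₀ (by positivity)
  have h2 : Tendsto (fun t => (gegen α t).eval (sigma0 ℓ L) /
      (gegen α (t + 1)).eval (sigma0 ℓ L)) atTop (𝓝 (-(2 * z))) := by
    have h3 := h1.neg
    rw [one_div, inv_inv] at h3
    refine h3.congr fun t => ?_
    have h4 := (eval_gegen_pos hα (one_lt_ratio hℓ hL).le t).ne'
    have h5 := (eval_gegen_pos hα (one_lt_ratio hℓ hL).le (t + 1)).ne'
    rw [sigma0_eq_neg, eval_neg_gegen, eval_neg_gegen, pow_succ]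
    have h6 : ((-1 : ℝ)) ^ t ≠ 0 := by simp
    field_simp
  refine ⟨h2, ?_⟩
  have h3 := h2.mul ((tendsto_add_atTop_iff_nat 1).2 h2)
  rw [show -(2 * z) * -(2 * z) = 4 * z ^ 2 by ring] at h3
  refine h3.congr fun t => ?_
  have h4 := eval_gegen_sigma0_ne_zero hα hℓ hL (t + 1)
  rw [div_mul_div_cancel₀ h4]

/-- The quotient U satisfies U_{t+2} = d_t p_t U_t + 1 - ξ_t p_t with p_t → 4m and ξ_t → 1/4. Since
d_t → 0, boundedness of U suffices to drop the first term. -/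
theorem tendsto_sobMonic_div_gegen (hα : -1 / 2 < α) (hℓ : 0 < ℓ) (hL : ℓ < L) (hη : 0 < η) :
    Tendsto (fun t => (sobMonic α ℓ L η t).eval (sigma0 ℓ L) / (gegen α t).eval (sigma0 ℓ L)) atTop
      (𝓝 (1 - hbMomentum ℓ L)) := by
  obtain ⟨-, hp⟩ := tendsto_ratios hα hℓ hL
  have hd := (tendsto_dCoef (ℓ := ℓ) hα hL hη).1
  set U : ℕ → ℝ := fun t => (sobMonic α ℓ L η t).eval (sigma0 ℓ L) /
    (gegen α t).eval (sigma0 ℓ L) with hU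
  set p : ℕ → ℝ := fun t => (gegen α t).eval (sigma0 ℓ L) /
    (gegen α (t + 2)).eval (sigma0 ℓ L) with hpdef
  have hrec : ∀ t, U (t + 2) = dCoef α ℓ L η t * p t * U t + (1 - xi α t * p t) := fun t => by
    have g0 := eval_gegen_sigma0_ne_zero hα hℓ hL t
    have g2 := eval_gegen_sigma0_ne_zero hα hℓ hL (t + 2)
    simp only [hU, hpdef]
    rw [eval_sobMonic_add_two]; field_simp
  have hdp : Tendsto (fun t => dCoef α ℓ L η t * p t) atTop (𝓝 0) := by simpa using hd.mul hp
  have hlim : Tendsto (fun t => 1 - xi α t * p t) atTop (𝓝 (1 - hbMomentum ℓ L)) := by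
    have := ((tendsto_xi α).mul hp).const_sub 1
    rwa [show 1 / 4 * (4 * hbMomentum ℓ L) = hbMomentum ℓ L by ring] at this
  obtain ⟨B, hB⟩ := hlim.abs.bddAbove_range
  have hev : ∀ᶠ t in atTop, |dCoef α ℓ L η t * p t| < 1 / 2 := by
    have := hdp.abs
    rw [abs_zero] at this
    exact this.eventually_lt_const (by norm_num)
  obtain ⟨N, hN⟩ := eventually_atTop.1 hev
  obtain ⟨D, hD0, hD⟩ := exists_bound_of_recurrence (X := Unit) (f := fun t _ => U t) (k := 2)
    (N := N) (q := 1 / 2) (r := 1) (K := B) one_pos (by norm_num) (by norm_num)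
    (fun t => ⟨_, fun _ => le_rfl⟩) (fun t ht _ => by
      rw [hrec, one_pow, mul_one]
      refine (abs_add_le _ _).trans (add_le_add ?_ (hB ⟨t, rfl⟩))
      rw [abs_mul]
      exact mul_le_mul_of_nonneg_right (hN t ht).le (abs_nonneg _))
  have h0 : Tendsto (fun t => dCoef α ℓ L η t * p t * U t) atTop (𝓝 0) := by
    have h1 : Tendsto (fun t => |dCoef α ℓ L η t * p t| * D) atTop (𝓝 0) := by
      simpa using hdp.abs.mul_const D
    refine squeeze_zero_norm (fun t => ?_) h1
    rw [Real.norm_eq_abs, abs_mul]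
    exact mul_le_mul_of_nonneg_left (by simpa using hD t ()) (abs_nonneg _)
  rw [← tendsto_add_atTop_iff_nat 2]
  have h2 := h0.add hlim
  rw [zero_add] at h2
  exact h2.congr fun t => (hrec t).symm

theorem one_sub_hbMomentum_pos (hℓ : 0 < ℓ) (hL : ℓ < L) : 0 < 1 - hbMomentum ℓ L := by
  obtain ⟨hz0, hz1, hm, -, -⟩ := hb_parameters hℓ hL
  rw [hm]; nlinarith

theorem tendsto_sobMonic_ratio (hα : -1 / 2 < α) (hℓ : 0 < ℓ) (hL : ℓ < L) (hη : 0 < η) :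
    Tendsto (fun t => (sobMonic α ℓ L η t).eval (sigma0 ℓ L) /
      (sobMonic α ℓ L η (t + 1)).eval (sigma0 ℓ L)) atTop (𝓝 (-(2 * √(hbMomentum ℓ L)))) := by
  have hU := tendsto_sobMonic_div_gegen hα hℓ hL hη
  have hm := (one_sub_hbMomentum_pos hℓ hL).ne'
  have h1 := (hU.div ((tendsto_add_atTop_iff_nat 1).2 hU) hm).mul (tendsto_ratios hα hℓ hL).1
  rw [div_self hm, one_mul] at h1
  refine h1.congr fun t => ?_
  have g0 := eval_gegen_sigma0_ne_zero hα hℓ hL t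
  have g2 := eval_gegen_sigma0_ne_zero hα hℓ hL (t + 1)
  simp only [Pi.div_apply]
  field_simp

theorem tendsto_stepSize (hα : -1 / 2 < α) (hℓ : 0 < ℓ) (hL : ℓ < L) :
    Tendsto (stepSize α ℓ L) atTop (𝓝 (hbStep ℓ L)) := by
  obtain ⟨-, -, -, -, hh⟩ := hb_parameters hℓ hL
  rw [← tendsto_add_atTop_iff_nat 1]
  have h1 := ((tendsto_ratios hα hℓ hL).1.const_mul (2 / (L - ℓ))).neg
  rw [show -(2 / (L - ℓ) * -(2 * √(hbMomentum ℓ L))) = hbStep ℓ L by rw [hh]; ring] at h1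
  exact h1.congr fun t => (stepSize_succ hα hℓ hL t).symm

theorem tendsto_momentum (hα : -1 / 2 < α) (hℓ : 0 < ℓ) (hL : ℓ < L) :
    Tendsto (momentum α ℓ L) atTop (𝓝 (hbMomentum ℓ L)) := by
  rw [← tendsto_add_atTop_iff_nat 2]
  have h1 := ((tendsto_add_atTop_iff_nat 1).2 (tendsto_gam α)).mul (tendsto_ratios hα hℓ hL).2
  rw [show 1 / 4 * (4 * hbMomentum ℓ L) = hbMomentum ℓ L by ring] at h1
  exact h1.congr fun t => (momentum_add_two hα hℓ hL t).symm

theorem tendsto_c1 (hα : -1 / 2 < α) (hℓ : 0 < ℓ) (hL : ℓ < L) (hη : 0 < η)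
    (hQ : ∀ t, (sobMonic α ℓ L η t).eval (sigma0 ℓ L) ≠ 0) :
    Tendsto (c1 α ℓ L η) atTop (𝓝 0) := by
  rw [← tendsto_add_atTop_iff_nat 2]
  have h := tendsto_sobMonic_ratio hα hℓ hL hη
  have h1 := (tendsto_dCoef (ℓ := ℓ) hα hL hη).1.mul (h.mul ((tendsto_add_atTop_iff_nat 1).2 h))
  rw [zero_mul] at h1
  refine h1.congr fun t => ?_
  rw [c1, deltaS_add_two hα hℓ hL hQ, Nat.add_sub_cancel, div_mul_div_cancel₀ (hQ (t + 1))]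

theorem tendsto_c2 (hα : -1 / 2 < α) (hℓ : 0 < ℓ) (hL : ℓ < L) (hη : 0 < η)
    (hQ : ∀ t, (sobMonic α ℓ L η t).eval (sigma0 ℓ L) ≠ 0) :
    Tendsto (c2 α ℓ L η) atTop (𝓝 (1 / (1 - hbMomentum ℓ L))) := by
  have h := (tendsto_sobMonic_div_gegen hα hℓ hL hη).inv₀ (one_sub_hbMomentum_pos hℓ hL).ne'
  rw [one_div]
  refine h.congr fun t => ?_
  rw [c2, kap_eq hα hℓ hL hQ, inv_div]

theorem tendsto_c3 (hα : -1 / 2 < α) (hℓ : 0 < ℓ) (hL : ℓ < L) (hη : 0 < η)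
    (hQ : ∀ t, (sobMonic α ℓ L η t).eval (sigma0 ℓ L) ≠ 0) :
    Tendsto (c3 α ℓ L η) atTop (𝓝 (hbMomentum ℓ L / (1 - hbMomentum ℓ L))) := by
  rw [← tendsto_add_atTop_iff_nat 2]
  have h := (tendsto_add_atTop_iff_nat 2).2
    ((tendsto_sobMonic_div_gegen hα hℓ hL hη).inv₀ (one_sub_hbMomentum_pos hℓ hL).ne')
  have h1 := ((tendsto_ratios hα hℓ hL).2.mul h).mul (tendsto_xi α)
  rw [show 4 * hbMomentum ℓ L * (1 - hbMomentum ℓ L)⁻¹ * (1 / 4) =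
    hbMomentum ℓ L / (1 - hbMomentum ℓ L) by ring] at h1
  refine h1.congr fun t => ?_
  rw [c3, tau_add_two hα hℓ hL hQ, Nat.add_sub_cancel, inv_div,
    div_mul_div_cancel₀ (eval_gegen_sigma0_ne_zero hα hℓ hL (t + 2))]

/-- The squared quotient of Q contributes 4m and γ contributes 1/4; the quotient of the
quadratically growing `dDenom` tends to 1. -/
theorem tendsto_aCoef_ratio (hα : -1 / 2 < α) (hℓ : 0 < ℓ) (hL : ℓ < L) (hη : 0 < η)
    (hQ : ∀ t, (sobMonic α ℓ L η t).eval (sigma0 ℓ L) ≠ 0) :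
    Tendsto (fun t => aCoef α ℓ L η t / aCoef α ℓ L η (t + 1)) atTop (𝓝 (hbMomentum ℓ L)) := by
  obtain ⟨-, -, hm, -, -⟩ := hb_parameters hℓ hL
  rw [← tendsto_add_atTop_iff_nat 2]
  have he := etaT_pos hL hη
  have hD := (tendsto_dCoef (ℓ := ℓ) hα hL hη).2
  have hD1 := (tendsto_add_atTop_iff_nat 1).2 hD
  have hr : Tendsto (fun t : ℕ => ((t : ℝ) + 3) ^ 2 / (t + 2) ^ 2) atTop (𝓝 1) := by
    have h1 := (tendsto_natCast_ratio 3 3 2 2).const_mul 4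
    norm_num at h1
    refine h1.congr fun t => ?_
    have : (t : ℝ) + 2 ≠ 0 := by positivity
    field_simp
  have h1 := (((((tendsto_add_atTop_iff_nat 2).2 (tendsto_sobMonic_ratio hα hℓ hL hη)).pow 2).mul
    (hD1.div hD (by positivity))).mul hr).mul ((tendsto_add_atTop_iff_nat 1).2 (tendsto_gam α))
  have h2 : (-(2 * √(hbMomentum ℓ L))) ^ 2 * (etaT ℓ L η / 4 / (etaT ℓ L η / 4)) * 1 * (1 / 4) =
      hbMomentum ℓ L := by
    rw [div_self (by positivity)]; linear_combination -hm
  rw [h2] at h1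
  refine h1.congr fun t => ?_
  have d0 := (dDenom_pos (ℓ := ℓ) hα hL hη t).ne'
  have d1 := (dDenom_pos (ℓ := ℓ) hα hL hη (t + 1)).ne'
  have k0 := (gamProd_pos hα t).ne'
  have g1 := (gam_pos hα t).ne'
  have q2 := hQ (t + 2)
  have q3 := hQ (t + 1 + 2)
  have e3 : t + 2 + 1 = t + 1 + 2 := by omega
  have n2 : (t : ℝ) + 2 ≠ 0 := by positivity
  have n3 : (t : ℝ) + 3 ≠ 0 := by positivity
  have n4 : ((t + 1 : ℕ) : ℝ) + 2 = t + 3 := by push_cast; ring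
  simp only [Pi.div_apply, e3]
  rw [n4, aCoef_add_two hα hℓ hL hη hQ, aCoef_add_two hα hℓ hL hη hQ, gamProd_succ]
  field_simp

/-- The quotient v_t = A_t / a_t satisfies v_{t+1} = 1 + (a_t / a_{t+1}) v_t, whose limiting fixed
point is 1/(1 - m). -/
theorem tendsto_weights (hα : -1 / 2 < α) (hℓ : 0 < ℓ) (hL : ℓ < L) (hη : 0 < η)
    (hQ : ∀ t, (sobMonic α ℓ L η t).eval (sigma0 ℓ L) ≠ 0) :
    Tendsto (fun t => ACoef α ℓ L η t / ACoef α ℓ L η (t + 1)) atTop (𝓝 (hbMomentum ℓ L)) ∧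
      Tendsto (fun t => aCoef α ℓ L η t / ACoef α ℓ L η t) atTop (𝓝 (1 - hbMomentum ℓ L)) := by
  obtain ⟨hz0, -, hm, -, -⟩ := hb_parameters hℓ hL
  have hm1 := one_sub_hbMomentum_pos hℓ hL
  have hm0 : 0 ≤ hbMomentum ℓ L := by rw [hm]; positivity
  have ha := aCoef_pos hα hℓ hL hη hQ
  have hA := ACoef_pos hα hℓ hL hη hQ
  have hv : Tendsto (fun t => ACoef α ℓ L η t / aCoef α ℓ L η t) atTop
      (𝓝 (1 / (1 - hbMomentum ℓ L))) := by
    refine tendsto_of_affine_recurrence (tendsto_aCoef_ratio hα hℓ hL hη hQ)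
      (tendsto_const_nhds (x := (1 : ℝ))) (by rw [abs_of_nonneg hm0]; linarith)
      (by field_simp; ring) (Eventually.of_forall fun t => ?_)
    have h1 := (ha t).ne'
    have h2 := (ha (t + 1)).ne'
    rw [ACoef_succ]; field_simp; ring
  have h2 : Tendsto (fun t => aCoef α ℓ L η t / ACoef α ℓ L η t) atTop
      (𝓝 (1 - hbMomentum ℓ L)) := by
    have := hv.inv₀ (by positivity)
    rw [one_div, inv_inv] at this
    exact this.congr fun t => inv_div _ _
  refine ⟨?_, h2⟩
  have h3 := ((tendsto_add_atTop_iff_nat 1).2 h2).const_sub 1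
  rw [sub_sub_cancel] at h3
  refine h3.congr fun t => ?_
  have := (hA (t + 1)).ne'
  rw [eq_div_iff this, sub_mul, div_mul_cancel₀ _ this, ACoef_succ]; ring

end Values

/-- For `α ≥ 1/2` the orthogonal polynomials do not vanish at the origin. -/
theorem eval_sobMonic_sigma0_ne_zero {α ℓ L η : ℝ} (hα : 1 / 2 ≤ α) (hℓ : 0 < ℓ) (hL : ℓ < L)
    (hη : 0 < η) (t : ℕ) : (sobMonic α ℓ L η t).eval (sigma0 ℓ L) ≠ 0 := by
  rw [sigma0_eq_neg, eval_neg_sobMonic]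
  exact mul_ne_zero (by simp) (eval_sobMonic_pos hα hL hη (one_lt_ratio hℓ hL).le t).ne'

/-! ## Growth of the residual polynomials on `[ℓ, L]` -/

theorem exists_bound_eval (p : ℝ[X]) (a b : ℝ) : ∃ B, ∀ x : Set.Icc a b, |p.eval (x : ℝ)| ≤ B := by
  obtain ⟨B, hB⟩ := isCompact_Icc.exists_bound_of_continuousOn (p.continuous.continuousOn
    (s := Set.Icc a b))
  exact ⟨B, fun x => hB x x.2⟩

/-- The monic Gegenbauer polynomials grow on `[-1, 1]` at most like `2 ^ (-t)`. -/
theorem hasRate_gegen (α : ℝ) :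
    HasRate (1 / 2) fun t (x : Set.Icc (-1 : ℝ) 1) => (gegen α t).eval (x : ℝ) := by
  intro r hr
  set s := (r - 1 / 2) / 2 with hs
  have hs0 : 0 < s := by rw [hs]; linarith
  -- `u` and `v` are the roots of w² - x w + 1/4, the characteristic equation of the limiting
  -- recurrence; on [-1, 1] both have modulus 1/2.
  let u : ℝ → ℂ := fun x => ⟨x / 2, √(1 - x ^ 2) / 2⟩
  let v : ℝ → ℂ := fun x => ⟨x / 2, -(√(1 - x ^ 2) / 2)⟩
  have hu2 : ∀ x ∈ Set.Icc (-1 : ℝ) 1, √(1 - x ^ 2) * √(1 - x ^ 2) = 1 - x ^ 2 := fun x hx =>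
    Real.mul_self_sqrt (by nlinarith [hx.1, hx.2])
  have hu : ∀ x ∈ Set.Icc (-1 : ℝ) 1, ‖u x‖ = 1 / 2 ∧ ‖v x‖ = 1 / 2 := fun x hx => by
    have h := hu2 x hx
    constructor
    · rw [Complex.norm_def, Real.sqrt_eq_iff_mul_self_eq (Complex.normSq_nonneg _) (by norm_num)]
      simp only [u, Complex.normSq_mk]; linarith
    · rw [Complex.norm_def, Real.sqrt_eq_iff_mul_self_eq (Complex.normSq_nonneg _) (by norm_num)]
      simp only [v, Complex.normSq_mk]; linarith
  have hsum : ∀ x : ℝ, (x : ℂ) = u x + v x := fun x => by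
    apply Complex.ext <;> simp [u, v]
  have hprod : ∀ x ∈ Set.Icc (-1 : ℝ) 1, u x * v x = (1 / 4 : ℝ) := fun x hx => by
    have h := hu2 x hx
    apply Complex.ext
    · simp only [u, v, Complex.mul_re, Complex.ofReal_re]; linarith
    · simp only [u, v, Complex.mul_im, Complex.ofReal_im]; ring
  let f : ℕ → ℝ → ℂ := fun t x => (((gegen α t).eval x : ℝ) : ℂ)
  -- Diagonalization would degenerate at x = ±1, where the roots coincide. The recurrence is instead
  -- triangularized, and the weight s makes `W` contract by 1/2 + s, uniformly in x, once |1/4 - γ|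
  -- < s².
  let W : ℕ → Set.Icc (-1 : ℝ) 1 → ℝ := fun t x => ‖f (t + 1) x - u x * f t x‖ + s * ‖f t x‖
  have hev : ∀ᶠ t in atTop, |1 / 4 - gam α (t + 1)| < s ^ 2 := by
    have h1 := (((tendsto_add_atTop_iff_nat 1).2 (tendsto_gam α)).const_sub (1 / 4)).abs
    rw [sub_self, abs_zero] at h1
    exact h1.eventually_lt_const (by positivity)
  obtain ⟨N, hN⟩ := eventually_atTop.1 hev
  have hnorm : ∀ t (x : ℝ), ‖f t x‖ = |(gegen α t).eval x| := fun t x => by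
    simp only [f, Complex.norm_real, Real.norm_eq_abs]
  have hWb : ∀ t, ∃ B, ∀ x, |W t x| ≤ B := fun t => by
    obtain ⟨B, hB⟩ := exists_bound_eval (gegen α t) (-1) 1
    obtain ⟨D, hD⟩ := exists_bound_eval (gegen α (t + 1)) (-1) 1
    refine ⟨(D + 1 / 2 * B) + s * B, fun x => ?_⟩
    rw [abs_of_nonneg (by positivity)]
    refine add_le_add ((norm_sub_le _ _).trans (add_le_add ?_ ?_)) ?_
    · rw [hnorm]; exact hD x
    · rw [norm_mul, (hu x x.2).1, hnorm]
      exact mul_le_mul_of_nonneg_left (hB x) (by norm_num)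
    · rw [hnorm]; exact mul_le_mul_of_nonneg_left (hB x) hs0.le
  obtain ⟨C, hC0, hC⟩ := exists_bound_of_recurrence (f := W) (k := 1) (N := N) (q := 1 / 2 + s)
    (r := r) (K := 0) (by linarith) (by positivity) (by rw [pow_one, hs]; linarith) hWb
    (fun t ht x => by
      rw [abs_of_nonneg (by positivity), abs_of_nonneg (by positivity), zero_mul, add_zero]
      obtain ⟨hu1, hv1⟩ := hu x x.2
      have h1 : f (t + 2) x - u x * f (t + 1) x = v x * (f (t + 1) x - u x * f t x) +
          ((1 / 4 - gam α (t + 1) : ℝ) : ℂ) * f t x := by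
        have h2 : f (t + 2) x = (x : ℂ) * f (t + 1) x - (gam α (t + 1) : ℂ) * f t x := by
          simp only [f]; rw [eval_gegen_add_two]; push_cast; ring
        have h3 := hprod x x.2
        rw [h2, hsum x]
        push_cast at h3 ⊢
        linear_combination f t x * h3
      have h4 : ‖f (t + 2) x - u x * f (t + 1) x‖ ≤
          1 / 2 * ‖f (t + 1) x - u x * f t x‖ + s ^ 2 * ‖f t x‖ := by
        rw [h1]
        refine (norm_add_le _ _).trans (add_le_add ?_ ?_)
        · rw [norm_mul, hv1]
        · rw [norm_mul, Complex.norm_real, Real.norm_eq_abs]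
          exact mul_le_mul_of_nonneg_right (hN t ht).le (norm_nonneg _)
      have h5 : ‖f (t + 1) x‖ ≤ ‖f (t + 1) x - u x * f t x‖ + 1 / 2 * ‖f t x‖ := by
        have h6 := norm_add_le (f (t + 1) x - u x * f t x) (u x * f t x)
        rwa [sub_add_cancel, norm_mul, hu1] at h6
      have h7 := mul_le_mul_of_nonneg_left h5 hs0.le
      change ‖f (t + 2) x - u x * f (t + 1) x‖ + s * ‖f (t + 1) x‖ ≤
        (1 / 2 + s) * (‖f (t + 1) x - u x * f t x‖ + s * ‖f t x‖)
      linarith)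
  refine ⟨C / s, fun t x => ?_⟩
  have h1 := (le_abs_self _).trans (hC t x)
  have h2 : s * |(gegen α t).eval (x : ℝ)| ≤ W t x := by
    rw [← hnorm]; exact le_add_of_nonneg_left (norm_nonneg _)
  rw [div_mul_eq_mul_div, le_div_iff₀ hs0]
  linarith

/-- Coherence is a two-step recurrence for G_t' with coefficient ξ_t → (1/2)² and forcing (t + 2)
G_{t+1}, so differentiation costs no exponential rate. -/
theorem hasRate_derivative_gegen {α : ℝ} (hα : -1 / 2 < α) :
    HasRate (1 / 2) fun t (x : Set.Icc (-1 : ℝ) 1) => (derivative (gegen α t)).eval (x : ℝ) := by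
  have h1 : HasRate (1 / 2) fun t (x : Set.Icc (-1 : ℝ) 1) =>
      ((t + 1 : ℕ) + 1 : ℝ) * (gegen α (t + 1)).eval (x : ℝ) := by
    have := HasRate.mul (by norm_num) zero_le_one HasRate.natCast (hasRate_gegen α)
    rw [one_mul] at this
    exact this.shift (by norm_num)
  refine HasRate.of_recurrence (k := 2) two_ne_zero (by norm_num)
    (fun t => exists_bound_eval _ _ _) (tendsto_xi α) (by norm_num) h1 fun t x => ?_
  have := congrArg (eval (x : ℝ)) (derivative_gegen_sub hα t)
  simp only [eval_sub, eval_mul, eval_C] at this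
  push_cast
  linear_combination this

/-- Families of functionals, bounded on each polynomial, under which Gegenbauer polynomials
transported to `[ℓ, L]` have growth rate `1/2`. -/
structure IsTestFamily {ι : Type*} (ℓ L : ℝ) (J : ι → ℝ[X] →ₗ[ℝ] ℝ) : Prop where
  bounded : ∀ p, ∃ B, ∀ i, |J i p| ≤ B
  rate : ∀ α, -1 / 2 < α → HasRate (1 / 2) fun t i => J i ((gegen α t).comp (toUnit ℓ L))

theorem shift_mem_Icc {ℓ L x : ℝ} (hL : ℓ < L) (hx : x ∈ Set.Icc ℓ L) :
    shift ℓ L x ∈ Set.Icc (-1 : ℝ) 1 := by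
  have := sub_pos.2 hL
  rw [shift, Set.mem_Icc, le_div_iff₀ this, div_le_iff₀ this]
  constructor <;> linarith [hx.1, hx.2]

theorem isTestFamily_eval {ℓ L : ℝ} (hL : ℓ < L) :
    IsTestFamily ℓ L fun x : Set.Icc ℓ L => leval (x : ℝ) where
  bounded p := exists_bound_eval p ℓ L
  rate α _ := by
    have := (hasRate_gegen α).reindex
      fun x : Set.Icc ℓ L => ⟨shift ℓ L x, shift_mem_Icc hL x.2⟩
    simpa only [leval_apply, eval_comp, eval_toUnit] using this

theorem isTestFamily_derivative {ℓ L : ℝ} (hL : ℓ < L) :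
    IsTestFamily ℓ L fun x : Set.Icc ℓ L => leval (x : ℝ) ∘ₗ derivative where
  bounded p := exists_bound_eval (derivative p) ℓ L
  rate α hα := by
    have := ((hasRate_derivative_gegen hα).reindex
      fun x : Set.Icc ℓ L => ⟨shift ℓ L x, shift_mem_Icc hL x.2⟩).const_mul (2 / (L - ℓ))
    have hd : derivative (toUnit ℓ L) = C (2 / (L - ℓ)) := by simp [toUnit]
    simpa only [LinearMap.comp_apply, leval_apply, derivative_comp, eval_mul, hd, eval_C, eval_comp,
      eval_toUnit] using this

/-! ### Growth of residual polynomials and of their derivatives, treated together through test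
functionals. -/

namespace IsTestFamily

variable {ι : Type*} {ℓ L α η : ℝ} {J : ι → ℝ[X] →ₗ[ℝ] ℝ}

theorem map_C_mul (J : ℝ[X] →ₗ[ℝ] ℝ) (a : ℝ) (p : ℝ[X]) : J (C a * p) = a * J p := by
  rw [C_mul', map_smul, smul_eq_mul]

/-- Rate 1/2 of the polynomial times rate 2√m of the reciprocal of its value at σ₀. -/
theorem hasRate_residual (hℓ : 0 < ℓ) (hL : ℓ < L) {q : ℕ → ℝ[X]}
    (hq : HasRate (1 / 2) fun t i => J i ((q t).comp (toUnit ℓ L)))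
    (hq0 : ∀ t, (q t).eval (sigma0 ℓ L) ≠ 0)
    (hr : Tendsto (fun t => (q t).eval (sigma0 ℓ L) / (q (t + 1)).eval (sigma0 ℓ L)) atTop
      (𝓝 (-(2 * √(hbMomentum ℓ L))))) :
    HasRate √(hbMomentum ℓ L) fun t i => J i (residualPoly ℓ L (q t)) := by
  have hz0 := (hb_parameters hℓ hL).1
  have h1 : HasRate (2 * √(hbMomentum ℓ L)) fun t (_ : ι) => ((q t).eval (sigma0 ℓ L))⁻¹ :=
    HasRate.of_ratio (by positivity) (by rw [abs_neg, abs_of_pos (by positivity)])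
      (fun t => by
        have := hq0 t
        have := hq0 (t + 1)
        field_simp) hr
  have h2 := HasRate.mul (by norm_num) (by positivity) h1 hq
  rw [show 2 * √(hbMomentum ℓ L) * (1 / 2) = √(hbMomentum ℓ L) by ring] at h2
  simpa only [residualPoly, map_C_mul] using h2

theorem hasRate_sobMonic (hJ : IsTestFamily ℓ L J) (hα : -1 / 2 < α) (hL : ℓ < L) (hη : 0 < η) :
    HasRate (1 / 2) fun t i => J i ((sobMonic α ℓ L η t).comp (toUnit ℓ L)) := by
  have hg := hJ.rate α hα
  have h1 : HasRate (1 / 2) fun t i => J i ((gegen α (t + 2)).comp (toUnit ℓ L)) +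
      -1 * (xi α t * J i ((gegen α t).comp (toUnit ℓ L))) :=
    ((hg.shift (by norm_num)).shift (by norm_num)).add
      ((hg.smul (by norm_num) (tendsto_xi α)).const_mul (-1))
  refine HasRate.of_recurrence (k := 2) two_ne_zero (by norm_num) (fun t => hJ.bounded _)
    (tendsto_dCoef (ℓ := ℓ) hα hL hη).1 (by norm_num) h1 fun t i => ?_
  rw [sobMonic, add_comp, sub_comp, mul_comp, mul_comp, C_comp, C_comp, map_add, map_sub, map_C_mul,
    map_C_mul]
  ring

/-- The averaging recursion forgets at rate m ≤ √m, so the rate √m of the forcing S_t prevails. -/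
theorem hasRate_average (hJ : IsTestFamily ℓ L J) (hα : -1 / 2 < α) (hℓ : 0 < ℓ) (hL : ℓ < L)
    (hη : 0 < η) (hQ : ∀ t, (sobMonic α ℓ L η t).eval (sigma0 ℓ L) ≠ 0) {P : ℕ → ℝ[X]}
    (hP : ∀ t, P (t + 1) = C (ACoef α ℓ L η t / ACoef α ℓ L η (t + 1)) * P t +
      C (aCoef α ℓ L η (t + 1) / ACoef α ℓ L η (t + 1)) *
        residualPoly ℓ L (sobMonic α ℓ L η (t + 1))) :
    HasRate √(hbMomentum ℓ L) fun t i => J i (P t) := by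
  obtain ⟨hz0, hz1, hm, -, -⟩ := hb_parameters hℓ hL
  obtain ⟨hw1, hw2⟩ := tendsto_weights hα hℓ hL hη hQ
  have hS := hasRate_residual hℓ hL (hJ.hasRate_sobMonic hα hL hη) hQ
    (tendsto_sobMonic_ratio hα hℓ hL hη)
  refine HasRate.of_recurrence (k := 1) one_ne_zero hz0.le (fun t => hJ.bounded _) hw1 ?_
    ((hS.smul hz0.le hw2).shift hz0.le) fun t i => ?_
  · rw [pow_one]
    nth_rw 1 [hm]
    rw [abs_of_nonneg (by positivity)]; nlinarith
  · rw [hP, map_add, map_C_mul, map_C_mul]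

end IsTestFamily

/-! ### Heavy Ball -/

/-- The residual polynomials of Heavy Ball. -/
noncomputable def hbYPoly (ℓ L : ℝ) : ℕ → ℝ[X] := hbY ℓ L (fun p => X * p) 1

/-- The residual polynomials of the averaged Heavy Ball method. -/
noncomputable def hbXPoly (ℓ L : ℝ) : ℕ → ℝ[X] := hbX ℓ L (fun p => X * p) 1

theorem hbYPoly_add_two (ℓ L : ℝ) (t : ℕ) : hbYPoly ℓ L (t + 2) =
    hbYPoly ℓ L (t + 1) - hbStep ℓ L • (X * hbYPoly ℓ L (t + 1)) +
      hbMomentum ℓ L • (hbYPoly ℓ L (t + 1) - hbYPoly ℓ L t) := rfl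

theorem hbXPoly_add_two (ℓ L : ℝ) (t : ℕ) : hbXPoly ℓ L (t + 2) =
    hbYPoly ℓ L (t + 2) + hbMomentum ℓ L • (hbXPoly ℓ L (t + 1) - hbYPoly ℓ L t) := rfl

theorem gam_one_arg (t : ℕ) : gam 1 (t + 1) = 1 / 4 := by
  have h1 := gam_spec (α := 1) (by norm_num) t
  have h2 : ((t : ℝ) + 1) * (t + 2) ≠ 0 := by positivity
  have h3 : ((t : ℝ) + 1) * (t + 2) * (4 * gam 1 (t + 1) - 1) = 0 := by linear_combination h1
  have := (mul_eq_zero.1 h3).resolve_left h2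
  linarith

/-- For α = 1 every γ equals 1/4, and with 2zσ = h x - (1 + z²) the scaling by (-2z) ^ t turns the
Gegenbauer recurrence into that of Heavy Ball. The term (z/2) G_t adjusts the initial values to y₋₁
= y₀. -/
theorem hbYPoly_succ {ℓ L : ℝ} (hℓ : 0 < ℓ) (hL : ℓ < L) (t : ℕ) : hbYPoly ℓ L (t + 1) =
    C ((-(2 * √(hbMomentum ℓ L))) ^ (t + 1)) *
      (gegen 1 (t + 1) + C (√(hbMomentum ℓ L) / 2) * gegen 1 t).comp (toUnit ℓ L) := by
  obtain ⟨hz0, hz1, hm, hs, hh⟩ := hb_parameters hℓ hL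
  have hLl : L - ℓ ≠ 0 := (sub_pos.2 hL).ne'
  set z := √(hbMomentum ℓ L)
  have hsh : ∀ x, 2 * z * shift ℓ L x = hbStep ℓ L * x - (1 + z ^ 2) := fun x => by
    have : shift ℓ L x = 2 * x / (L - ℓ) - (L + ℓ) / (L - ℓ) := by rw [shift]; ring
    rw [this, hs, hh]; field_simp; ring
  refine Polynomial.funext fun x => ?_
  have hx := hsh x
  simp only [eval_mul, eval_C, eval_comp, eval_toUnit, eval_add]
  set σ := shift ℓ L x
  induction t using Nat.twoStepInduction with
  | zero =>
    have h1 : hbYPoly ℓ L 1 = 1 - hbStep ℓ L • (X * 1) := rfl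
    rw [h1]
    simp only [eval_sub, eval_one, eval_smul, eval_mul, eval_X, smul_eq_mul, gegen]
    linear_combination hx
  | one =>
    have h1 : hbYPoly ℓ L 1 = 1 - hbStep ℓ L • (X * 1) := rfl
    have h0 : hbYPoly ℓ L 0 = 1 := rfl
    have h2 := hbYPoly_add_two ℓ L 0
    rw [zero_add, h1, h0] at h2
    rw [h2]
    simp only [eval_sub, eval_one, eval_smul, eval_mul, eval_X, smul_eq_mul, gegen, eval_add, eval_C,
      gam_one_arg, hm]
    have h3 : hbStep ℓ L * x = 2 * z * σ + (1 + z ^ 2) := by linarith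
    linear_combination (hbStep ℓ L * x + 2 * z * σ - 1) * h3
  | more t ih1 ih2 =>
    have e3 := eval_gegen_add_two 1 σ (t + 1)
    have e2 := eval_gegen_add_two 1 σ t
    rw [gam_one_arg] at e3 e2
    have hrec : (hbYPoly ℓ L (t + 3)).eval x = (1 + z ^ 2 - hbStep ℓ L * x) *
        (hbYPoly ℓ L (t + 2)).eval x - z ^ 2 * (hbYPoly ℓ L (t + 1)).eval x := by
      rw [hbYPoly_add_two, hm]
      simp only [eval_add, eval_sub, eval_smul, eval_mul, eval_X, smul_eq_mul]; ring
    have h3 : 1 + z ^ 2 - hbStep ℓ L * x = -(2 * z) * σ := by linarith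
    change (hbYPoly ℓ L (t + 3)).eval x = _
    rw [hrec, ih1, ih2, h3]
    simp only [show t + 1 + 1 = t + 2 from rfl, show t + 2 + 1 = t + 3 from rfl] at *
    rw [e3, e2]
    ring

theorem IsTestFamily.hasRate_hbYPoly {ι : Type*} {ℓ L : ℝ} {J : ι → ℝ[X] →ₗ[ℝ] ℝ}
    (hJ : IsTestFamily ℓ L J) (hℓ : 0 < ℓ) (hL : ℓ < L) :
    HasRate √(hbMomentum ℓ L) fun t i => J i (hbYPoly ℓ L t) := by
  have hz0 := (hb_parameters hℓ hL).1
  refine HasRate.of_shift hz0.le (hJ.bounded _) ?_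
  have hg := hJ.rate 1 (by norm_num)
  have h1 := (hg.shift (by norm_num)).add (hg.const_mul (√(hbMomentum ℓ L) / 2))
  have h2 : HasRate (2 * √(hbMomentum ℓ L)) fun t (_ : ι) =>
      (-(2 * √(hbMomentum ℓ L))) ^ (t + 1) :=
    HasRate.of_ratio (d := fun _ => -(2 * √(hbMomentum ℓ L))) (a := -(2 * √(hbMomentum ℓ L)))
      (by positivity) (by rw [abs_neg, abs_of_pos (by positivity)])
      (fun t => by rw [pow_succ' _ (t + 1)]) tendsto_const_nhds
  have h3 := HasRate.mul (by norm_num) (by positivity) h2 h1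
  rw [show 2 * √(hbMomentum ℓ L) * (1 / 2) = √(hbMomentum ℓ L) by ring] at h3
  simpa only [hbYPoly_succ hℓ hL, IsTestFamily.map_C_mul, add_comp, mul_comp, C_comp, map_add]
    using h3

theorem IsTestFamily.hasRate_hbXPoly {ι : Type*} {ℓ L : ℝ} {J : ι → ℝ[X] →ₗ[ℝ] ℝ}
    (hJ : IsTestFamily ℓ L J) (hℓ : 0 < ℓ) (hL : ℓ < L) :
    HasRate √(hbMomentum ℓ L) fun t i => J i (hbXPoly ℓ L t) := by
  obtain ⟨hz0, hz1, hm, -, -⟩ := hb_parameters hℓ hL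
  have hY := hJ.hasRate_hbYPoly hℓ hL
  refine HasRate.of_shift hz0.le (hJ.bounded _) ?_
  refine HasRate.of_recurrence (k := 1) one_ne_zero hz0.le (fun t => hJ.bounded _)
    (tendsto_const_nhds (x := hbMomentum ℓ L)) ?_
    (((hY.shift hz0.le).shift hz0.le).add (hY.const_mul (-hbMomentum ℓ L))) fun t i => ?_
  · rw [pow_one]
    nth_rw 1 [hm]
    rw [abs_of_nonneg (by positivity)]; nlinarith
  · rw [hbXPoly_add_two, map_add, map_smul, map_sub, smul_eq_mul]; ring

/-! ### Chebyshev -/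

theorem gam_zero_arg (t : ℕ) : gam 0 (t + 2) = 1 / 4 := by
  rw [gam_add_two]; field_simp; ring

theorem chebyshev_T_eq_gegen (t : ℕ) :
    Chebyshev.T ℝ ((t + 1 : ℕ) : ℤ) = C (2 ^ t) * gegen 0 (t + 1) := by
  induction t using Nat.twoStepInduction with
  | zero => simp [gegen]
  | one =>
    have := Chebyshev.T_two ℝ
    norm_num [gegen, gam_one, this]
    refine Polynomial.funext fun x => ?_
    simp; ring
  | more t ih1 ih2 =>
    have h := Chebyshev.T_add_two ℝ ((t + 1 : ℕ) : ℤ)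
    have e1 : ((t + 1 : ℕ) : ℤ) + 2 = ((t + 2 + 1 : ℕ) : ℤ) := by push_cast; ring
    have e2 : ((t + 1 : ℕ) : ℤ) + 1 = ((t + 1 + 1 : ℕ) : ℤ) := by push_cast; ring
    rw [e1, e2, ih1, ih2] at h
    rw [h]
    refine Polynomial.funext fun x => ?_
    rw [gegen.eq_3 0 (t + 1)]
    simp only [eval_sub, eval_mul, eval_C, eval_X, gam_zero_arg, eval_ofNat]
    ring

theorem residual_C_mul (ℓ L : ℝ) {a : ℝ} (ha : a ≠ 0) (q : ℝ[X]) :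
    residualPoly ℓ L (C a * q) = residualPoly ℓ L q := by
  refine Polynomial.funext fun x => ?_
  simp only [residualPoly, eval_mul, eval_C, eval_comp]
  rw [mul_inv]; field_simp

theorem chebResidual_eq_residual (ℓ L : ℝ) (t : ℕ) :
    chebResidual ℓ L t = residualPoly ℓ L (Chebyshev.T ℝ (t : ℤ)) := by
  rw [chebResidual, shift_zero]; rfl

theorem chebResidual_eq (ℓ L : ℝ) (t : ℕ) : chebResidual ℓ L t = residualPoly ℓ L (gegen 0 t) := by
  rw [chebResidual_eq_residual]
  rcases t with _ | t
  · simp [gegen]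
  · rw [chebyshev_T_eq_gegen, residual_C_mul _ _ (by positivity)]

theorem IsTestFamily.hasRate_chebResidual {ι : Type*} {ℓ L : ℝ} {J : ι → ℝ[X] →ₗ[ℝ] ℝ}
    (hJ : IsTestFamily ℓ L J) (hℓ : 0 < ℓ) (hL : ℓ < L) :
    HasRate √(hbMomentum ℓ L) fun t i => J i (chebResidual ℓ L t) := by
  simp only [chebResidual_eq]
  exact hasRate_residual hℓ hL (hJ.rate 0 (by norm_num))
    (eval_gegen_sigma0_ne_zero (by norm_num) hℓ hL) (tendsto_ratios (by norm_num) hℓ hL).1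

/-- This is T_t((z + 1/z)/2) = (z^t + z^{-t})/2 together with parity. -/
theorem eval_chebyshev_T_sigma0 {ℓ L : ℝ} (hℓ : 0 < ℓ) (hL : ℓ < L) (t : ℕ) :
    (Chebyshev.T ℝ (t : ℤ)).eval (sigma0 ℓ L) =
      (-1) ^ t * ((√(hbMomentum ℓ L) ^ t + (√(hbMomentum ℓ L))⁻¹ ^ t) / 2) := by
  obtain ⟨hz0, -, -, hs, -⟩ := hb_parameters hℓ hL
  rw [sigma0_eq_neg, hs]
  set z := √(hbMomentum ℓ L)
  induction t using Nat.twoStepInduction with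
  | zero => simp
  | one => simp; field_simp; ring
  | more t ih1 ih2 =>
    have h := Chebyshev.T_add_two ℝ (t : ℤ)
    push_cast at ih2 ⊢
    rw [h]
    simp only [eval_sub, eval_mul, eval_X, eval_ofNat]
    rw [ih1, ih2]
    simp only [inv_pow, pow_succ]
    field_simp
    ring

theorem sSup_abs_chebResidual {ℓ L : ℝ} (hL : ℓ < L) (t : ℕ) :
    sSup ((fun x => |(chebResidual ℓ L t).eval x|) '' Set.Icc ℓ L) =
      |(Chebyshev.T ℝ (t : ℤ)).eval (sigma0 ℓ L)|⁻¹ := by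
  have hLl : L - ℓ ≠ 0 := (sub_pos.2 hL).ne'
  have he : ∀ x, |(chebResidual ℓ L t).eval x| =
      |(Chebyshev.T ℝ (t : ℤ)).eval (sigma0 ℓ L)|⁻¹ *
        |(Chebyshev.T ℝ (t : ℤ)).eval (shift ℓ L x)| := fun x => by
    rw [chebResidual_eq_residual, residualPoly, eval_mul, eval_C, eval_comp, eval_toUnit, abs_mul,
      abs_inv]
  refine IsGreatest.csSup_eq ⟨⟨L, ⟨hL.le, le_rfl⟩, ?_⟩, ?_⟩
  · have : shift ℓ L L = 1 := by rw [shift, div_eq_one_iff_eq hLl]; ring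
    simp only [he, this, Chebyshev.T_eval_one, abs_one, mul_one]
  · rintro _ ⟨x, hx, rfl⟩
    simp only [he]
    have := Chebyshev.abs_eval_T_real_le_one (t : ℤ) (abs_le.2 (shift_mem_Icc hL hx))
    exact mul_le_of_le_one_right (by positivity) this

theorem tendsto_const_rpow_inv {a : ℝ} (ha : 0 < a) :
    Tendsto (fun t : ℕ => a ^ (1 / (t : ℝ))) atTop (𝓝 1) := by
  have h := (tendsto_const_nhds (x := a) (f := (atTop : Filter ℕ))).rpow
    tendsto_one_div_atTop_nhds_zero_nat (Or.inl ha.ne')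
  simpa using h

/-- The maximum is 2 / (z^t + z^{-t}), which lies between z^t and 2 z^t. -/
theorem tendsto_chebResidual_root {ℓ L : ℝ} (hℓ : 0 < ℓ) (hL : ℓ < L) :
    Tendsto (fun t : ℕ => (sSup ((fun x => |(chebResidual ℓ L t).eval x|) '' Set.Icc ℓ L)) ^
      (1 / (t : ℝ))) atTop (𝓝 √(hbMomentum ℓ L)) := by
  obtain ⟨hz0, hz1, -, -, -⟩ := hb_parameters hℓ hL
  simp only [sSup_abs_chebResidual hL, eval_chebyshev_T_sigma0 hℓ hL]
  set z := √(hbMomentum ℓ L)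
  have hb : ∀ t : ℕ, z ^ t ≤ |(-1) ^ t * ((z ^ t + z⁻¹ ^ t) / 2)|⁻¹ ∧
      |(-1) ^ t * ((z ^ t + z⁻¹ ^ t) / 2)|⁻¹ ≤ 2 * z ^ t := fun t => by
    have h1 : |(-1 : ℝ) ^ t * ((z ^ t + z⁻¹ ^ t) / 2)| = (z ^ t + (z ^ t)⁻¹) / 2 := by
      rw [abs_mul, abs_pow, abs_neg, abs_one, one_pow, one_mul, inv_pow,
        abs_of_pos (by positivity)]
    have h2 : z ^ t ≤ 1 := pow_le_one₀ hz0.le hz1.le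
    have h3 : 0 < z ^ t := by positivity
    rw [h1]
    set w := z ^ t
    have h4 : ((w + w⁻¹) / 2)⁻¹ = 2 * w / (w ^ 2 + 1) := by field_simp
    rw [h4, le_div_iff₀ (by positivity), div_le_iff₀ (by positivity)]
    constructor
    · nlinarith
    · nlinarith [pow_pos h3 3]
  have hroot : ∀ t : ℕ, t ≠ 0 → (z ^ t) ^ (1 / (t : ℝ)) = z := fun t ht => by
    rw [one_div]; exact Real.pow_rpow_inv_natCast hz0.le ht
  have hup : Tendsto (fun t : ℕ => (2 : ℝ) ^ (1 / (t : ℝ)) * z) atTop (𝓝 z) := by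
    simpa using (tendsto_const_rpow_inv two_pos).mul_const z
  refine tendsto_of_tendsto_of_tendsto_of_le_of_le' (tendsto_const_nhds (x := z)) hup ?_ ?_
  · filter_upwards [eventually_ne_atTop 0] with t ht
    rw [← hroot t ht]
    exact Real.rpow_le_rpow (by positivity) (by rw [hroot t ht]; exact (hb t).1) (by positivity)
  · filter_upwards [eventually_ne_atTop 0] with t ht
    calc _ ≤ (2 * z ^ t) ^ (1 / (t : ℝ)) :=
          Real.rpow_le_rpow (by positivity) (hb t).2 (by positivity)
      _ = _ := by rw [Real.mul_rpow (by norm_num) (by positivity), hroot t ht]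

/-! ## The iterates as polynomials in the Hessian -/

section Iterates

variable {E : Type*} [NormedAddCommGroup E] [NormedSpace ℝ E] {H : E →L[ℝ] E} {b xs : E}

theorem apply_add_eq (hxs : H xs + b = 0) (x : E) : H x + b = H (x - xs) := by
  rw [map_sub, eq_sub_iff_add_eq, add_assoc, add_comm b, hxs, add_zero]

theorem aeval_X_mul_apply (H : E →L[ℝ] E) (p : ℝ[X]) (v : E) :
    aeval H (X * p) v = H (aeval H p v) := by
  rw [map_mul, aeval_X, mul_apply_eq_comp]

/-- The error vector of a method with residual polynomial `p` and initial error `v`. -/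
noncomputable def residualMap (H : E →L[ℝ] E) (v : E) : ℝ[X] →ₗ[ℝ] E where
  toFun p := aeval H p v
  map_add' p q := by rw [map_add, add_apply]
  map_smul' a p := by rw [map_smul, smul_apply, RingHom.id_apply]

theorem residualMap_apply (H : E →L[ℝ] E) (v : E) (p : ℝ[X]) :
    residualMap H v p = aeval H p v := rfl

theorem residualMap_X_mul (H : E →L[ℝ] E) (v : E) (p : ℝ[X]) :
    residualMap H v (X * p) = H (residualMap H v p) := aeval_X_mul_apply H p v

theorem residualMap_one (H : E →L[ℝ] E) (v : E) : residualMap H v 1 = v := by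
  rw [residualMap_apply, map_one, one_apply_eq_self]

/-- The algorithm on ℝ[X] with p ↦ X p, started at 1, is universal: evaluation at H and v is linear
and intertwines X with H, hence carries it to the error vectors. -/
theorem momentumIter_eq (hxs : H xs + b = 0) (h m : ℕ → ℝ) (v : E) (t : ℕ) :
    momentumIter h m (fun x => H x + b) (xs + v) t =
      xs + residualMap H v (momentumIter h m (fun p : ℝ[X] => X * p) 1 t) := by
  induction t using Nat.twoStepInduction with
  | zero => simp [momentumIter, residualMap_one]
  | one =>
    simp only [momentumIter, apply_add_eq hxs, map_sub, map_smul, residualMap_X_mul,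
      residualMap_one, add_sub_cancel_left]
    module
  | more t ih1 ih2 =>
    simp only [momentumIter, ih1, ih2]
    simp only [apply_add_eq hxs (xs + _), add_sub_cancel_left]
    simp only [map_add, map_sub, map_smul, residualMap_X_mul]
    module

theorem sobZ_eq (hxs : H xs + b = 0) {α ℓ L η : ℝ}
    (hc : ∀ t, c1 α ℓ L η (t + 2) + c2 α ℓ L η (t + 2) - c3 α ℓ L η (t + 2) = 1) (v : E) (t : ℕ) :
    sobZ α ℓ L η (fun x => H x + b) (xs + v) t =
      xs + residualMap H v (sobZ α ℓ L η (fun p : ℝ[X] => X * p) 1 t) := by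
  have hY : ∀ t, sobY α ℓ L (fun x => H x + b) (xs + v) t =
      xs + residualMap H v (sobY α ℓ L (fun p : ℝ[X] => X * p) 1 t) :=
    momentumIter_eq hxs (stepSize α ℓ L) (momentum α ℓ L) v
  induction t using Nat.twoStepInduction with
  | zero => exact hY 0
  | one => exact hY 1
  | more t ih _ =>
    have h1 : xs = (c1 α ℓ L η (t + 2) + c2 α ℓ L η (t + 2) - c3 α ℓ L η (t + 2)) • xs := by
      rw [hc, one_smul]
    simp only [sobZ, map_add, map_sub, map_smul, ih, hY]
    -- Only the free-standing `xs` on the right is expanded; the second stage fixes it because its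
    -- coefficients sum to 1.
    nth_rw 4 [h1]
    module

theorem sobX_eq (hxs : H xs + b = 0) {α ℓ L η : ℝ}
    (hc : ∀ t, c1 α ℓ L η (t + 2) + c2 α ℓ L η (t + 2) - c3 α ℓ L η (t + 2) = 1)
    (hA : ∀ t, ACoef α ℓ L η t ≠ 0) (v : E) (t : ℕ) :
    sobX α ℓ L η (fun x => H x + b) (xs + v) t =
      xs + residualMap H v (sobX α ℓ L η (fun p : ℝ[X] => X * p) 1 t) := by
  induction t with
  | zero => simp [sobX, residualMap_one]
  | succ t ih =>
    have h1 : xs = (ACoef α ℓ L η t / ACoef α ℓ L η (t + 1) +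
        aCoef α ℓ L η (t + 1) / ACoef α ℓ L η (t + 1)) • xs := by
      rw [← add_div, ← ACoef_succ, div_self (hA _), one_smul]
    simp only [sobX, map_add, map_smul, ih, sobZ_eq hxs hc]
    nth_rw 3 [h1]
    module

theorem hbX_eq (hxs : H xs + b = 0) (ℓ L : ℝ) (v : E) (t : ℕ) :
    hbX ℓ L (fun x => H x + b) (xs + v) t = xs + residualMap H v (hbXPoly ℓ L t) := by
  have hY : ∀ t, hbY ℓ L (fun x => H x + b) (xs + v) t = xs + residualMap H v (hbYPoly ℓ L t) :=
    momentumIter_eq hxs _ _ v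
  induction t using Nat.twoStepInduction with
  | zero => simp [hbXPoly, hbX, residualMap_one]
  | one =>
    have h1 := hY 1
    simpa [hbXPoly, hbX, hbYPoly] using h1
  | more t _ ih =>
    rw [hbXPoly_add_two]
    simp only [hbX, ih, hY, map_add, map_sub, map_smul]
    module

end Iterates

/-! ## The residual polynomials of the three stages -/

section Stages

variable {α ℓ L η : ℝ}

theorem eval_residual (ℓ L : ℝ) (q : ℝ[X]) (x : ℝ) :
    (residualPoly ℓ L q).eval x = q.eval (shift ℓ L x) / q.eval (sigma0 ℓ L) := by
  rw [residualPoly, eval_mul, eval_C, eval_comp, eval_toUnit]; ring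

theorem shift_eq (ℓ L x : ℝ) : shift ℓ L x = 2 / (L - ℓ) * x + sigma0 ℓ L := by
  rw [shift, sigma0]; ring

theorem sobY_poly (hα : -1 / 2 < α) (hℓ : 0 < ℓ) (hL : ℓ < L) (t : ℕ) :
    sobY α ℓ L (fun p : ℝ[X] => X * p) 1 t = residualPoly ℓ L (gegen α t) := by
  refine Polynomial.funext fun x => ?_
  induction t using Nat.twoStepInduction with
  | zero => simp [sobY, momentumIter, residualPoly, gegen]
  | one =>
    have h1 := eval_gegen_sigma0_ne_zero hα hℓ hL 1
    simp only [sobY, momentumIter, mul_one, eval_sub, eval_one, eval_smul, eval_X, smul_eq_mul]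
    rw [show (1 : ℕ) = 0 + 1 from rfl, stepSize_succ hα hℓ hL, eval_residual, shift_eq]
    simp only [gegen, eval_X, eval_one] at h1 ⊢
    field_simp
    ring
  | more t ih1 ih2 =>
    have hrec : sobY α ℓ L (fun p : ℝ[X] => X * p) 1 (t + 2) =
        sobY α ℓ L (fun p : ℝ[X] => X * p) 1 (t + 1) -
          stepSize α ℓ L (t + 2) • (X * sobY α ℓ L (fun p : ℝ[X] => X * p) 1 (t + 1)) +
          momentum α ℓ L (t + 2) • (sobY α ℓ L (fun p : ℝ[X] => X * p) 1 (t + 1) -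
            sobY α ℓ L (fun p : ℝ[X] => X * p) 1 t) := rfl
    have g0 := eval_gegen_sigma0_ne_zero hα hℓ hL t
    have g1 := eval_gegen_sigma0_ne_zero hα hℓ hL (t + 1)
    have g2 := eval_gegen_sigma0_ne_zero hα hℓ hL (t + 2)
    have e2 := eval_gegen_add_two α (shift ℓ L x) t
    have m2 := momentum_add_two hα hℓ hL t
    have m2' := momentum_succ α ℓ L (t + 1)
    rw [delta_succ hα hℓ hL] at m2'
    rw [hrec]
    simp only [eval_add, eval_sub, eval_smul, eval_mul, eval_X, smul_eq_mul, ih1, ih2]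
    rw [stepSize_succ hα hℓ hL (t + 1), eval_residual, eval_residual, eval_residual, e2]
    have hx := shift_eq ℓ L x
    set σ := shift ℓ L x
    set y0 := (gegen α t).eval σ
    set y1 := (gegen α (t + 1)).eval σ
    set v0 := (gegen α t).eval (sigma0 ℓ L)
    set v1 := (gegen α (t + 1)).eval (sigma0 ℓ L)
    set v2 := (gegen α (t + 2)).eval (sigma0 ℓ L)
    change _ = _ * sigma0 ℓ L - 1 at m2'
    -- The momentum is used in two forms: as δ σ₀ - 1 in front of the newer iterate and as a
    -- γ-multiple of a quotient in front of the older one.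
    have e3 : momentum α ℓ L (t + 2) * (y1 / v1 - y0 / v0) =
        (v1 / v2 * sigma0 ℓ L - 1) * (y1 / v1) - gam α (t + 1) * (v0 / v2) * (y0 / v0) := by
      rw [mul_sub]; nth_rw 1 [m2']; rw [m2]
    change y1 / v1 - -(2 / (L - ℓ) * (v1 / v2)) * (x * (y1 / v1)) +
      momentum α ℓ L (t + 2) * (y1 / v1 - y0 / v0) = _
    rw [e3, hx]
    field_simp
    ring

theorem c_sum (hα : -1 / 2 < α) (hℓ : 0 < ℓ) (hL : ℓ < L)
    (hQ : ∀ t, (sobMonic α ℓ L η t).eval (sigma0 ℓ L) ≠ 0) (t : ℕ) :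
    c1 α ℓ L η (t + 2) + c2 α ℓ L η (t + 2) - c3 α ℓ L η (t + 2) = 1 := by
  have h2 := hQ (t + 2)
  have e := eval_sobMonic_add_two α ℓ L η (sigma0 ℓ L) t
  rw [c1, c2, c3, deltaS_add_two hα hℓ hL hQ, kap_eq hα hℓ hL hQ, tau_add_two hα hℓ hL hQ,
    Nat.add_sub_cancel]
  field_simp
  linear_combination -e

theorem sobZ_poly (hα : -1 / 2 < α) (hℓ : 0 < ℓ) (hL : ℓ < L)
    (hQ : ∀ t, (sobMonic α ℓ L η t).eval (sigma0 ℓ L) ≠ 0) (t : ℕ) :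
    sobZ α ℓ L η (fun p : ℝ[X] => X * p) 1 t = residualPoly ℓ L (sobMonic α ℓ L η t) := by
  induction t using Nat.twoStepInduction with
  | zero => rw [sobZ, sobY_poly hα hℓ hL]; rfl
  | one => rw [sobZ, sobY_poly hα hℓ hL]; rfl
  | more t ih _ =>
    rw [sobZ, ih, sobY_poly hα hℓ hL, sobY_poly hα hℓ hL]
    refine Polynomial.funext fun x => ?_
    have h0 := hQ t
    have h2 := hQ (t + 2)
    have g0 := eval_gegen_sigma0_ne_zero hα hℓ hL t
    have g2 := eval_gegen_sigma0_ne_zero hα hℓ hL (t + 2)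
    simp only [eval_add, eval_sub, eval_smul, smul_eq_mul, eval_residual]
    rw [c1, c2, c3, deltaS_add_two hα hℓ hL hQ, kap_eq hα hℓ hL hQ, tau_add_two hα hℓ hL hQ,
      Nat.add_sub_cancel, eval_sobMonic_add_two α ℓ L η (shift ℓ L x)]
    field_simp
    ring

theorem sobX_poly (hα : -1 / 2 < α) (hℓ : 0 < ℓ) (hL : ℓ < L) (hη : 0 < η)
    (hQ : ∀ t, (sobMonic α ℓ L η t).eval (sigma0 ℓ L) ≠ 0) (t : ℕ) :
    sobX α ℓ L η (fun p : ℝ[X] => X * p) 1 t = C (1 / ACoef α ℓ L η t) *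
      ∑ i ∈ Finset.range (t + 1), C (aCoef α ℓ L η i) * residualPoly ℓ L (sobMonic α ℓ L η i) := by
  have hA := fun t => (ACoef_pos hα hℓ hL hη hQ t).ne'
  induction t with
  | zero => simp [sobX, ACoef, aCoef, residualPoly, sobMonic]
  | succ t ih =>
    have h1 : ACoef α ℓ L η t / ACoef α ℓ L η (t + 1) * (1 / ACoef α ℓ L η t) =
        1 / ACoef α ℓ L η (t + 1) := by
      have := hA t
      field_simp
    rw [sobX, ih, sobZ_poly hα hℓ hL hQ, Finset.sum_range_succ _ (t + 1), mul_add, ← C_mul',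
      ← C_mul', ← mul_assoc, ← C_mul, h1, ← mul_assoc (C _) (C _), ← C_mul, one_div_mul_eq_div]

theorem IsTestFamily.hasRate_sobX {ι : Type*} {J : ι → ℝ[X] →ₗ[ℝ] ℝ} (hJ : IsTestFamily ℓ L J)
    (hα : -1 / 2 < α) (hℓ : 0 < ℓ) (hL : ℓ < L) (hη : 0 < η)
    (hQ : ∀ t, (sobMonic α ℓ L η t).eval (sigma0 ℓ L) ≠ 0) :
    HasRate √(hbMomentum ℓ L) fun t i => J i (sobX α ℓ L η (fun p : ℝ[X] => X * p) 1 t) :=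
  hJ.hasRate_average hα hℓ hL hη hQ fun t => by
    rw [sobX, sobZ_poly hα hℓ hL hQ, C_mul', C_mul']

end Stages

/-! ## Quadratic objectives -/

section Quadratic

variable {d : ℕ} {H : EuclideanSpace ℝ (Fin d) →L[ℝ] EuclideanSpace ℝ (Fin d)}
  {b xs : EuclideanSpace ℝ (Fin d)} {ℓ L : ℝ}

theorem hasGradientAt_quadObj (hH : IsSelfAdjoint H) (b x : EuclideanSpace ℝ (Fin d)) :
    HasGradientAt (quadObj H b) (H x + b) x := by
  rw [hasGradientAt_iff_hasFDerivAt]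
  have h1 := ((hasFDerivAt_id (𝕜 := ℝ) x).inner ℝ (H.hasFDerivAt (x := x))).const_mul (1 / 2)
  have h2 := (hasFDerivAt_const (𝕜 := ℝ) b x).inner ℝ (hasFDerivAt_id (𝕜 := ℝ) x)
  refine (h1.add h2).congr_fderiv ?_
  ext v
  have hs : inner ℝ x (H v) = inner ℝ (H x) v :=
    (hH.isSymmetric x v).symm
  simp [fderivInnerCLM_apply, hs, real_inner_comm]
  ring

theorem gradient_quadObj (hH : IsSelfAdjoint H) (b : EuclideanSpace ℝ (Fin d)) :
    gradient (quadObj H b) = fun x => H x + b :=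
  funext fun x => (hasGradientAt_quadObj hH b x).gradient

theorem apply_add_eq_zero_of_isMinOn (hH : IsSelfAdjoint H)
    (hmin : IsMinOn (quadObj H b) Set.univ xs) : H xs + b = 0 := by
  have h1 : IsLocalMin (quadObj H b) xs := hmin.isLocalMin Filter.univ_mem
  have h2 := h1.hasFDerivAt_eq_zero (hasGradientAt_iff_hasFDerivAt.1 (hasGradientAt_quadObj hH b xs))
  exact (map_eq_zero_iff _ (InnerProductSpace.toDual ℝ _).injective).1 h2

theorem isUnit_of_spectrumIn (hℓ : 0 < ℓ) (hspec : SpectrumIn ℓ L H) : IsUnit H := by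
  rw [ContinuousLinearMap.isUnit_iff_isUnit_toLinearMap, LinearMap.isUnit_iff_ker_eq_bot,
    LinearMap.ker_eq_bot']
  intro v hv
  have h1 := (hspec v).1
  have h2 : H v = 0 := hv
  rw [h2, inner_zero_right] at h1
  have h3 : ‖v‖ ^ 2 ≤ 0 := by
    by_contra h
    have := mul_pos hℓ (not_le.1 h)
    linarith
  have h4 : ‖v‖ = 0 := by
    have := sq_nonneg ‖v‖
    exact pow_eq_zero_iff two_ne_zero |>.1 (le_antisymm h3 this)
  exact norm_eq_zero.1 h4

/-- Spectral bound for a polynomial in a self-adjoint operator. -/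
theorem norm_aeval_apply_le (hH : IsSelfAdjoint H) (hspec : SpectrumIn ℓ L H) {p : ℝ[X]} {M : ℝ}
    (hM0 : 0 ≤ M) (hM : ∀ x ∈ Set.Icc ℓ L, |p.eval x| ≤ M) (v : EuclideanSpace ℝ (Fin d)) :
    ‖aeval H p v‖ ≤ M * ‖v‖ := by
  have hT : (H : EuclideanSpace ℝ (Fin d) →ₗ[ℝ] EuclideanSpace ℝ (Fin d)).IsSymmetric :=
    hH.isSymmetric
  set B := hT.eigenvectorBasis rfl with hB
  set lam := hT.eigenvalues rfl with hlam
  have hmem : ∀ i, lam i ∈ Set.Icc ℓ L := fun i => by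
    have h1 := hspec (B i)
    have h2 : H (B i) = lam i • B i := hT.apply_eigenvectorBasis rfl i
    rw [h2, inner_smul_right, real_inner_self_eq_norm_sq, B.norm_eq_one i] at h1
    simpa using h1
  have hcoord : ∀ q : ℝ[X], ∀ w i, B.repr (aeval H q w) i = q.eval (lam i) * B.repr w i := by
    intro q
    induction q using Polynomial.induction_on with
    | C a => intro w i; simp [Algebra.algebraMap_eq_smul_one]
    | add p q hp hq =>
      intro w i
      rw [map_add, add_apply, map_add, PiLp.add_apply, hp, hq, eval_add]; ring
    | monomial n a ih =>
      intro w i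
      have h1 : (C a * X ^ (n + 1) : ℝ[X]) = X * (C a * X ^ n) := by ring
      rw [h1, aeval_X_mul_apply]
      have h2 := hT.eigenvectorBasis_apply_self_apply rfl (aeval H (C a * X ^ n) w) i
      refine h2.trans ?_
      rw [ih, eval_mul (p := X), eval_X, mul_assoc]
      rfl
  have h1 : ∀ w, ‖w‖ ^ 2 = ∑ i, B.repr w i ^ 2 := fun w => by
    rw [← B.repr.norm_map w, EuclideanSpace.norm_sq_eq]
    simp
  have h2 : ‖aeval H p v‖ ^ 2 ≤ (M * ‖v‖) ^ 2 := by
    rw [mul_pow, h1, h1, Finset.mul_sum]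
    refine Finset.sum_le_sum fun i _ => ?_
    rw [hcoord, mul_pow]
    refine mul_le_mul_of_nonneg_right ?_ (sq_nonneg _)
    rw [← sq_abs]
    exact pow_le_pow_left₀ (abs_nonneg _) (hM _ (hmem i)) 2
  exact le_of_sq_le_sq h2 (by positivity)

end Quadratic

/-! ## Jacobians -/

section Jacobian

/-- Without commutation the derivative of H ↦ p(H) is no multiple of p'(H). One derivative D
therefore exists unconditionally, and the formula is claimed only in directions commuting with H. -/
theorem hasFDerivAt_aeval {F A : Type*} [NormedAddCommGroup F] [NormedSpace ℝ F] [NormedRing A]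
    [NormedAlgebra ℝ A] {H : F → A} {θ : F} (hH : DifferentiableAt ℝ H θ) (p : ℝ[X]) :
    ∃ D : F →L[ℝ] A, HasFDerivAt (fun θ' => aeval (H θ') p) D θ ∧
      ∀ v, Commute (fderiv ℝ H θ v) (H θ) →
        D v = aeval (H θ) (derivative p) * fderiv ℝ H θ v := by
  induction p using Polynomial.induction_on with
  | C a => exact ⟨0, by simpa using hasFDerivAt_const _ _, by simp⟩
  | add p q hp hq =>
    obtain ⟨D, hD, hD'⟩ := hp
    obtain ⟨G, hG, hG'⟩ := hq
    refine ⟨D + G, ?_, fun v hv => ?_⟩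
    · simp only [map_add]; exact hD.add hG
    · rw [add_apply, hD' v hv, hG' v hv, derivative_add, map_add, add_mul]
  | monomial n a ih =>
    obtain ⟨D, hD, hD'⟩ := ih
    rw [pow_succ, ← mul_assoc]
    generalize C a * X ^ n = q at *
    have h2 := hD.mul' hH.hasFDerivAt
    refine ⟨_, h2.congr_of_eventuallyEq (Eventually.of_forall fun θ' => ?_), fun v hv => ?_⟩
    · simp only [map_mul, aeval_X, Pi.mul_apply]
    · rw [derivative_mul, derivative_X, mul_one, map_add, map_mul, aeval_X, add_mul, mul_assoc,
        ← hv.eq, ← mul_assoc, ← hD' v hv, add_comm]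
      rfl

theorem frob_nonneg {k d : ℕ} (J : EuclideanSpace ℝ (Fin k) →L[ℝ] EuclideanSpace ℝ (Fin d)) :
    0 ≤ frob J := Real.sqrt_nonneg _

theorem frob_le {k d : ℕ} {J : EuclideanSpace ℝ (Fin k) →L[ℝ] EuclideanSpace ℝ (Fin d)}
    {B : Fin k → ℝ} {r : ℝ} (hr : 0 ≤ r)
    (h : ∀ i, ‖J (EuclideanSpace.single i 1)‖ ≤ r * B i) : frob J ≤ r * √(∑ i, B i ^ 2) := by
  rw [frob]
  have h1 : r * √(∑ i, B i ^ 2) = √(∑ i, (r * B i) ^ 2) := by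
    simp only [mul_pow]
    rw [← Finset.mul_sum, Real.sqrt_mul (sq_nonneg r), Real.sqrt_sq hr]
  rw [h1]
  exact Real.sqrt_le_sqrt (Finset.sum_le_sum fun i _ => pow_le_pow_left₀ (norm_nonneg _) (h i) 2)

/-- A geometric bound at each rate larger than `ρ` bounds the upper limit of the roots by `ρ`. -/
theorem limsup_root_le {u : ℕ → ℝ} (hu : ∀ t, 0 ≤ u t) {ρ : ℝ} (hρ : 0 ≤ ρ)
    (h : ∀ r, ρ < r → ∃ C, ∀ t, u t ≤ C * r ^ t) :
    limsup (fun t : ℕ => ENNReal.ofReal (u t ^ (1 / (t : ℝ)))) atTop ≤ ENNReal.ofReal ρ := by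
  have h1 : Tendsto ENNReal.ofReal (𝓝[>] ρ) (𝓝 (ENNReal.ofReal ρ)) :=
    (ENNReal.continuous_ofReal.tendsto ρ).mono_left nhdsWithin_le_nhds
  refine ge_of_tendsto h1 ?_
  filter_upwards [self_mem_nhdsWithin] with r hr
  have hr0 : 0 < r := hρ.trans_lt hr
  obtain ⟨C, hC⟩ := h r hr
  have hC' : ∀ t, u t ≤ (|C| + 1) * r ^ t := fun t => (hC t).trans
    (mul_le_mul_of_nonneg_right (by linarith [le_abs_self C]) (by positivity))
  -- The t-th root of a positive constant tends to 1, so constants do not affect the rate.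
  have h2 : Tendsto (fun t : ℕ => ENNReal.ofReal ((|C| + 1) ^ (1 / (t : ℝ)) * r)) atTop
      (𝓝 (ENNReal.ofReal r)) := by
    refine (ENNReal.continuous_ofReal.tendsto _).comp ?_
    simpa using (tendsto_const_rpow_inv (by positivity : 0 < |C| + 1)).mul_const r
  rw [← h2.limsup_eq]
  refine limsup_le_limsup ?_
  filter_upwards [eventually_ne_atTop 0] with t ht
  refine ENNReal.ofReal_le_ofReal ?_
  calc u t ^ (1 / (t : ℝ)) ≤ ((|C| + 1) * r ^ t) ^ (1 / (t : ℝ)) :=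
        Real.rpow_le_rpow (hu t) (hC' t) (by positivity)
    _ = _ := by
        rw [Real.mul_rpow (by positivity) (by positivity)]
        congr 1
        rw [one_div]; exact Real.pow_rpow_inv_natCast hr0.le ht

variable {k d : ℕ}
  {H : EuclideanSpace ℝ (Fin k) → EuclideanSpace ℝ (Fin d) →L[ℝ] EuclideanSpace ℝ (Fin d)}
  {b x₀ xs : EuclideanSpace ℝ (Fin k) → EuclideanSpace ℝ (Fin d)} {θ : EuclideanSpace ℝ (Fin k)}
  {ℓ L ρ : ℝ}

/-- Near θ the minimizer is -H⁻¹ b, and inversion is differentiable at the invertible H(θ). -/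
theorem differentiableAt_minimizer (hℓ : 0 < ℓ) (hspec : SpectrumIn ℓ L (H θ))
    (hH : DifferentiableAt ℝ H θ) (hb : DifferentiableAt ℝ b θ)
    (hxs : ∀ᶠ θ' in 𝓝 θ, H θ' (xs θ') + b θ' = 0) : DifferentiableAt ℝ xs θ := by
  have hu := isUnit_of_spectrumIn hℓ hspec
  have h1 : DifferentiableAt ℝ (fun θ' => Ring.inverse (H θ') (-b θ')) θ :=
    ((differentiableAt_inverse hu).comp θ hH).clm_apply hb.neg
  refine h1.congr_of_eventuallyEq ?_
  have h2 : ∀ᶠ θ' in 𝓝 θ, IsUnit (H θ') :=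
    hH.continuousAt.eventually (Units.isOpen.mem_nhds hu)
  filter_upwards [hxs, h2] with θ' h3 h4
  rw [← eq_neg_of_add_eq_zero_left h3, ← mul_apply_eq_comp,
    Ring.inverse_mul_cancel _ h4, one_apply_eq_self]

/-- The product rule; the term with p' is the reason for controlling derivatives of residual
polynomials. -/
theorem differentiableAt_of_residual (hH : DifferentiableAt ℝ H θ) (hx₀ : DifferentiableAt ℝ x₀ θ)
    (hxs : DifferentiableAt ℝ xs θ) {p : ℝ[X]}
    {x : EuclideanSpace ℝ (Fin k) → EuclideanSpace ℝ (Fin d)}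
    (hx : ∀ᶠ θ' in 𝓝 θ, x θ' - xs θ' = aeval (H θ') p (x₀ θ' - xs θ')) :
    DifferentiableAt ℝ x θ ∧ ∀ v, Commute (fderiv ℝ H θ v) (H θ) →
      (fderiv ℝ x θ - fderiv ℝ xs θ) v =
        aeval (H θ) (derivative p) (fderiv ℝ H θ v (x₀ θ - xs θ)) +
          aeval (H θ) p ((fderiv ℝ x₀ θ - fderiv ℝ xs θ) v) := by
  obtain ⟨D, hD, hD'⟩ := hasFDerivAt_aeval hH p
  have h1 := hxs.hasFDerivAt.add (hD.clm_apply (hx₀.hasFDerivAt.sub hxs.hasFDerivAt))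
  have h2 := h1.congr_of_eventuallyEq (f₁ := x) (by
    filter_upwards [hx] with θ' h
    simp only [Pi.add_apply, Pi.sub_apply] at *
    rw [← h]; abel)
  refine ⟨h2.differentiableAt, fun v hv => ?_⟩
  rw [h2.fderiv, add_sub_cancel_left]
  simp only [add_apply, ContinuousLinearMap.comp_apply,
    ContinuousLinearMap.flip_apply, hD' v hv, mul_apply_eq_comp, Pi.sub_apply]
  rw [add_comm]

/-- The Jacobians of iterates given by residual polynomials of rate `ρ` converge with rate `ρ`. -/
theorem jacobianRateLE_of_hasRate (hρ : 0 ≤ ρ) (hsa : IsSelfAdjoint (H θ))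
    (hspec : SpectrumIn ℓ L (H θ)) (hH : DifferentiableAt ℝ H θ) (hx₀ : DifferentiableAt ℝ x₀ θ)
    (hxs : DifferentiableAt ℝ xs θ)
    (hcomm : ∀ i, Commute (fderiv ℝ H θ (EuclideanSpace.single i 1)) (H θ)) {p : ℕ → ℝ[X]}
    (hp : HasRate ρ fun t (x : Set.Icc ℓ L) => (p t).eval (x : ℝ))
    (hp' : HasRate ρ fun t (x : Set.Icc ℓ L) => (derivative (p t)).eval (x : ℝ))
    {x : ℕ → EuclideanSpace ℝ (Fin k) → EuclideanSpace ℝ (Fin d)}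
    (hx : ∀ t, ∀ᶠ θ' in 𝓝 θ, x t θ' - xs θ' = aeval (H θ') (p t) (x₀ θ' - xs θ')) :
    JacobianRateLE x xs θ ρ := by
  refine limsup_root_le (fun t => div_nonneg (frob_nonneg _) (frob_nonneg _)) hρ fun r hr => ?_
  have hr0 := hρ.trans hr.le
  obtain ⟨C, hC0, hC⟩ := hp.exists_nonneg hr hr0
  obtain ⟨D, hD0, hD⟩ := hp'.exists_nonneg hr hr0
  set B : Fin k → ℝ := fun i =>
    D * ‖fderiv ℝ H θ (EuclideanSpace.single i 1) (x₀ θ - xs θ)‖ +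
      C * ‖(fderiv ℝ x₀ θ - fderiv ℝ xs θ) (EuclideanSpace.single i 1)‖ with hB
  refine ⟨√(∑ i, B i ^ 2) / frob (fderiv ℝ (x 0) θ - fderiv ℝ xs θ), fun t => ?_⟩
  rw [div_mul_eq_mul_div, mul_comm]
  refine div_le_div_of_nonneg_right (frob_le (by positivity) fun i => ?_) (frob_nonneg _)
  rw [(differentiableAt_of_residual hH hx₀ hxs (hx t)).2 _ (hcomm i)]
  refine (norm_add_le _ _).trans ?_
  have h1 := norm_aeval_apply_le hsa hspec (p := derivative (p t)) (M := D * r ^ t) (by positivity)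
    (fun y hy => hD t ⟨y, hy⟩) (fderiv ℝ H θ (EuclideanSpace.single i 1) (x₀ θ - xs θ))
  have h2 := norm_aeval_apply_le hsa hspec (p := p t) (M := C * r ^ t) (by positivity)
    (fun y hy => hC t ⟨y, hy⟩) ((fderiv ℝ x₀ θ - fderiv ℝ xs θ) (EuclideanSpace.single i 1))
  refine (add_le_add h1 h2).trans_eq ?_
  rw [hB]; ring

end Jacobian

/-! ### Existence of the orthogonal sequences, and the weights as ratios of norms. -/

section Residuals

variable {α ℓ L η : ℝ}

theorem IsGegenbauerFunctional.norm_gegen {Λ : ℝ[X] →ₗ[ℝ] ℝ} (h : IsGegenbauerFunctional α Λ)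
    (hα : -1 / 2 < α) (t : ℕ) : Λ (gegen α t * gegen α t) = gamProd α t * Λ (1 * 1) := by
  induction t with
  | zero => simp [gegen, gamProd]
  | succ t ih => rw [h.norm_gegen_succ hα, ih, gamProd_succ]; ring

theorem isResidualOrthogonal_gegen (hα : -1 / 2 < α) (hℓ : 0 < ℓ) (hL : ℓ < L) :
    IsResidualOrthogonal α ℓ L 0 fun t => residualPoly ℓ L (gegen α t) :=
  isResidualOrthogonal_residual hα hL le_rfl (natDegree_gegen α)
    (eval_gegen_sigma0_ne_zero hα hℓ hL) fun i j hij => by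
      rw [sobForm_apply, etaT, mul_zero, zero_mul, add_zero]
      exact (isGegenbauerFunctional_gegenFunctional hα hL).gegen_orthogonal hα hij

theorem exists_isResidualOrthogonal (hα : 1 / 2 ≤ α) (hℓ : 0 < ℓ) (hL : ℓ < L) (hη : 0 < η) :
    ∃ S, IsResidualOrthogonal α ℓ L η S := by
  have hα' : -1 / 2 < α := by linarith
  exact ⟨_, isResidualOrthogonal_residual hα' hL hη.le (natDegree_sobMonic α ℓ L η)
    (eval_sobMonic_sigma0_ne_zero hα hℓ hL hη) fun i j hij =>
      (isGegenbauerFunctional_gegenFunctional hα' hL).sobMonic_orthogonal hα' hL hη hij⟩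

/-- Combines d_t ‖Q_t‖² = ξ_t ‖G_t‖² with ‖G_t‖² = γ₁ ⋯ γ_t ‖1‖². -/
theorem aCoef_eq_sobInner_div (hα : -1 / 2 < α) (hℓ : 0 < ℓ) (hL : ℓ < L) (hη : 0 < η)
    (hQ : ∀ t, (sobMonic α ℓ L η t).eval (sigma0 ℓ L) ≠ 0) (t : ℕ) : aCoef α ℓ L η t =
      sobInner α ℓ L η (residualPoly ℓ L (sobMonic α ℓ L η 0)) (residualPoly ℓ L (sobMonic α ℓ L η 0)) /
        sobInner α ℓ L η (residualPoly ℓ L (sobMonic α ℓ L η t))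
          (residualPoly ℓ L (sobMonic α ℓ L η t)) := by
  have hΛ := isGegenbauerFunctional_gegenFunctional (ℓ := ℓ) hα hL
  have h1 := (hΛ.sobMonic_aux hα hL hη t).2
  rw [hΛ.norm_gegen hα] at h1
  have h2 : sobForm (gegenFunctional hα hL) (etaT ℓ L η) (sobMonic α ℓ L η 0)
      (sobMonic α ℓ L η 0) = gegenFunctional hα hL (1 * 1) := by
    simp [sobForm_apply, sobMonic]
  have h3 : (sobMonic α ℓ L η 0).eval (sigma0 ℓ L) = 1 := by simp [sobMonic]
  have hs := sobForm_pos hΛ (etaT_nonneg (ℓ := ℓ) (L := L) hη.le) (sobMonic_monic α ℓ L η t).ne_zero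
  rw [aCoef_eq hα hℓ hL hη hQ, sobInner_residual hα hL, sobInner_residual hα hL, h2, h3]
  have hx := xi_ne_zero hα t
  have hk := (gamProd_pos hα t).ne'
  have hq := hQ t
  field_simp
  linear_combination h1

end Residuals

end SobolevUnroll

/-! ### The main theorem. -/

theorem theorem4 (α ℓ L η : ℝ) (hα : -1 / 2 < α) (hℓ : 0 < ℓ) (hL : ℓ < L) (hη : 0 < η) :
    -- for `α ≥ 1/2` the normalization `S_i(0) = 1` is always possible
    (1 / 2 ≤ α → ∃ S, IsResidualOrthogonal α ℓ L η S) ∧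
    ∀ S : ℕ → ℝ[X], IsResidualOrthogonal α ℓ L η S →
      -- the three-stage recursion realizes the optimal residual polynomials
      (∃ G P : ℕ → ℝ[X],
        IsResidualOrthogonal α ℓ L 0 G ∧
        (∀ t Q, IsOptimalResidual α ℓ L η t Q ↔ Q = P t) ∧
        (∀ t, P t = C (1 / ACoef α ℓ L η t) *
          ∑ i ∈ Finset.range (t + 1), C (aCoef α ℓ L η i) * S i) ∧
        (∀ t, aCoef α ℓ L η t =
          sobInner α ℓ L η (S 0) (S 0) / sobInner α ℓ L η (S t) (S t)) ∧
        ∀ (d : ℕ) (H : EuclideanSpace ℝ (Fin d) →L[ℝ] EuclideanSpace ℝ (Fin d))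
          (b x₀ xs : EuclideanSpace ℝ (Fin d)),
          IsSelfAdjoint H → SpectrumIn ℓ L H → IsMinOn (quadObj H b) Set.univ xs →
          ∀ t, sobY α ℓ L (gradient (quadObj H b)) x₀ t - xs = aeval H (G t) (x₀ - xs) ∧
            sobZ α ℓ L η (gradient (quadObj H b)) x₀ t - xs = aeval H (S t) (x₀ - xs) ∧
            sobX α ℓ L η (gradient (quadObj H b)) x₀ t - xs = aeval H (P t) (x₀ - xs)) ∧
      -- limits of the coefficients
      (Tendsto (stepSize α ℓ L) atTop (𝓝 (hbStep ℓ L)) ∧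
        Tendsto (momentum α ℓ L) atTop (𝓝 (hbMomentum ℓ L)) ∧
        Tendsto (c1 α ℓ L η) atTop (𝓝 0) ∧
        Tendsto (c2 α ℓ L η) atTop (𝓝 (1 / (1 - hbMomentum ℓ L))) ∧
        Tendsto (c3 α ℓ L η) atTop (𝓝 (hbMomentum ℓ L / (1 - hbMomentum ℓ L))) ∧
        Tendsto (fun t => ACoef α ℓ L η t / ACoef α ℓ L η (t + 1)) atTop (𝓝 (hbMomentum ℓ L)) ∧
        Tendsto (fun t => aCoef α ℓ L η t / ACoef α ℓ L η t) atTop (𝓝 (1 - hbMomentum ℓ L))) ∧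
      -- the recursion with the limiting coefficients is an average of Heavy Ball iterates
      (∀ (d : ℕ) (y z x : ℕ → EuclideanSpace ℝ (Fin d)),
        (∀ t, z (t + 2) = (0 : ℝ) • z t + (1 / (1 - hbMomentum ℓ L)) • y (t + 2) -
          (hbMomentum ℓ L / (1 - hbMomentum ℓ L)) • y t) →
        (∀ t, x (t + 2) = hbMomentum ℓ L • x (t + 1) + (1 - hbMomentum ℓ L) • z (t + 2)) →
        ∀ t, x (t + 2) = y (t + 2) + hbMomentum ℓ L • (x (t + 1) - y t)) ∧
      -- asymptotic rate of the Jacobians, and the rate of the Chebyshev method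
      (∀ (k d : ℕ)
        (H : EuclideanSpace ℝ (Fin k) → EuclideanSpace ℝ (Fin d) →L[ℝ] EuclideanSpace ℝ (Fin d))
        (b x₀ xs : EuclideanSpace ℝ (Fin k) → EuclideanSpace ℝ (Fin d))
        (θ : EuclideanSpace ℝ (Fin k)),
        (∀ θ', IsSelfAdjoint (H θ')) → SpectrumIn ℓ L (H θ) →
        DifferentiableAt ℝ H θ → DifferentiableAt ℝ b θ → DifferentiableAt ℝ x₀ θ →
        (∀ i, Commute (fderiv ℝ H θ (EuclideanSpace.single i 1)) (H θ)) →
        (∀ᶠ θ' in 𝓝 θ, IsMinOn (quadObj (H θ') (b θ')) Set.univ (xs θ')) →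
        DifferentiableAt ℝ xs θ ∧
        (∀ t, DifferentiableAt ℝ
          (fun θ' => sobX α ℓ L η (gradient (quadObj (H θ') (b θ'))) (x₀ θ') t) θ) ∧
        (∀ t, DifferentiableAt ℝ
          (fun θ' => hbX ℓ L (gradient (quadObj (H θ') (b θ'))) (x₀ θ') t) θ) ∧
        (fderiv ℝ x₀ θ ≠ fderiv ℝ xs θ →
          JacobianRateLE
            (fun t θ' => sobX α ℓ L η (gradient (quadObj (H θ') (b θ'))) (x₀ θ') t)
            xs θ (√(hbMomentum ℓ L)) ∧
          JacobianRateLE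
            (fun t θ' => hbX ℓ L (gradient (quadObj (H θ') (b θ'))) (x₀ θ') t)
            xs θ (√(hbMomentum ℓ L)) ∧
          ∀ x : ℕ → EuclideanSpace ℝ (Fin k) → EuclideanSpace ℝ (Fin d),
            (∀ᶠ θ' in 𝓝 θ, ∀ t,
              x t θ' - xs θ' = aeval (H θ') (chebResidual ℓ L t) (x₀ θ' - xs θ')) →
            JacobianRateLE x xs θ (√(hbMomentum ℓ L)))) ∧
      Tendsto (fun t : ℕ =>
          (sSup ((fun lam => |(chebResidual ℓ L t).eval lam|) '' Set.Icc ℓ L)) ^ (1 / (t : ℝ)))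
        atTop (𝓝 (√(hbMomentum ℓ L))) := by
  refine ⟨fun h => exists_isResidualOrthogonal h hℓ hL hη, fun S hS => ?_⟩
  have hΛ := isGegenbauerFunctional_gegenFunctional (ℓ := ℓ) hα hL
  have hSq := hS.eq_residual hα hL hη.le (natDegree_sobMonic α ℓ L η)
    (fun i => (sobMonic_monic α ℓ L η i).ne_zero)
    fun i j hij => hΛ.sobMonic_orthogonal hα hL hη hij
  have hQ := fun t => (hSq t).1
  -- From here on the given sequence is the concrete one, and `hQ` makes every explicit coefficient
  -- formula available.
  obtain rfl : S = fun t => residualPoly ℓ L (sobMonic α ℓ L η t) := funext fun t => (hSq t).2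
  have ha := aCoef_eq_sobInner_div hα hℓ hL hη hQ
  have hA := fun t => (ACoef_pos hα hℓ hL hη hQ t).ne'
  have hc := c_sum hα hℓ hL hQ
  obtain ⟨hw1, hw2⟩ := tendsto_weights hα hℓ hL hη hQ
  have hm1 := one_sub_hbMomentum_pos hℓ hL
  refine ⟨⟨fun t => residualPoly ℓ L (gegen α t), fun t => C (1 / ACoef α ℓ L η t) *
      ∑ i ∈ Finset.range (t + 1), C (aCoef α ℓ L η i) * residualPoly ℓ L (sobMonic α ℓ L η i),
      isResidualOrthogonal_gegen hα hℓ hL,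
      fun t Q => isOptimalResidual_iff hα hL hη.le hS ha t Q, fun t => rfl, ha, ?_⟩,
    ⟨tendsto_stepSize hα hℓ hL, tendsto_momentum hα hℓ hL, tendsto_c1 hα hℓ hL hη hQ,
      tendsto_c2 hα hℓ hL hη hQ, tendsto_c3 hα hℓ hL hη hQ, hw1, hw2⟩, ?_, ?_,
    tendsto_chebResidual_root hℓ hL⟩
  · intro d H b x₀ xs hH _ hmin t
    have hxs := apply_add_eq_zero_of_isMinOn hH hmin
    beta_reduce
    rw [gradient_quadObj hH b, ← sobY_poly hα hℓ hL, ← sobZ_poly hα hℓ hL hQ,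
      ← sobX_poly hα hℓ hL hη hQ]
    have e1 : sobY α ℓ L (fun x => H x + b) (xs + (x₀ - xs)) t = _ :=
      momentumIter_eq hxs (stepSize α ℓ L) (momentum α ℓ L) (x₀ - xs) t
    have e2 := sobZ_eq hxs hc (x₀ - xs) t
    have e3 := sobX_eq hxs hc hA (x₀ - xs) t
    rw [add_sub_cancel] at e1 e2 e3
    exact ⟨sub_eq_of_eq_add' e1, sub_eq_of_eq_add' e2, sub_eq_of_eq_add' e3⟩
  · intro d y z x hz hx t
    rw [hx, hz, zero_smul, zero_add, smul_sub, smul_smul, smul_smul, mul_one_div_cancel hm1.ne',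
      mul_div_cancel₀ _ hm1.ne']
    module
  · intro k d H b x₀ xs θ hsa hspec hH hb hx₀ hcomm hmin
    have hxs0 : ∀ᶠ θ' in 𝓝 θ, H θ' (xs θ') + b θ' = 0 :=
      hmin.mono fun θ' h => apply_add_eq_zero_of_isMinOn (hsa θ') h
    have hxs := differentiableAt_minimizer hℓ hspec hH hb hxs0
    have hz0 := (hb_parameters hℓ hL).1.le
    have hev := isTestFamily_eval hL
    have hder := isTestFamily_derivative hL
    have hX : ∀ t, ∀ᶠ θ' in 𝓝 θ,
        sobX α ℓ L η (gradient (quadObj (H θ') (b θ'))) (x₀ θ') t - xs θ' =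
          aeval (H θ') (sobX α ℓ L η (fun p : ℝ[X] => X * p) 1 t) (x₀ θ' - xs θ') := fun t => by
      filter_upwards [hxs0] with θ' h
      have e := sobX_eq h hc hA (x₀ θ' - xs θ') t
      rw [add_sub_cancel] at e
      rw [gradient_quadObj (hsa θ')]
      exact sub_eq_of_eq_add' e
    have hB : ∀ t, ∀ᶠ θ' in 𝓝 θ,
        hbX ℓ L (gradient (quadObj (H θ') (b θ'))) (x₀ θ') t - xs θ' =
          aeval (H θ') (hbXPoly ℓ L t) (x₀ θ' - xs θ') := fun t => by
      filter_upwards [hxs0] with θ' h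
      have e := hbX_eq h ℓ L (x₀ θ' - xs θ') t
      rw [add_sub_cancel] at e
      rw [gradient_quadObj (hsa θ')]
      exact sub_eq_of_eq_add' e
    refine ⟨hxs, fun t => (differentiableAt_of_residual hH hx₀ hxs (hX t)).1,
      fun t => (differentiableAt_of_residual hH hx₀ hxs (hB t)).1, fun _ => ⟨?_, ?_, ?_⟩⟩
    · exact jacobianRateLE_of_hasRate hz0 (hsa θ) hspec hH hx₀ hxs hcomm
        (hev.hasRate_sobX hα hℓ hL hη hQ) (hder.hasRate_sobX hα hℓ hL hη hQ) hX
    · exact jacobianRateLE_of_hasRate hz0 (hsa θ) hspec hH hx₀ hxs hcomm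
        (hev.hasRate_hbXPoly hℓ hL) (hder.hasRate_hbXPoly hℓ hL) hB
    · intro x hx
      exact jacobianRateLE_of_hasRate hz0 (hsa θ) hspec hH hx₀ hxs hcomm
        (hev.hasRate_chebResidual hℓ hL) (hder.hasRate_chebResidual hℓ hL)
        fun t => hx.mono fun θ' h => h t
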